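/- **Setting.** Let $\mathcal G=(\partial\colon E\to G,\triangleright)$ be a Lie crossed module: $G,E$ are finite-dimensional Lie groups with Lie algebras $\mathfrak g,\mathfrak e$, $\partial$ is a smooth homomorphism, and $\triangleright$ is a smooth left action of $G$ on $E$ by automorphisms with $\partial(g\triangleright e)=g\,\partial(e)\,g^{-1}$ and $\partial(e)\triangleright f=efe^{-1}$. The induced maps $\partial\colon\mathfrak e\to\mathfrak g$ and $G\times\mathfrak e\to\mathfrak e$ are denoted by the same symbols. Let $M$ be a smooth (finite-dimensional, Hausdorff) manifold. A smooth square in $M$ is a smooth map $\Gamma\colon[0,1]^2\to M$, $(t,s)\mapsto\Gamma(t,s)$; we write $\gamma_s(t)=\gamma^t(s)=\Gamma(t,s)$. **(1) Bundle form.** Let $\pi\colon P\to M$ be a smooth principal $G$-bundle with a $\mathcal G$-categorical connection $(\omega,m)$, i.e. a connection 1-form $\omega\in\mathcal A^1(P,\mathfrak g)$ and a 2-form $m\in\mathcal A^2(P,\mathfrak e)$ such that $R_g^*m=g^{-1}\triangleright m$ for all $g\in G$, $m$ is horizontal with respect to $\omega$, and $\partial(m)=\Omega=d\omega+\tfrac12\,\omega\wedge^{\mathrm{ad}}\omega$.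 Let $\mathcal H_\omega(\gamma,t,u)$ denote the parallel transport of $u$ along $\gamma|_{[0,t]}$ and $\widetilde v$ the horizontal lift of a tangent vector $v$ of $M$. For a smooth square $\Gamma$, $u\in\pi^{-1}(\Gamma(0,0))$ and $t,s\in[0,1]$ put $u_s=\mathcal H_\omega(\gamma^0,s,u)$ and $u^t=\mathcal H_\omega(\gamma_0,t,u)$. Let $e_\Gamma(u,t,s),f_\Gamma(u,t,s)\in E$ be the solutions of $$\frac{\partial e_\Gamma}{\partial s}(u,t,s)=e_\Gamma(u,t,s)\int_0^t m\Big(\widetilde{\tfrac{\partial}{\partial t'}\gamma_s(t')},\widetilde{\tfrac{\partial}{\partial s}\gamma_s(t')}\Big)_{\mathcal H_\omega(\gamma_s,t',u_s)}dt',\qquad e_\Gamma(u,t,0)=1_E,$$ $$\frac{\partial f_\Gamma}{\partial t}(u,t,s)=f_\Gamma(u,t,s)\int_0^s m\Big(\widetilde{\tfrac{\partial}{\partial s'}\gamma^t(s')},\widetilde{\tfrac{\partial}{\partial t}\gamma^t(s')}\Big)_{\mathcal H_\omega(\gamma^t,s',u^t)}ds',\qquad f_\Gamma(u,0,s)=1_E.$$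 These solutions exist on $[0,1]^2$, are unique, and for all $t,s\in[0,1]$ $$e_\Gamma(u,t,s)\,f_\Gamma(u,t,s)=1_E .$$ **(2) Dihedral covariance.** Let $\mathcal D^2(\mathcal G)$ be the set of squares in $\mathcal G$: tuples $(X,Y,Z,W,e)\in G^4\times E$ (bottom, right, left and top edge, and face) with $\partial(e)^{-1}XY=ZW$. The dihedral group $D_4$ of symmetries of $[0,1]^2$, generated by the anticlockwise rotation $\rho(t,s)=(1-s,t)$ and the interchange $r_{xy}(t,s)=(s,t)$, acts on $\mathcal D^2(\mathcal G)$ by $$\rho(X,Y,Z,W,e)=(Z^{-1},X,W,Y^{-1},Z^{-1}\triangleright e),\qquad r_{xy}(X,Y,Z,W,e)=(Z,W,X,Y,e^{-1}).$$ Let $A\in\mathcal A^1(M,\mathfrak g)$ and $B\in\mathcal A^2(M,\mathfrak e)$ be smooth forms with $\partial(B)=dA+\tfrac12A\wedge^{\mathrm{ad}}A$. For a curve $\gamma\colon[0,1]\to M$ let $g_\gamma(t)\in G$ be the solution of $\frac{d}{dt}g_\gamma(t)=g_\gamma(t)\,A(\dot\gamma(t))$, $g_\gamma(0)=1_G$.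 For a smooth square $\Gamma$ let $e^{(A,B)}_\Gamma(t,s)\in E$ be the solution of $$\frac{\partial}{\partial s}e^{(A,B)}_\Gamma(t,s)=e^{(A,B)}_\Gamma(t,s)\int_0^t\big(g_{\gamma^0}(s)\,g_{\gamma_s}(t')\big)\triangleright B\Big(\tfrac{\partial}{\partial t'}\gamma_s(t'),\tfrac{\partial}{\partial s}\gamma_s(t')\Big)dt',\qquad e^{(A,B)}_\Gamma(t,0)=1_E .$$ Then $$\mathcal H^{(A,B)}(\Gamma)=\big(g_{\gamma_0}(1),\,g_{\gamma^1}(1),\,g_{\gamma^0}(1),\,g_{\gamma_1}(1),\,e^{(A,B)}_\Gamma(1,1)\big)$$ is a well-defined map from smooth squares in $M$ to $\mathcal D^2(\mathcal G)$, and for every $r\in D_4$ and every smooth square $\Gamma$ in $M$ $$\mathcal H^{(A,B)}(\Gamma\circ r^{-1})=r\big(\mathcal H^{(A,B)}(\Gamma)\big).$$ -/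

import Mathlib

open Set Manifold ContDiff

noncomputable section

/-! ### The dihedral group of the square and its actions -/

/-- The homomorphism from the dihedral group of order 8 determined by a "rotation" `ρ` and a
"reflection" `σ`; it sends `r i` to `ρ ^ i` and `sr i` to `σ * ρ ^ i`. -/
def dihedralHom {α : Type*} (ρ σ : Equiv.Perm α) (hρ : ρ ^ 4 = 1) (hσ : σ * σ = 1)
    (hσρ : ρ * σ = σ * ρ⁻¹) : DihedralGroup 4 →* Equiv.Perm α :=
  have key : ∀ k : ℕ, ρ ^ (k % 4) = ρ ^ k := fun k => by
    conv_rhs => rw [← Nat.mod_add_div k 4, pow_add, pow_mul, hρ, one_pow, mul_one]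
  have hadd : ∀ i j : ZMod 4, ρ ^ (i + j).val = ρ ^ i.val * ρ ^ j.val := fun i j => by
    rw [ZMod.val_add, key, pow_add]
  have hsub : ∀ i j : ZMod 4, ρ ^ (j - i).val = (ρ ^ i.val)⁻¹ * ρ ^ j.val := fun i j => by
    rw [eq_inv_mul_iff_mul_eq, ← hadd, add_sub_cancel]
  have hcomm : ∀ k : ℕ, ρ ^ k * σ = σ * (ρ ^ k)⁻¹ := fun k => by
    induction k with
    | zero => simp
    | succ k ih =>
      rw [pow_succ, mul_assoc, hσρ, ← mul_assoc, ih, mul_assoc, ← mul_inv_rev,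
        ← pow_succ', pow_succ]
  { toFun := fun g => match g with
      | .r i => ρ ^ i.val
      | .sr i => σ * ρ ^ i.val
    map_one' := by
      change ρ ^ (0 : ZMod 4).val = 1
      simp
    map_mul' := by
      rintro (i | i) (j | j)
      · exact hadd i j
      · change σ * ρ ^ (j - i).val = ρ ^ i.val * (σ * ρ ^ j.val)
        rw [hsub, ← mul_assoc, ← mul_assoc, hcomm]
      · change σ * ρ ^ (i + j).val = σ * ρ ^ i.val * ρ ^ j.val
        rw [hadd, mul_assoc]
      · change ρ ^ (j - i).val = σ * ρ ^ i.val * (σ * ρ ^ j.val)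
        rw [hsub, mul_assoc, ← mul_assoc (ρ ^ i.val), hcomm, ← mul_assoc, ← mul_assoc, hσ,
          one_mul] }

/-- Anticlockwise rotation of the plane by 90 degrees about the centre of the unit square. -/
def planeRot : Equiv.Perm (ℝ × ℝ) where
  toFun p := (1 - p.2, p.1)
  invFun p := (p.2, 1 - p.1)
  left_inv p := by simp
  right_inv p := by simp

/-- Interchange of coordinates, i.e. reflection in the diagonal. -/
def planeSwap : Equiv.Perm (ℝ × ℝ) := Equiv.prodComm ℝ ℝ

/-- The action of the dihedral group on the plane by symmetries of the unit square: `r 1` acts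
as anticlockwise rotation by 90 degrees and `sr 0` as interchange of coordinates. -/
def planeAction : DihedralGroup 4 →* Equiv.Perm (ℝ × ℝ) :=
  dihedralHom planeRot planeSwap
    (by ext p <;> simp [pow_succ, planeRot])
    (by ext p <;> simp [planeSwap])
    (by
      rw [eq_mul_inv_iff_mul_eq]
      ext p <;> simp [planeSwap, planeRot])

/-- The closed unit square `[0,1]²`. -/
def unitSquare : Set (ℝ × ℝ) := Icc 0 1 ×ˢ Icc 0 1

theorem planeAction_good (r : DihedralGroup 4) :
    ContDiff ℝ ∞ (planeAction r) ∧ MapsTo (planeAction r) unitSquare unitSquare := by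
  have hmul : ∀ p q : Equiv.Perm (ℝ × ℝ),
      (ContDiff ℝ ∞ p ∧ MapsTo p unitSquare unitSquare) →
      (ContDiff ℝ ∞ q ∧ MapsTo q unitSquare unitSquare) →
      (ContDiff ℝ ∞ (p * q : Equiv.Perm (ℝ × ℝ)) ∧
        MapsTo (p * q : Equiv.Perm (ℝ × ℝ)) unitSquare unitSquare) :=
    fun p q hp hq => ⟨hp.1.comp hq.1, hp.2.comp hq.2⟩
  have hone : ContDiff ℝ ∞ (1 : Equiv.Perm (ℝ × ℝ)) ∧
      MapsTo (1 : Equiv.Perm (ℝ × ℝ)) unitSquare unitSquare :=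
    ⟨contDiff_id, fun _ h => h⟩
  have hrot : ContDiff ℝ ∞ planeRot ∧ MapsTo planeRot unitSquare unitSquare := by
    constructor
    · exact (contDiff_const.sub contDiff_snd).prodMk contDiff_fst
    · rintro ⟨t, s⟩ ⟨⟨h1, h2⟩, ⟨h3, h4⟩⟩
      simp only [planeRot, unitSquare, mem_prod, mem_Icc, Equiv.coe_fn_mk] at *
      exact ⟨⟨by linarith, by linarith⟩, h1, h2⟩
  have hswap : ContDiff ℝ ∞ planeSwap ∧ MapsTo planeSwap unitSquare unitSquare :=
    ⟨contDiff_snd.prodMk contDiff_fst, fun p h => ⟨h.2, h.1⟩⟩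
  have hpow : ∀ k : ℕ, ContDiff ℝ ∞ (planeRot ^ k : Equiv.Perm (ℝ × ℝ)) ∧
      MapsTo (planeRot ^ k : Equiv.Perm (ℝ × ℝ)) unitSquare unitSquare := fun k => by
    induction k with
    | zero => exact hone
    | succ k ih => rw [pow_succ]; exact hmul _ _ ih hrot
  rcases r with i | i
  · exact hpow i.val
  · exact hmul _ _ hswap (hpow i.val)

/-! ### Squares in a manifold and differential forms -/

section Forms

variable {V : Type*} [NormedAddCommGroup V] [NormedSpace ℝ V]
  {N : Type*} [TopologicalSpace N] [ChartedSpace V N]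

variable (V N) in
/-- Smooth squares `Γ : [0,1]² → N`. The map is written as a function on the plane; only its
values on the unit square are ever used. -/
structure SmoothSquare where
  toFun : ℝ × ℝ → N
  smooth : ContMDiffOn 𝓘(ℝ, ℝ × ℝ) 𝓘(ℝ, V) ∞ toFun unitSquare

/-- The square `Γ ∘ r⁻¹`, for `r` in the dihedral group. -/
def SmoothSquare.transform (Γ : SmoothSquare V N) (r : DihedralGroup 4) : SmoothSquare V N where
  toFun := Γ.toFun ∘ planeAction r⁻¹
  smooth := Γ.smooth.comp (planeAction_good r⁻¹).1.contMDiff.contMDiffOn (planeAction_good r⁻¹).2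

/-- The velocity `dc/dt` at time `t` of a curve `c : [0,1] → N` (one-sided at the end points). -/
def velocity (c : ℝ → N) (t : ℝ) : TangentSpace 𝓘(ℝ, V) (c t) :=
  mfderivWithin 𝓘(ℝ, ℝ) 𝓘(ℝ, V) c (Icc 0 1) t (1 : ℝ)

/-- The curve `c : [0,1] → N` is differentiable at time `t`, with velocity `v`. -/
def HasVelocity (c : ℝ → N) (t : ℝ) (v : TangentSpace 𝓘(ℝ, V) (c t)) : Prop :=
  HasMFDerivWithinAt 𝓘(ℝ, ℝ) 𝓘(ℝ, V) c (Icc 0 1) t ((1 : ℝ →L[ℝ] ℝ).smulRight v)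

variable (V N) in
/-- `F`-valued differential `k`-forms on `N` (not assumed to be smooth). -/
abbrev DiffForm (k : ℕ) (F : Type*) [NormedAddCommGroup F] [NormedSpace ℝ F] :=
  (x : N) → (TangentSpace 𝓘(ℝ, V) x) [⋀^Fin k]→L[ℝ] F

variable {F : Type*} [NormedAddCommGroup F] [NormedSpace ℝ F] {k : ℕ}

/-- The coordinate expression of a differential form in the preferred chart at `x`, i.e. its
pull-back along the inverse of the chart. -/
def DiffForm.inChart (α : DiffForm V N k F) (x : N) : V → V [⋀^Fin k]→L[ℝ] F := fun y =>
  (α ((extChartAt 𝓘(ℝ, V) x).symm y)).compContinuousLinearMap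
    (mfderiv 𝓘(ℝ, V) 𝓘(ℝ, V) (extChartAt 𝓘(ℝ, V) x).symm y)

/-- A differential form is smooth if all its coordinate expressions are. -/
def DiffForm.IsSmooth (α : DiffForm V N k F) : Prop :=
  ∀ x : N, ContDiffOn ℝ ∞ (α.inChart x) (extChartAt 𝓘(ℝ, V) x).target

/-- The exterior derivative of a differential form, computed in the preferred chart at each
point. -/
def DiffForm.extd (α : DiffForm V N k F) : DiffForm V N (k + 1) F := fun x =>
  (extDeriv (α.inChart x) (extChartAt 𝓘(ℝ, V) x x)).compContinuousLinearMap
    (mfderiv 𝓘(ℝ, V) 𝓘(ℝ, V) (extChartAt 𝓘(ℝ, V) x) x)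

end Forms

/-! ### Lie groups

The Lie algebra `𝔤` of a Lie group `G` modelled on `VG` is `T₁G`, whose underlying normed space
is `VG` itself (this is how `GroupLieAlgebra` is defined). Lie algebra valued forms are
`VG`-valued forms. -/

section LieGroups

variable {VG : Type*} [NormedAddCommGroup VG] [NormedSpace ℝ VG]
  {G : Type*} [TopologicalSpace G] [ChartedSpace VG G] [Group G]

/-- The tangent vector `g X` at `g`, for `X` in the Lie algebra: the value at `g` of the left
invariant vector field determined by `X`. -/
def leftMul (g : G) (X : VG) : TangentSpace 𝓘(ℝ, VG) g :=
  mulInvariantVectorField (I := 𝓘(ℝ, VG)) (G := G) X g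

variable (G) in
/-- The Lie bracket of the Lie algebra of `G`. -/
def lieBr (X Y : VG) : VG :=
  Bracket.bracket (L := GroupLieAlgebra 𝓘(ℝ, VG) G) (M := GroupLieAlgebra 𝓘(ℝ, VG) G) X Y

/-- The adjoint action `g X g⁻¹`. -/
def adj (g : G) (X : VG) : VG :=
  mfderiv 𝓘(ℝ, VG) 𝓘(ℝ, VG) (fun h : G => g * h * g⁻¹) 1 X

variable {V : Type*} [NormedAddCommGroup V] [NormedSpace ℝ V]
  {N : Type*} [TopologicalSpace N] [ChartedSpace V N]

variable (G) in
/-- The curvature `Ω = dα + ½ α ∧^ad α` of a Lie algebra valued 1-form, that is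
`Ω(X, Y) = dα(X, Y) + [α(X), α(Y)]`. -/
def curvature (α : DiffForm V N 1 VG) (x : N) (X Y : TangentSpace 𝓘(ℝ, V) x) : VG :=
  α.extd x ![X, Y] + lieBr G (α x ![X]) (α x ![Y])

end LieGroups

/-! ### Lie crossed modules and their squares -/

section CrossedModules

variable (VG : Type*) [NormedAddCommGroup VG] [NormedSpace ℝ VG]
  (VE : Type*) [NormedAddCommGroup VE] [NormedSpace ℝ VE]
  (G : Type*) [TopologicalSpace G] [ChartedSpace VG G] [Group G]
  (E : Type*) [TopologicalSpace E] [ChartedSpace VE E] [Group E]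

/-- A Lie crossed module `(∂ : E → G, ▷)`. -/
structure LieCrossedModule where
  bd : E →* G
  act : G →* MulAut E
  smooth_bd : ContMDiff 𝓘(ℝ, VE) 𝓘(ℝ, VG) ∞ bd
  smooth_act : ContMDiff (𝓘(ℝ, VG).prod 𝓘(ℝ, VE)) 𝓘(ℝ, VE) ∞
    (fun p : G × E => act p.1 p.2)
  bd_act : ∀ (g : G) (e : E), bd (act g e) = g * bd e * g⁻¹
  peiffer : ∀ e f : E, act (bd e) f = e * f * e⁻¹

variable {VG VE G E}

namespace LieCrossedModule

/-- The differential `∂ : 𝔢 → 𝔤`. -/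
def bdLie (𝒢 : LieCrossedModule VG VE G E) (v : VE) : VG :=
  mfderiv 𝓘(ℝ, VE) 𝓘(ℝ, VG) 𝒢.bd 1 v

/-- The induced action of `G` on `𝔢`. -/
def actLie (𝒢 : LieCrossedModule VG VE G E) (g : G) (v : VE) : VE :=
  mfderiv 𝓘(ℝ, VE) 𝓘(ℝ, VE) (fun e : E => 𝒢.act g e) 1 v

/-- The squares in `𝒢`: bottom edge `X`, right edge `Y`, left edge `Z`, top edge `W`, and
`e : E` with `∂(e)⁻¹ X Y = Z W`. -/
@[ext]
structure Square (𝒢 : LieCrossedModule VG VE G E) where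
  X : G
  Y : G
  Z : G
  W : G
  e : E
  flat : (𝒢.bd e)⁻¹ * X * Y = Z * W

variable {𝒢 : LieCrossedModule VG VE G E}

/-- Anticlockwise rotation of a square by 90 degrees. -/
def Square.rot (q : 𝒢.Square) : 𝒢.Square where
  X := q.Z⁻¹
  Y := q.X
  Z := q.W
  W := q.Y⁻¹
  e := 𝒢.act q.Z⁻¹ q.e
  flat := by
    have h := q.flat
    rw [𝒢.bd_act]
    have h2 : (𝒢.bd q.e)⁻¹ * q.X = q.Z * q.W * q.Y⁻¹ := by rw [← h]; group
    calc (q.Z⁻¹ * 𝒢.bd q.e * q.Z⁻¹⁻¹)⁻¹ * q.Z⁻¹ * q.X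
        = q.Z⁻¹ * ((𝒢.bd q.e)⁻¹ * q.X) := by group
      _ = q.W * q.Y⁻¹ := by rw [h2]; group

/-- Reflection of a square in the diagonal. -/
def Square.swap (q : 𝒢.Square) : 𝒢.Square where
  X := q.Z
  Y := q.W
  Z := q.X
  W := q.Y
  e := q.e⁻¹
  flat := by
    rw [map_inv, inv_inv, mul_assoc, ← q.flat]
    group

theorem Square.swap_swap (q : 𝒢.Square) : q.swap.swap = q := by
  ext <;> simp [Square.swap]

theorem Square.rot_rot_rot_rot (q : 𝒢.Square) : q.rot.rot.rot.rot = q := by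
  have h : q.X * q.Y * q.W⁻¹ * q.Z⁻¹ = 𝒢.bd q.e := by
    have h1 : q.X * q.Y = 𝒢.bd q.e * (q.Z * q.W) := by rw [← q.flat]; group
    rw [h1]; group
  ext
  · simp [Square.rot]
  · simp [Square.rot]
  · simp [Square.rot]
  · simp [Square.rot]
  · have : q.rot.rot.rot.rot.e = 𝒢.act (q.X * q.Y * q.W⁻¹ * q.Z⁻¹) q.e := by
      simp [Square.rot, map_mul, MulAut.mul_apply]
    rw [this, h, 𝒢.peiffer]
    group

theorem Square.swap_rot_swap_rot (q : 𝒢.Square) : q.rot.swap.rot.swap = q := by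
  ext <;> simp [Square.swap, Square.rot]

/-- `Square.rot` as a permutation of the set of squares. -/
def Square.rotPerm (𝒢 : LieCrossedModule VG VE G E) : Equiv.Perm 𝒢.Square where
  toFun := Square.rot
  invFun q := q.rot.rot.rot
  left_inv := Square.rot_rot_rot_rot
  right_inv := Square.rot_rot_rot_rot

/-- `Square.swap` as a permutation of the set of squares. -/
def Square.swapPerm (𝒢 : LieCrossedModule VG VE G E) : Equiv.Perm 𝒢.Square where
  toFun := Square.swap
  invFun := Square.swap
  left_inv := Square.swap_swap
  right_inv := Square.swap_swap

/-- The action of the dihedral group on the squares in `𝒢`. -/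
def squareAction (𝒢 : LieCrossedModule VG VE G E) : DihedralGroup 4 →* Equiv.Perm 𝒢.Square :=
  dihedralHom (Square.rotPerm 𝒢) (Square.swapPerm 𝒢)
    (Equiv.ext Square.rot_rot_rot_rot) (Equiv.ext Square.swap_swap)
    (by
      rw [eq_mul_inv_iff_mul_eq]
      refine Equiv.ext fun q => ?_
      have h := Square.swap_rot_swap_rot q
      have h2 := congrArg Square.swap h
      rw [Square.swap_swap] at h2
      exact h2)

end LieCrossedModule

end CrossedModules

/-! ### Principal bundles and categorical connections -/

section Bundles

variable (VG : Type*) [NormedAddCommGroup VG] [NormedSpace ℝ VG]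
  (VM : Type*) [NormedAddCommGroup VM] [NormedSpace ℝ VM]
  (VP : Type*) [NormedAddCommGroup VP] [NormedSpace ℝ VP]
  (G : Type*) [TopologicalSpace G] [ChartedSpace VG G] [Group G]
  (M : Type*) [TopologicalSpace M] [ChartedSpace VM M]
  (P : Type*) [TopologicalSpace P] [ChartedSpace VP P]

/-- A smooth principal `G`-bundle `P → M`: a smooth right action of `G` on `P` and a smooth
projection which is locally, equivariantly and smoothly, `U × G → U`. -/
structure SmoothPrincipalBundle where
  proj : P → M
  act : P → G → P
  act_one : ∀ u, act u 1 = u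
  act_mul : ∀ u g h, act u (g * h) = act (act u g) h
  smooth_proj : ContMDiff 𝓘(ℝ, VP) 𝓘(ℝ, VM) ∞ proj
  smooth_act : ContMDiff (𝓘(ℝ, VP).prod 𝓘(ℝ, VG)) 𝓘(ℝ, VP) ∞ (fun p : P × G => act p.1 p.2)
  proj_act : ∀ u g, proj (act u g) = proj u
  locallyTrivial : ∀ x : M, ∃ e : Bundle.Trivialization G proj, x ∈ e.baseSet ∧
    ContMDiffOn 𝓘(ℝ, VP) (𝓘(ℝ, VM).prod 𝓘(ℝ, VG)) ∞ e e.source ∧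
    ContMDiffOn (𝓘(ℝ, VM).prod 𝓘(ℝ, VG)) 𝓘(ℝ, VP) ∞ e.toOpenPartialHomeomorph.symm e.target ∧
    ∀ u ∈ e.source, ∀ g : G, e (act u g) = ((e u).1, (e u).2 * g)

variable {VG VM VP G M P}

namespace SmoothPrincipalBundle

/-- The vertical vector `A^#` at `u`, for `A` in the Lie algebra of `G`. -/
def vert (𝓟 : SmoothPrincipalBundle VG VM VP G M P) (A : VG) (u : P) : TangentSpace 𝓘(ℝ, VP) u :=
  mfderiv 𝓘(ℝ, VG) 𝓘(ℝ, VP) (fun g : G => 𝓟.act u g) 1 A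

/-- The differential at `u` of the right translation `R_g`. -/
def dR (𝓟 : SmoothPrincipalBundle VG VM VP G M P) (g : G) (u : P) (X : TangentSpace 𝓘(ℝ, VP) u) :
    TangentSpace 𝓘(ℝ, VP) (𝓟.act u g) :=
  mfderiv 𝓘(ℝ, VP) 𝓘(ℝ, VP) (fun v : P => 𝓟.act v g) u X

/-- The horizontal projection `X ↦ X^H` determined by a connection 1-form `θ`. -/
def horProj (𝓟 : SmoothPrincipalBundle VG VM VP G M P) (θ : DiffForm VP P 1 VG) (u : P)
    (X : TangentSpace 𝓘(ℝ, VP) u) : TangentSpace 𝓘(ℝ, VP) u :=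
  X - 𝓟.vert (θ u ![X]) u

/-- `X ∈ T_u P` is the horizontal lift of `v ∈ T_x M`, where `x = π(u)`: it is horizontal and
projects to `v`. -/
def IsHorizontalLift (𝓟 : SmoothPrincipalBundle VG VM VP G M P) (θ : DiffForm VP P 1 VG) (u : P)
    {x : M} (v : TangentSpace 𝓘(ℝ, VM) x) (X : TangentSpace 𝓘(ℝ, VP) u) : Prop :=
  θ u ![X] = 0 ∧ tangentMap 𝓘(ℝ, VP) 𝓘(ℝ, VM) 𝓟.proj ⟨u, X⟩ = ⟨x, v⟩

/-- The horizontal lift of `v ∈ T_x M` to a point `u` of the fibre over `x`. -/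
def horLift (𝓟 : SmoothPrincipalBundle VG VM VP G M P) (θ : DiffForm VP P 1 VG) (u : P)
    {x : M} (v : TangentSpace 𝓘(ℝ, VM) x) : TangentSpace 𝓘(ℝ, VP) u :=
  Classical.epsilon (𝓟.IsHorizontalLift θ u v)

/-- `t ↦ h t` is the parallel transport `ℋ(γ, t, u)` of `u` along the curve `γ : [0,1] → M`. -/
def IsParallelTransport (𝓟 : SmoothPrincipalBundle VG VM VP G M P) (θ : DiffForm VP P 1 VG)
    (γ : ℝ → M) (u : P) (h : ℝ → P) : Prop :=
  h 0 = u ∧ ∀ t ∈ Icc (0 : ℝ) 1, 𝓟.proj (h t) = γ t ∧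
    HasVelocity (V := VP) h t (𝓟.horLift θ (h t) (velocity (V := VM) γ t))

end SmoothPrincipalBundle

variable {VE : Type*} [NormedAddCommGroup VE] [NormedSpace ℝ VE]
  {E : Type*} [TopologicalSpace E] [ChartedSpace VE E] [Group E]

/-- A `𝒢`-categorical connection `(ω, m)` on a principal `G`-bundle. -/
structure CategoricalConnection (𝒢 : LieCrossedModule VG VE G E)
    (𝓟 : SmoothPrincipalBundle VG VM VP G M P) where
  omega : DiffForm VP P 1 VG
  m : DiffForm VP P 2 VE
  smooth_omega : omega.IsSmooth
  smooth_m : m.IsSmooth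
  omega_equivariant : ∀ (g : G) (u : P) (X : TangentSpace 𝓘(ℝ, VP) u),
    omega (𝓟.act u g) ![𝓟.dR g u X] = adj g⁻¹ (omega u ![X])
  omega_vert : ∀ (A : VG) (u : P), omega u ![𝓟.vert A u] = A
  m_equivariant : ∀ (g : G) (u : P) (X Y : TangentSpace 𝓘(ℝ, VP) u),
    m (𝓟.act u g) ![𝓟.dR g u X, 𝓟.dR g u Y] = 𝒢.actLie g⁻¹ (m u ![X, Y])
  m_horizontal : ∀ (u : P) (X Y : TangentSpace 𝓘(ℝ, VP) u),
    m u ![X, Y] = m u ![𝓟.horProj omega u X, 𝓟.horProj omega u Y]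
  fakeCurvature : ∀ (u : P) (X Y : TangentSpace 𝓘(ℝ, VP) u),
    𝒢.bdLie (m u ![X, Y]) = curvature G omega u X Y

namespace CategoricalConnection

variable {𝒢 : LieCrossedModule VG VE G E} {𝓟 : SmoothPrincipalBundle VG VM VP G M P}

/-- `(t, s) ↦ e t s` is the surface holonomy `e_Γ(u, t, s)`: with `c s = u_s` the parallel
transport of `u` along `γ^0 = Γ(0, ·)` and `h s t = ℋ(γ_s, t, u_s)` the one along
`γ_s = Γ(·, s)`, it solves `∂e/∂s = e ∫₀ᵗ m(∂γ_s/∂t', ∂γ_s/∂s)_{h s t'} dt'` (with horizontal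
lifts inside `m`), `e t 0 = 1`. -/
def IsSurfaceHolonomy (C : CategoricalConnection 𝒢 𝓟) (Γ : ℝ × ℝ → M) (u : P)
    (e : ℝ → ℝ → E) : Prop :=
  ∃ (c : ℝ → P) (h : ℝ → ℝ → P),
    𝓟.IsParallelTransport C.omega (fun s => Γ (0, s)) u c ∧
    (∀ s ∈ Icc (0 : ℝ) 1, 𝓟.IsParallelTransport C.omega (fun t => Γ (t, s)) (c s) (h s)) ∧
    ∀ t ∈ Icc (0 : ℝ) 1, e t 0 = 1 ∧ ∀ s ∈ Icc (0 : ℝ) 1,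
      HasVelocity (V := VE) (fun s => e t s) s (leftMul (e t s)
        (∫ t' in (0 : ℝ)..t, C.m (h s t')
          ![𝓟.horLift C.omega (h s t') (velocity (V := VM) (fun t => Γ (t, s)) t'),
            𝓟.horLift C.omega (h s t') (velocity (V := VM) (fun s => Γ (t', s)) s)]))

/-- `(t, s) ↦ f t s` is the function `f_Γ(u, t, s)`, for which the roles of `s` and `t` are
reversed: with `c t = u^t` the parallel transport of `u` along `γ_0 = Γ(·, 0)` and
`h t s = ℋ(γ^t, s, u^t)` the one along `γ^t = Γ(t, ·)`, it solves
`∂f/∂t = f ∫₀ˢ m(∂γ^t/∂s', ∂γ^t/∂t)_{h t s'} ds'`, `f 0 s = 1`. -/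
def IsTransposedHolonomy (C : CategoricalConnection 𝒢 𝓟) (Γ : ℝ × ℝ → M) (u : P)
    (f : ℝ → ℝ → E) : Prop :=
  ∃ (c : ℝ → P) (h : ℝ → ℝ → P),
    𝓟.IsParallelTransport C.omega (fun t => Γ (t, 0)) u c ∧
    (∀ t ∈ Icc (0 : ℝ) 1, 𝓟.IsParallelTransport C.omega (fun s => Γ (t, s)) (c t) (h t)) ∧
    ∀ s ∈ Icc (0 : ℝ) 1, f 0 s = 1 ∧ ∀ t ∈ Icc (0 : ℝ) 1,
      HasVelocity (V := VE) (fun t => f t s) t (leftMul (f t s)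
        (∫ s' in (0 : ℝ)..s, C.m (h t s')
          ![𝓟.horLift C.omega (h t s') (velocity (V := VM) (fun s => Γ (t, s)) s'),
            𝓟.horLift C.omega (h t s') (velocity (V := VM) (fun t => Γ (t, s')) t)]))

end CategoricalConnection

end Bundles

/-! ### Local connection pairs and their holonomy -/

section Local

variable {VG : Type*} [NormedAddCommGroup VG] [NormedSpace ℝ VG]
  {VE : Type*} [NormedAddCommGroup VE] [NormedSpace ℝ VE]
  {VM : Type*} [NormedAddCommGroup VM] [NormedSpace ℝ VM]
  {G : Type*} [TopologicalSpace G] [ChartedSpace VG G] [Group G]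
  {E : Type*} [TopologicalSpace E] [ChartedSpace VE E] [Group E]

variable (VM) in
/-- A local connection pair `(A, B)` on `M`: `A` is a smooth `𝔤`-valued 1-form, `B` a smooth
`𝔢`-valued 2-form, and `∂(B) = dA + ½ A ∧^ad A`. -/
structure LocalConnectionPair (𝒢 : LieCrossedModule VG VE G E)
    (M : Type*) [TopologicalSpace M] [ChartedSpace VM M] where
  A : DiffForm VM M 1 VG
  B : DiffForm VM M 2 VE
  smooth_A : A.IsSmooth
  smooth_B : B.IsSmooth
  fakeCurvature : ∀ (x : M) (X Y : TangentSpace 𝓘(ℝ, VM) x),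
    𝒢.bdLie (B x ![X, Y]) = curvature G A x X Y

variable {M : Type*} [TopologicalSpace M] [ChartedSpace VM M]

/-- `t ↦ g t` is the path-ordered exponential of `A` along `γ : [0,1] → M`, i.e. the solution of
`dg/dt = g A(dγ/dt)`, `g 0 = 1`. -/
def IsPathExp (A : DiffForm VM M 1 VG) (γ : ℝ → M) (g : ℝ → G) : Prop :=
  g 0 = 1 ∧ ∀ t ∈ Icc (0 : ℝ) 1,
    HasVelocity (V := VG) g t (leftMul (g t) (A (γ t) ![velocity (V := VM) γ t]))

namespace LocalConnectionPair

variable {𝒢 : LieCrossedModule VG VE G E}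

/-- `(t, s) ↦ e t s` is the surface-ordered exponential of `(A, B)` over `Γ`: with `z` and `y s`
the path-ordered exponentials along `γ^0 = Γ(0, ·)` and `γ_s = Γ(·, s)`, it solves
`∂e/∂s = e ∫₀ᵗ (z s * y s t') ▷ B(∂γ_s/∂t', ∂γ_s/∂s) dt'`, `e t 0 = 1`. -/
def IsSurfaceExp (C : LocalConnectionPair VM 𝒢 M) (Γ : ℝ × ℝ → M) (e : ℝ → ℝ → E) : Prop :=
  ∃ (z : ℝ → G) (y : ℝ → ℝ → G),
    IsPathExp C.A (fun s => Γ (0, s)) z ∧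
    (∀ s ∈ Icc (0 : ℝ) 1, IsPathExp C.A (fun t => Γ (t, s)) (y s)) ∧
    ∀ t ∈ Icc (0 : ℝ) 1, e t 0 = 1 ∧ ∀ s ∈ Icc (0 : ℝ) 1,
      HasVelocity (V := VE) (fun s => e t s) s (leftMul (e t s)
        (∫ t' in (0 : ℝ)..t, 𝒢.actLie (z s * y s t') (C.B (Γ (t', s))
          ![velocity (V := VM) (fun t => Γ (t, s)) t',
            velocity (V := VM) (fun s => Γ (t', s)) s])))

/-- The square `q` in `𝒢` is the local holonomy of `Γ`: its edges are the path-ordered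
exponentials along the edges of `Γ` and its `E`-component is the surface-ordered exponential
over `Γ`. -/
def IsHolonomy (C : LocalConnectionPair VM 𝒢 M) (Γ : ℝ × ℝ → M) (q : 𝒢.Square) : Prop :=
  (∃ g, IsPathExp C.A (fun t => Γ (t, 0)) g ∧ q.X = g 1) ∧
  (∃ g, IsPathExp C.A (fun s => Γ (1, s)) g ∧ q.Y = g 1) ∧
  (∃ g, IsPathExp C.A (fun s => Γ (0, s)) g ∧ q.Z = g 1) ∧
  (∃ g, IsPathExp C.A (fun t => Γ (t, 1)) g ∧ q.W = g 1) ∧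
  (∃ e, C.IsSurfaceExp Γ e ∧ q.e = e 1 1)

end LocalConnectionPair

end Local

end

/-!
All derivatives of maps between manifolds are handled through `md` and `HasVelWithin`, whose values
lie in the model spaces, and velocities in a Lie group through `HasLeftVel`, which trivializes
tangent spaces by left translation. The path-ordered exponentials are then the solutions `IsPOE` of
`g' = g α`; they exist on `[0, 1]` (`exists_isPOE`), are unique (`IsPOE.eqOn`), and depend
differentiably on a parameter, the derivative being given by Duhamel's formula
(`IsPOE.hasLeftVel_param`).

Everything reduces to a computation on the unit square. Pulling a connection with vanishing fake
curvature back along a smooth square gives coefficients `a dt + b ds` and `β dt ∧ ds` with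
`∂(β) = ∂b/∂t - ∂a/∂s + [a, b]` (`exists_squareData`); here the exterior derivative commutes with
the pull-back because second derivatives are symmetric up to the boundary of the square. For such
data let `y` and `z` be the exponentials along the horizontal lines and the left edge.

* `SquareData.bd_mul` is the non-abelian Stokes theorem: `∂(e)` compares the transport along the
  two ways around the rectangle `[0, t] × [0, s]`. In the gauge of `y`, the coefficient `b` is, up
  to its value on the left edge, the integral of the curvature, so both sides of the identity
  satisfy the same differential equation in `s`.
* `SquareData.isSurf_swap_mul` says that the exponentials `e` and `f` for the two orders of the
  coordinates are inverse to each other. By Duhamel's formula, the derivative of `e` in `t` is the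
  integral over `s` of `β`, transported by `e` and by the path along left edge and horizontal line.
  By the Peiffer identity `e` acts as `∂(e)`, and by Stokes' theorem this replaces that path by the
  one along bottom edge and vertical line, which is the one in the equation for `f`. Hence `f e` is
  constant in `t`.
* `SquareData.isSurf_reflect` treats the reflection in the horizontal axis by reversing time.

In the bundle form, the square is lifted to a smooth map `σ` into the total space (`exists_lift`);
local lifts exist by triviality and are glued using a smooth function which stops in the overlap.
In the gauge given by `σ`, parallel transport is `σ g⁻¹` with `g` a path-ordered exponential of `ω`,
and equivariance and horizontality of `m` identify the surface holonomies with the exponentials of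
the pulled back pair `(ω, m)` (`isSurfaceHolonomy_iff`), so that `e f = 1` is the statement on the
square.

For the dihedral covariance it is enough to treat generators (`IsHolonomy.transform`). The
interchange of coordinates is `isSurf_swap_mul`, and the rotation is the composite of a reflection
and the interchange.
-/

set_option linter.unusedSectionVars false

/-! ### Velocities of curves and derivatives of maps -/

noncomputable section Velocities

variable {V : Type*} [NormedAddCommGroup V] [NormedSpace ℝ V]
  {N : Type*} [TopologicalSpace N] [ChartedSpace V N]
  {V' : Type*} [NormedAddCommGroup V'] [NormedSpace ℝ V']
  {N' : Type*} [TopologicalSpace N'] [ChartedSpace V' N']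
  {V'' : Type*} [NormedAddCommGroup V''] [NormedSpace ℝ V'']
  {N'' : Type*} [TopologicalSpace N''] [ChartedSpace V'' N'']
  {F : Type*} [NormedAddCommGroup F] [NormedSpace ℝ F]

/-- The derivative of a map between manifolds, as a continuous linear map between the model
spaces (to which all tangent spaces are definitionally equal). -/
def md (f : N → N') (x : N) : V →L[ℝ] V' := mfderiv 𝓘(ℝ, V) 𝓘(ℝ, V') f x

/-- The curve `c` has velocity `v` at time `t`, within the set `s` of times. -/
def HasVelWithin (c : ℝ → N) (s : Set ℝ) (t : ℝ) (v : V) : Prop :=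
  HasMFDerivWithinAt 𝓘(ℝ, ℝ) 𝓘(ℝ, V) c s t ((1 : ℝ →L[ℝ] ℝ).smulRight v : ℝ →L[ℝ] V)

theorem md_comp {g : N' → N''} {f : N → N'} {x : N}
    (hg : MDifferentiableAt 𝓘(ℝ, V') 𝓘(ℝ, V'') g (f x))
    (hf : MDifferentiableAt 𝓘(ℝ, V) 𝓘(ℝ, V') f x) :
    (md (fun y => g (f y)) x : V →L[ℝ] V'') = (md g (f x) : V' →L[ℝ] V'').comp (md f x) :=
  mfderiv_comp x hg hf

theorem md_id {x : N} : (md (fun y : N => y) x : V →L[ℝ] V) = ContinuousLinearMap.id ℝ V :=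
  mfderiv_id

theorem md_const {x : N} {y : N'} : (md (fun _ : N => y) x : V →L[ℝ] V') = 0 :=
  mfderiv_const

theorem md_eq_fderiv {f : V → V'} {x : V} : (md f x : V →L[ℝ] V') = fderiv ℝ f x :=
  mfderiv_eq_fderiv

namespace HasVelWithin

variable {c : ℝ → N} {s : Set ℝ} {t : ℝ} {v : V}

theorem of_hasMFDerivWithinAt {D : ℝ →L[ℝ] V}
    (h : HasMFDerivWithinAt 𝓘(ℝ, ℝ) 𝓘(ℝ, V) c s t D) : HasVelWithin c s t (D 1) := by
  have : (1 : ℝ →L[ℝ] ℝ).smulRight (D 1) = D := by ext; simp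
  unfold HasVelWithin
  rw [this]
  exact h

theorem continuousWithinAt (h : HasVelWithin c s t v) : ContinuousWithinAt c s t := h.1

theorem mdifferentiableWithinAt (h : HasVelWithin c s t v) :
    MDifferentiableWithinAt 𝓘(ℝ, ℝ) 𝓘(ℝ, V) c s t :=
  HasMFDerivWithinAt.mdifferentiableWithinAt h

theorem mono {s' : Set ℝ} (h : HasVelWithin c s t v) (hs : s' ⊆ s) : HasVelWithin c s' t v :=
  HasMFDerivWithinAt.mono h hs

theorem mono_of_mem_nhdsWithin {s' : Set ℝ} (h : HasVelWithin c s t v)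
    (hs : s ∈ nhdsWithin t s') : HasVelWithin c s' t v :=
  HasMFDerivWithinAt.mono_of_mem_nhdsWithin h hs

theorem union {s' : Set ℝ} (h : HasVelWithin c s t v) (h' : HasVelWithin c s' t v) :
    HasVelWithin c (s ∪ s') t v :=
  HasMFDerivWithinAt.union h h'

theorem congr_of_eventuallyEq {c' : ℝ → N} (h : HasVelWithin c s t v)
    (hc : c' =ᶠ[nhdsWithin t s] c) (ht : c' t = c t) : HasVelWithin c' s t v := by
  unfold HasVelWithin at *
  have h2 : HasMFDerivWithinAt 𝓘(ℝ, ℝ) 𝓘(ℝ, V) c' s t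
      (mfderivWithin 𝓘(ℝ, ℝ) 𝓘(ℝ, V) c' s t) :=
    (h.mdifferentiableWithinAt.congr_of_eventuallyEq hc ht).hasMFDerivWithinAt
  refine ⟨h2.1, ?_⟩
  have h3 := h.2
  simp only [writtenInExtChartAt, mfld_simps] at h3 ⊢
  rw [← ht] at h3
  refine h3.congr_of_eventuallyEq ?_ (by simp [ht])
  filter_upwards [hc] with x hx
  change chartAt V (c' t) (c' x) = chartAt V (c' t) (c x)
  rw [hx]

theorem congr {c' : ℝ → N} (h : HasVelWithin c s t v) (hc : ∀ x ∈ s, c' x = c x)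
    (ht : c' t = c t) : HasVelWithin c' s t v :=
  h.congr_of_eventuallyEq (Filter.eventually_of_mem self_mem_nhdsWithin hc) ht

theorem iff_hasDerivWithinAt {c : ℝ → F} {v : F} :
    HasVelWithin c s t v ↔ HasDerivWithinAt c v s t := by
  rw [hasDerivWithinAt_iff_hasFDerivWithinAt]
  exact hasMFDerivWithinAt_iff_hasFDerivWithinAt

theorem comp (h : HasVelWithin c s t v) {f : N → N'}
    (hf : MDifferentiableAt 𝓘(ℝ, V) 𝓘(ℝ, V') f (c t)) :
    HasVelWithin (fun t => f (c t)) s t ((md f (c t) : V →L[ℝ] V') v) := by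
  have := of_hasMFDerivWithinAt
    (D := (md f (c t) : V →L[ℝ] V').comp ((1 : ℝ →L[ℝ] ℝ).smulRight v))
    (hf.hasMFDerivAt.comp_hasMFDerivWithinAt t h)
  simpa using! this

theorem comp₂ (h : HasVelWithin c s t v) {c' : ℝ → N'} {v' : V'} (h' : HasVelWithin c' s t v')
    {f : N × N' → N''}
    (hf : MDifferentiableAt (𝓘(ℝ, V).prod 𝓘(ℝ, V')) 𝓘(ℝ, V'') f (c t, c' t)) :
    HasVelWithin (fun t => f (c t, c' t)) s t
      ((md (fun x => f (x, c' t)) (c t) v : V'') + md (fun x => f (c t, x)) (c' t) v') := by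
  have h1 := hf.hasMFDerivAt.comp_hasMFDerivWithinAt t (HasMFDerivWithinAt.prodMk h h')
  rw [mfderiv_prod_eq_add_comp hf] at h1
  have h2 := of_hasMFDerivWithinAt
    (D := ((md (fun x => f (x, c' t)) (c t) : V →L[ℝ] V'').comp (.fst ℝ V V') +
      (md (fun x => f (c t, x)) (c' t) : V' →L[ℝ] V'').comp (.snd ℝ V V')).comp
      (((1 : ℝ →L[ℝ] ℝ).smulRight v).prod ((1 : ℝ →L[ℝ] ℝ).smulRight v'))) h1
  simpa using! h2

theorem const (x : N) : HasVelWithin (fun _ : ℝ => x) s t (0 : V) :=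
  of_hasMFDerivWithinAt (D := 0) (hasMFDerivWithinAt_const x s t)

theorem eq {v' : V} (h : HasVelWithin c s t v) (h' : HasVelWithin c s t v')
    (hs : UniqueDiffWithinAt ℝ s t) : v = v' := by
  have : ((1 : ℝ →L[ℝ] ℝ).smulRight v : ℝ →L[ℝ] V) = (1 : ℝ →L[ℝ] ℝ).smulRight v' :=
    UniqueMDiffWithinAt.eq (uniqueMDiffWithinAt_iff_uniqueDiffWithinAt.2 hs) h h'
  have h2 := DFunLike.congr_fun this (1 : ℝ)
  rwa [ContinuousLinearMap.smulRight_apply, ContinuousLinearMap.smulRight_apply,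
    one_apply_eq_self, one_smul, one_smul] at h2

theorem of_mdifferentiableWithinAt
    (h : MDifferentiableWithinAt 𝓘(ℝ, ℝ) 𝓘(ℝ, V) c (Icc 0 1) t) :
    HasVelWithin (V := V) c (Icc 0 1) t (velocity (V := V) c t) :=
  of_hasMFDerivWithinAt (V := V)
    (D := (mfderivWithin 𝓘(ℝ, ℝ) 𝓘(ℝ, V) c (Icc 0 1) t : ℝ →L[ℝ] V))
    h.hasMFDerivWithinAt

theorem velocity_eq (h : HasVelWithin c (Icc 0 1) t v) (ht : t ∈ Icc (0:ℝ) 1) :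
    velocity (V := V) c t = v :=
  (of_mdifferentiableWithinAt h.mdifferentiableWithinAt).eq (V := V) h
    (uniqueDiffOn_Icc_zero_one t ht)

end HasVelWithin

end Velocities

/-! ### Left-trivialized velocities in a Lie group -/

noncomputable section LieCalculus

variable {VG : Type*} [NormedAddCommGroup VG] [NormedSpace ℝ VG]
  {G : Type*} [TopologicalSpace G] [ChartedSpace VG G] [Group G]
  {VE : Type*} [NormedAddCommGroup VE] [NormedSpace ℝ VE]
  {E : Type*} [TopologicalSpace E] [ChartedSpace VE E] [Group E]

/-- The adjoint action of `g` as a continuous linear map. -/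
def Ad (g : G) : VG →L[ℝ] VG := md (fun h : G => g * h * g⁻¹) 1

/-- The derivative at `1` of left translation by `g`, as a continuous linear map. -/
def lmul (g : G) : VG →L[ℝ] VG := md (fun h : G => g * h) 1

/-- The curve `g` in a Lie group has velocity `g X` at time `t`, within the set `s` of times. -/
def HasLeftVel (g : ℝ → G) (s : Set ℝ) (t : ℝ) (X : VG) : Prop :=
  HasVelWithin g s t (lmul (g t) X)

variable [LieGroup 𝓘(ℝ, VG) ∞ G] [LieGroup 𝓘(ℝ, VE) ∞ E]

theorem mdifferentiable_mul_pair :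
    MDifferentiable (𝓘(ℝ, VG).prod 𝓘(ℝ, VG)) 𝓘(ℝ, VG) (fun p : G × G => p.1 * p.2) :=
  (contMDiff_mul 𝓘(ℝ, VG) ∞).mdifferentiable (by simp)

theorem mdifferentiable_lmul (g : G) :
    MDifferentiable 𝓘(ℝ, VG) 𝓘(ℝ, VG) (fun h : G => g * h) :=
  (contMDiff_mul_left (I := 𝓘(ℝ, VG)) (n := ∞)).mdifferentiable (by simp)

theorem mdifferentiable_rmul (g : G) :
    MDifferentiable 𝓘(ℝ, VG) 𝓘(ℝ, VG) (fun h : G => h * g) :=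
  (contMDiff_mul_right (I := 𝓘(ℝ, VG)) (n := ∞)).mdifferentiable (by simp)

theorem mdifferentiable_conj (g : G) :
    MDifferentiable 𝓘(ℝ, VG) 𝓘(ℝ, VG) (fun h : G => g * h * g⁻¹) :=
  (mdifferentiable_rmul g⁻¹).comp (mdifferentiable_lmul g)

theorem md_lmul_lmul (g h : G) (X : VG) :
    (md (fun x : G => g * x) h : VG →L[ℝ] VG) (lmul h X) = lmul (g * h) X := by
  have h1 := md_comp (V := VG) (V' := VG) (V'' := VG) (g := fun x : G => g * x)
    (f := fun x : G => h * x) (x := 1) (mdifferentiable_lmul _ _) (mdifferentiable_lmul _ _)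
  simp only [mul_one] at h1
  unfold lmul
  rw [← ContinuousLinearMap.comp_apply, ← h1]
  simp only [mul_assoc]

theorem lmul_one : lmul (1 : G) = ContinuousLinearMap.id ℝ VG := by
  unfold lmul
  simp only [one_mul]
  exact md_id

theorem md_inv_lmul_lmul (g : G) (X : VG) :
    (md (fun x : G => g⁻¹ * x) g : VG →L[ℝ] VG) (lmul g X) = X := by
  rw [md_lmul_lmul, inv_mul_cancel, lmul_one]
  rfl

theorem lmul_injective (g : G) : Function.Injective (lmul g : VG →L[ℝ] VG) :=
  Function.LeftInverse.injective (md_inv_lmul_lmul g)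

theorem lmul_md_inv_lmul (g : G) (v : VG) :
    lmul g ((md (fun x : G => g⁻¹ * x) g : VG →L[ℝ] VG) v) = v := by
  have h1 := md_comp (V := VG) (V' := VG) (V'' := VG) (g := fun x : G => g * x)
    (f := fun x : G => g⁻¹ * x) (x := g) (mdifferentiable_lmul _ _) (mdifferentiable_lmul _ _)
  simp only [mul_inv_cancel_left, inv_mul_cancel] at h1
  unfold lmul
  rw [← ContinuousLinearMap.comp_apply, ← h1, md_id]
  rfl

theorem md_rmul_lmul (g h : G) (X : VG) :
    (md (fun x : G => x * h) g : VG →L[ℝ] VG) (lmul g X) = lmul (g * h) (Ad h⁻¹ X) := by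
  have h1 := md_comp (V := VG) (V' := VG) (V'' := VG) (g := fun x : G => x * h)
    (f := fun x : G => g * x) (x := 1) (mdifferentiable_rmul _ _) (mdifferentiable_lmul _ _)
  have h2 := md_comp (V := VG) (V' := VG) (V'' := VG) (g := fun x : G => g * h * x)
    (f := fun x : G => h⁻¹ * x * h⁻¹⁻¹) (x := 1) (mdifferentiable_lmul _ _)
    (mdifferentiable_conj h⁻¹ _)
  simp only [mul_one, inv_inv, inv_mul_cancel] at h1 h2
  unfold lmul Ad
  rw [← ContinuousLinearMap.comp_apply, ← h1]
  simp only [inv_inv]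
  rw [← ContinuousLinearMap.comp_apply, ← h2]
  congr 3
  ext x
  group

theorem Ad_mul (g h : G) : (Ad (g * h) : VG →L[ℝ] VG) = (Ad g).comp (Ad h) := by
  have h2 := md_comp (V := VG) (V' := VG) (V'' := VG) (g := fun x : G => g * x * g⁻¹)
    (f := fun x : G => h * x * h⁻¹) (x := 1) (mdifferentiable_conj g _)
    (mdifferentiable_conj h _)
  simp only [mul_one, mul_inv_cancel] at h2
  unfold Ad
  rw [← h2]
  congr 1
  ext x
  group

theorem Ad_one : (Ad (1 : G) : VG →L[ℝ] VG) = ContinuousLinearMap.id ℝ VG := by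
  unfold Ad
  simp only [one_mul, inv_one, mul_one]
  exact md_id

@[simp] theorem Ad_Ad_inv (g : G) (X : VG) : Ad g (Ad g⁻¹ X) = X := by
  rw [← ContinuousLinearMap.comp_apply, ← Ad_mul, mul_inv_cancel, Ad_one]
  rfl

@[simp] theorem Ad_inv_Ad (g : G) (X : VG) : Ad g⁻¹ (Ad g X) = X := by
  rw [← ContinuousLinearMap.comp_apply, ← Ad_mul, inv_mul_cancel, Ad_one]
  rfl

/-- A smooth homomorphism maps left-trivialized velocities by its derivative at `1`. -/
theorem md_hom_lmul (φ : E →* G)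
    (hφ : MDifferentiable 𝓘(ℝ, VE) 𝓘(ℝ, VG) φ) (g : E) (X : VE) :
    (md φ g : VE →L[ℝ] VG) (lmul g X) = lmul (φ g) ((md φ 1 : VE →L[ℝ] VG) X) := by
  have h1 := md_comp (V := VE) (V' := VE) (V'' := VG) (g := φ)
    (f := fun x : E => g * x) (x := 1) (hφ _) (mdifferentiable_lmul _ _)
  have h2 := md_comp (V := VE) (V' := VG) (V'' := VG) (g := fun x : G => φ g * x)
    (f := φ) (x := 1) (mdifferentiable_lmul _ _) (hφ _)
  simp only [mul_one, map_one, map_mul] at h1 h2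
  unfold lmul
  rw [← ContinuousLinearMap.comp_apply, ← ContinuousLinearMap.comp_apply, ← h1, ← h2]

namespace HasLeftVel

variable {g h : ℝ → G} {s : Set ℝ} {t : ℝ} {X Y : VG}

/-- The Leibniz rule, left-trivialized. -/
theorem mul (hg : HasLeftVel g s t X) (hh : HasLeftVel h s t Y) :
    HasLeftVel (fun t => g t * h t) s t (Ad (h t)⁻¹ X + Y) := by
  have := HasVelWithin.comp₂ (V'' := VG) hg hh (mdifferentiable_mul_pair _)
  unfold HasLeftVel
  rwa [md_rmul_lmul, md_lmul_lmul, ← map_add] at this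

theorem const (a : G) : HasLeftVel (fun _ : ℝ => a) s t (0 : VG) := by
  unfold HasLeftVel
  rw [map_zero]
  exact HasVelWithin.const a

theorem const_mul (a : G) (hg : HasLeftVel g s t X) :
    HasLeftVel (fun t => a * g t) s t X := by
  simpa using (const a).mul hg

theorem mul_const (hg : HasLeftVel g s t X) (a : G) :
    HasLeftVel (fun t => g t * a) s t (Ad a⁻¹ X) := by
  simpa using hg.mul (const a)

theorem congr {g' : ℝ → G} (hg : HasLeftVel g s t X) (hc : ∀ x ∈ s, g' x = g x)
    (ht : t ∈ s) : HasLeftVel g' s t X := by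
  unfold HasLeftVel at *
  rw [hc t ht]
  exact HasVelWithin.congr hg hc (hc t ht)

theorem eq (hg : HasLeftVel g s t X) (hg' : HasLeftVel g s t Y)
    (hs : UniqueDiffWithinAt ℝ s t) : X = Y :=
  lmul_injective (g t) (HasVelWithin.eq hg hg' hs)

theorem _root_.HasVelWithin.exists_hasLeftVel {v : VG} (hg : HasVelWithin g s t v) :
    ∃ X : VG, HasLeftVel g s t X := by
  refine ⟨(md (fun x : G => (g t)⁻¹ * x) (g t) : VG →L[ℝ] VG) v, ?_⟩
  unfold HasLeftVel
  rwa [lmul_md_inv_lmul]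

theorem inv (hg : HasLeftVel g s t X) (hs : UniqueDiffWithinAt ℝ s t) :
    HasLeftVel (fun t => (g t)⁻¹) s t (-Ad (g t) X) := by
  have h1 : MDifferentiable 𝓘(ℝ, VG) 𝓘(ℝ, VG) (fun x : G => x⁻¹) :=
    (contMDiff_inv 𝓘(ℝ, VG) ∞).mdifferentiable (by simp)
  obtain ⟨Z, hZ⟩ := (HasVelWithin.comp (V' := VG) hg (h1 _)).exists_hasLeftVel
  have h2 := hg.mul hZ
  simp only [mul_inv_cancel, inv_inv] at h2
  have h3 := h2.eq (const 1) hs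
  rwa [← eq_neg_of_add_eq_zero_right h3]

theorem hom {e : ℝ → E} {Z : VE} (he : HasLeftVel e s t Z) (φ : E →* G)
    (hφ : MDifferentiable 𝓘(ℝ, VE) 𝓘(ℝ, VG) φ) :
    HasLeftVel (fun t => φ (e t)) s t ((md φ 1 : VE →L[ℝ] VG) Z) := by
  have := HasVelWithin.comp (V' := VG) he (hφ (e t))
  rwa [md_hom_lmul φ hφ] at this

end HasLeftVel

end LieCalculus

/-! ### Charts, and curves with vanishing velocity -/

noncomputable section Charts

variable {V : Type*} [NormedAddCommGroup V] [NormedSpace ℝ V]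
  {N : Type*} [TopologicalSpace N] [ChartedSpace V N] [IsManifold 𝓘(ℝ, V) ∞ N]
  {V' : Type*} [NormedAddCommGroup V'] [NormedSpace ℝ V']
  {N' : Type*} [TopologicalSpace N'] [ChartedSpace V' N'] [IsManifold 𝓘(ℝ, V') ∞ N']
  {V'' : Type*} [NormedAddCommGroup V''] [NormedSpace ℝ V'']
  {N'' : Type*} [TopologicalSpace N''] [ChartedSpace V'' N''] [IsManifold 𝓘(ℝ, V'') ∞ N'']

theorem mdifferentiableAt_extChart {x y : N} (hy : y ∈ (extChartAt 𝓘(ℝ, V) x).source) :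
    MDifferentiableAt 𝓘(ℝ, V) 𝓘(ℝ, V) (extChartAt 𝓘(ℝ, V) x) y :=
  mdifferentiableAt_extChartAt (by simpa using hy)

theorem mdifferentiableAt_extChart_symm {x : N} {y : V}
    (hy : y ∈ (extChartAt 𝓘(ℝ, V) x).target) :
    MDifferentiableAt 𝓘(ℝ, V) 𝓘(ℝ, V) (extChartAt 𝓘(ℝ, V) x).symm y := by
  have := mdifferentiableWithinAt_extChartAt_symm hy
  rwa [modelWithCornersSelf_coe, range_id, mdifferentiableWithinAt_univ] at this

theorem md_extChart_self (x : N) :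
    (md (extChartAt 𝓘(ℝ, V) x) x : V →L[ℝ] V) = ContinuousLinearMap.id ℝ V :=
  mfderiv_extChartAt_self

theorem md_extChart_symm_self (x : N) :
    (md (extChartAt 𝓘(ℝ, V) x).symm (extChartAt 𝓘(ℝ, V) x x) : V →L[ℝ] V) =
      ContinuousLinearMap.id ℝ V := by
  have h : mfderivWithin 𝓘(ℝ, V) 𝓘(ℝ, V) (extChartAt 𝓘(ℝ, V) x).symm (range 𝓘(ℝ, V))
    (extChartAt 𝓘(ℝ, V) x x) = ContinuousLinearMap.id ℝ V := mfderivWithin_range_extChartAt_symm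
  rwa [modelWithCornersSelf_coe, range_id, mfderivWithin_univ] at h

theorem md_symm_md_extChart {x y : N} (hy : y ∈ (extChartAt 𝓘(ℝ, V) x).source) (v : V) :
    (md (extChartAt 𝓘(ℝ, V) x).symm (extChartAt 𝓘(ℝ, V) x y) : V →L[ℝ] V)
      ((md (extChartAt 𝓘(ℝ, V) x) y : V →L[ℝ] V) v) = v := by
  have h := mfderivWithin_extChartAt_symm_comp_mfderiv_extChartAt' hy
  simp only [modelWithCornersSelf_coe, range_id, mfderivWithin_univ] at h
  exact DFunLike.congr_fun h v

theorem HasVelWithin.hasDerivWithinAt_extChart {c : ℝ → N} {s : Set ℝ} {t : ℝ} {v : V} {x : N}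
    (h : HasVelWithin c s t v) (hx : c t ∈ (extChartAt 𝓘(ℝ, V) x).source) :
    HasDerivWithinAt (fun t => extChartAt 𝓘(ℝ, V) x (c t))
      ((md (extChartAt 𝓘(ℝ, V) x) (c t) : V →L[ℝ] V) v) s t :=
  HasVelWithin.iff_hasDerivWithinAt.1 (h.comp (mdifferentiableAt_extChart hx))

/-- A curve on the unit interval whose velocity vanishes is constant. -/
theorem HasVelWithin.eq_of_zero [T2Space N] {c : ℝ → N}
    (h : ∀ t ∈ Icc (0 : ℝ) 1, HasVelWithin c (Icc 0 1) t (0 : V)) {t : ℝ}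
    (ht : t ∈ Icc (0 : ℝ) 1) : c t = c 0 := by
  have key : IsLocallyConstant (fun t : Icc (0 : ℝ) 1 => c t) := by
    rw [IsLocallyConstant.iff_eventually_eq]
    rintro ⟨t, ht⟩
    have hnear : ∀ᶠ y in nhdsWithin t (Icc 0 1), c y ∈ (extChartAt 𝓘(ℝ, V) (c t)).source :=
      (h t ht).continuousWithinAt.eventually_mem (extChartAt_source_mem_nhds _)
    obtain ⟨ε, hε, hball⟩ := Metric.mem_nhdsWithin_iff.1 hnear
    have hconv : Convex ℝ (Metric.ball t ε ∩ Icc 0 1) := (convex_ball t ε).inter (convex_Icc 0 1)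
    have hder : ∀ y ∈ Metric.ball t ε ∩ Icc 0 1,
        HasDerivWithinAt (fun t' => extChartAt 𝓘(ℝ, V) (c t) (c t')) 0
          (Metric.ball t ε ∩ Icc 0 1) y := by
      intro y hy
      have := (h y hy.2).hasDerivWithinAt_extChart (hball hy)
      rw [map_zero] at this
      exact this.mono inter_subset_right
    rw [nhds_subtype_eq_comap_nhdsWithin, Filter.eventually_comap]
    filter_upwards [inter_mem_nhdsWithin (Icc (0 : ℝ) 1) (Metric.ball_mem_nhds t hε)]
    rintro y hy ⟨z, hz⟩ rfl
    have hle := hconv.norm_image_sub_le_of_norm_hasDerivWithin_le (C := 0) hder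
      (by simp) ⟨Metric.mem_ball_self hε, ht⟩ ⟨hy.2, hy.1⟩
    rw [zero_mul, norm_le_zero_iff, sub_eq_zero] at hle
    exact (extChartAt 𝓘(ℝ, V) (c t)).injOn (hball ⟨hy.2, hy.1⟩) (mem_extChartAt_source _) hle
  have := key.apply_eq_of_isPreconnected isPreconnected_univ
    (mem_univ (⟨t, ht⟩ : Icc (0 : ℝ) 1)) (mem_univ ⟨0, by simp⟩)
  exact this

/-- A curve is determined by its initial point and its left-trivialized velocity: for two solutions
`g` and `h` of the same equation, `g h⁻¹` has velocity zero. -/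
theorem HasLeftVel.eq_of_eq_zero {VG : Type*} [NormedAddCommGroup VG] [NormedSpace ℝ VG]
    {G : Type*} [TopologicalSpace G] [ChartedSpace VG G] [Group G] [LieGroup 𝓘(ℝ, VG) ∞ G]
    [T2Space G] {g h : ℝ → G} {α : ℝ → VG}
    (hg : ∀ t ∈ Icc (0 : ℝ) 1, HasLeftVel g (Icc 0 1) t (α t))
    (hh : ∀ t ∈ Icc (0 : ℝ) 1, HasLeftVel h (Icc 0 1) t (α t)) (h0 : g 0 = h 0) {t : ℝ}
    (ht : t ∈ Icc (0 : ℝ) 1) : g t = h t := by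
  have key : g t * (h t)⁻¹ = g 0 * (h 0)⁻¹ := by
    refine HasVelWithin.eq_of_zero (V := VG) (c := fun t => g t * (h t)⁻¹) (fun t ht => ?_) ht
    have := (hg t ht).mul ((hh t ht).inv (uniqueDiffOn_Icc_zero_one t ht))
    rw [inv_inv, add_neg_cancel] at this
    unfold HasLeftVel at this
    rwa [map_zero] at this
  rw [h0, mul_inv_cancel] at key
  exact mul_inv_eq_one.1 key

/-- The derivatives at a common fixed point of a smooth family of maps depend smoothly on the
parameter. -/
theorem contMDiff_md_of_fixed {f : N → N' → N''} {y : N'} {z : N''}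
    (hf : ContMDiff (𝓘(ℝ, V).prod 𝓘(ℝ, V')) 𝓘(ℝ, V'') ∞ (Function.uncurry f))
    (hy : ∀ x, f x y = z) :
    ContMDiff 𝓘(ℝ, V) 𝓘(ℝ, V' →L[ℝ] V'') ∞ (fun x => (md (f x) y : V' →L[ℝ] V'')) := by
  intro x₀
  have h := ContMDiffAt.mfderiv (x₀ := x₀) (m := ∞) (n := ∞) f (fun _ => y) (hf _)
    contMDiffAt_const (by simp)
  refine h.congr_of_eventuallyEq (Filter.Eventually.of_forall fun x => ?_)
  dsimp only
  rw [inTangentCoordinates_eq_mfderiv_comp (by simp) (by simp [hy])]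
  simp only [modelWithCornersSelf_coe, range_id, mfderivWithin_univ]
  have h1 := md_extChart_symm_self (V := V') y
  have h2 := md_extChart_self (V := V'') (f x₀ y)
  have h3 : f x₀ y = f x y := by rw [hy, hy]
  have h4 : (md (extChartAt 𝓘(ℝ, V'') (f x₀ y)) (f x y) : V'' →L[ℝ] V'') =
    ContinuousLinearMap.id ℝ V'' := by rw [h3]; exact md_extChart_self (V := V'') (f x y)
  ext v
  change (md (f x) y : V' →L[ℝ] V'') v =
    (md (extChartAt 𝓘(ℝ, V'') (f x₀ y)) (f x y) : V'' →L[ℝ] V'')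
      ((md (f x) y : V' →L[ℝ] V'') ((md (extChartAt 𝓘(ℝ, V') y).symm _ : V' →L[ℝ] V') v))
  rw [h4, h1]
  rfl

end Charts

/-! ### The derivative of the adjoint action -/

noncomputable section AdDerivative

variable {VG : Type*} [NormedAddCommGroup VG] [NormedSpace ℝ VG]
  {G : Type*} [TopologicalSpace G] [ChartedSpace VG G] [Group G] [LieGroup 𝓘(ℝ, VG) ∞ G]

variable (VG G) in
/-- The multiplication of a Lie group in the preferred chart at `1`. -/
def chartMul (p : VG × VG) : VG :=
  extChartAt 𝓘(ℝ, VG) (1 : G) ((extChartAt 𝓘(ℝ, VG) (1 : G)).symm p.1 *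
    (extChartAt 𝓘(ℝ, VG) (1 : G)).symm p.2)

variable (VG G) in
/-- The coordinates of `1` in the preferred chart at `1`. -/
def chartOne : VG := extChartAt 𝓘(ℝ, VG) (1 : G) 1

theorem chartOne_mem_target : chartOne VG G ∈ (extChartAt 𝓘(ℝ, VG) (1 : G)).target :=
  mem_extChartAt_target _

theorem chart_symm_chartOne : (extChartAt 𝓘(ℝ, VG) (1 : G)).symm (chartOne VG G) = 1 :=
  extChartAt_to_inv _

theorem contDiffAt_chartMul {p : VG × VG} (h1 : p.1 ∈ (extChartAt 𝓘(ℝ, VG) (1 : G)).target)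
    (h2 : p.2 ∈ (extChartAt 𝓘(ℝ, VG) (1 : G)).target)
    (h3 : (extChartAt 𝓘(ℝ, VG) (1 : G)).symm p.1 * (extChartAt 𝓘(ℝ, VG) (1 : G)).symm p.2 ∈
      (extChartAt 𝓘(ℝ, VG) (1 : G)).source) :
    ContDiffAt ℝ ∞ (chartMul VG G) p := by
  rw [← contMDiffAt_iff_contDiffAt]
  have hs : ∀ y ∈ (extChartAt 𝓘(ℝ, VG) (1 : G)).target,
      ContMDiffAt 𝓘(ℝ, VG) 𝓘(ℝ, VG) ∞ (extChartAt 𝓘(ℝ, VG) (1 : G)).symm y := fun y hy =>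
    (contMDiffOn_extChartAt_symm (1 : G)).contMDiffAt
      ((isOpen_extChartAt_target (1 : G)).mem_nhds hy)
  have hm : ContMDiffAt 𝓘(ℝ, VG × VG) 𝓘(ℝ, VG) ∞ (fun p : VG × VG =>
      (extChartAt 𝓘(ℝ, VG) (1 : G)).symm p.1 * (extChartAt 𝓘(ℝ, VG) (1 : G)).symm p.2) p := by
    refine ContMDiffAt.mul ?_ ?_
    · exact ContMDiffAt.comp p (hs _ h1) contDiffAt_fst.contMDiffAt
    · exact ContMDiffAt.comp p (hs _ h2) contDiffAt_snd.contMDiffAt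
  exact ContMDiffAt.comp p (contMDiffAt_extChartAt' (by simpa using h3)) hm

variable (VG G) in
theorem contDiffAt_chartMul_one :
    ContDiffAt ℝ ∞ (chartMul VG G) (chartOne VG G, chartOne VG G) :=
  contDiffAt_chartMul chartOne_mem_target chartOne_mem_target
    (by simp only [chart_symm_chartOne, mul_one]; exact mem_extChartAt_source _)

/-- In the chart at `1`, differentiating the product in its second factor at `1` gives the
derivative of left translation. -/
theorem fderiv_chartMul_inr {x : VG} (hx : x ∈ (extChartAt 𝓘(ℝ, VG) (1 : G)).target) (X : VG) :
    fderiv ℝ (chartMul VG G) (x, chartOne VG G) (0, X) =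
      (md (extChartAt 𝓘(ℝ, VG) (1 : G)) ((extChartAt 𝓘(ℝ, VG) (1 : G)).symm x) : VG →L[ℝ] VG)
        (lmul ((extChartAt 𝓘(ℝ, VG) (1 : G)).symm x) X) := by
  set φ := extChartAt 𝓘(ℝ, VG) (1 : G)
  have hd : DifferentiableAt ℝ (chartMul VG G) (x, chartOne VG G) :=
    (contDiffAt_chartMul hx chartOne_mem_target (by
      simp only [chart_symm_chartOne, mul_one]; exact φ.map_target hx)).differentiableAt (by simp)
  have h1 : HasFDerivAt (fun y => chartMul VG G (x, y))
      ((fderiv ℝ (chartMul VG G) (x, chartOne VG G)).comp (.inr ℝ VG VG)) (chartOne VG G) :=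
    HasFDerivAt.comp (chartOne VG G) hd.hasFDerivAt (hasFDerivAt_prodMk_right x (chartOne VG G))
  have h2 := md_comp (V := VG) (V' := VG) (V'' := VG) (x := chartOne VG G)
    (g := fun y : G => φ (φ.symm x * y)) (f := φ.symm) ?_
    (mdifferentiableAt_extChart_symm chartOne_mem_target)
  · have h3 := md_comp (V := VG) (V' := VG) (V'' := VG) (x := φ.symm (chartOne VG G))
      (g := φ) (f := fun y => φ.symm x * y) (mdifferentiableAt_extChart ?_)
      (mdifferentiable_lmul _ _)
    · have h4 : (md (fun y => φ (φ.symm x * φ.symm y)) (chartOne VG G) : VG →L[ℝ] VG) =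
        (fderiv ℝ (chartMul VG G) (x, chartOne VG G)).comp (.inr ℝ VG VG) := by
        rw [md_eq_fderiv]
        exact h1.fderiv
      have h5 : (md φ.symm (chartOne VG G) : VG →L[ℝ] VG) = ContinuousLinearMap.id ℝ VG :=
        md_extChart_symm_self (1 : G)
      rw [h4, h3, h5] at h2
      have h6 := DFunLike.congr_fun h2 X
      simp only [φ, chart_symm_chartOne, mul_one] at h6
      exact h6
    · simp only [φ, chart_symm_chartOne, mul_one]
      exact φ.map_target hx
  · refine MDifferentiableAt.comp _ (mdifferentiableAt_extChart ?_) (mdifferentiable_lmul _ _)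
    simp only [φ, chart_symm_chartOne, mul_one]
    exact φ.map_target hx

/-- In the chart at `1`, differentiating the product in its first factor at `1` gives the
derivative of right translation. -/
theorem fderiv_chartMul_inl {x : VG} (hx : x ∈ (extChartAt 𝓘(ℝ, VG) (1 : G)).target) (X : VG) :
    fderiv ℝ (chartMul VG G) (chartOne VG G, x) (X, 0) =
      (md (extChartAt 𝓘(ℝ, VG) (1 : G)) ((extChartAt 𝓘(ℝ, VG) (1 : G)).symm x) : VG →L[ℝ] VG)
        ((md (fun y : G => y * (extChartAt 𝓘(ℝ, VG) (1 : G)).symm x) 1 : VG →L[ℝ] VG) X) := by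
  set φ := extChartAt 𝓘(ℝ, VG) (1 : G)
  have hd : DifferentiableAt ℝ (chartMul VG G) (chartOne VG G, x) :=
    (contDiffAt_chartMul chartOne_mem_target hx (by
      simp only [chart_symm_chartOne, one_mul]; exact φ.map_target hx)).differentiableAt (by simp)
  have h1 : HasFDerivAt (fun y => chartMul VG G (y, x))
      ((fderiv ℝ (chartMul VG G) (chartOne VG G, x)).comp (.inl ℝ VG VG)) (chartOne VG G) :=
    HasFDerivAt.comp (g := chartMul VG G) (chartOne VG G) hd.hasFDerivAt
      (hasFDerivAt_prodMk_left (chartOne VG G) x)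
  have h2 := md_comp (V := VG) (V' := VG) (V'' := VG) (x := chartOne VG G)
    (g := fun y : G => φ (y * φ.symm x)) (f := φ.symm) ?_
    (mdifferentiableAt_extChart_symm chartOne_mem_target)
  · have h3 := md_comp (V := VG) (V' := VG) (V'' := VG) (x := φ.symm (chartOne VG G))
      (g := φ) (f := fun y => y * φ.symm x) (mdifferentiableAt_extChart ?_)
      (mdifferentiable_rmul _ _)
    · have h4 : (md (fun y => φ (φ.symm y * φ.symm x)) (chartOne VG G) : VG →L[ℝ] VG) =
        (fderiv ℝ (chartMul VG G) (chartOne VG G, x)).comp (.inl ℝ VG VG) := by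
        rw [md_eq_fderiv]
        exact h1.fderiv
      have h5 : (md φ.symm (chartOne VG G) : VG →L[ℝ] VG) = ContinuousLinearMap.id ℝ VG :=
        md_extChart_symm_self (1 : G)
      rw [h4, h3, h5] at h2
      have h6 := DFunLike.congr_fun h2 X
      simp only [φ, chart_symm_chartOne, one_mul] at h6
      exact h6
    · simp only [φ, chart_symm_chartOne, one_mul]
      exact φ.map_target hx
  · refine MDifferentiableAt.comp _ (mdifferentiableAt_extChart ?_) (mdifferentiable_rmul _ _)
    simp only [φ, chart_symm_chartOne, one_mul]
    exact φ.map_target hx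

/-- The bracket of the Lie algebra in terms of the second derivative of the multiplication in a
chart. -/
theorem lieBr_eq_chartMul (a X : VG) : lieBr G a X =
    fderiv ℝ (fderiv ℝ (chartMul VG G)) (chartOne VG G, chartOne VG G) (a, 0) (0, X) -
    fderiv ℝ (fderiv ℝ (chartMul VG G)) (chartOne VG G, chartOne VG G) (X, 0) (0, a) := by
  set φ := extChartAt 𝓘(ℝ, VG) (1 : G) with hφ
  set μ := chartMul VG G
  set x₀ := chartOne VG G
  have hfield : ∀ Y : VG,
      (VectorField.mpullbackWithin 𝓘(ℝ, VG) 𝓘(ℝ, VG) φ.symm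
        (mulInvariantVectorField (I := 𝓘(ℝ, VG)) (G := G) Y) (range 𝓘(ℝ, VG)) : VG → VG)
      =ᶠ[nhds x₀] fun x => fderiv ℝ μ (x, x₀) (0, Y) := by
    intro Y
    filter_upwards [(isOpen_extChartAt_target (1 : G)).mem_nhds chartOne_mem_target] with x hx
    rw [fderiv_chartMul_inr hx, VectorField.mpullbackWithin_apply]
    have hinv : (mfderivWithin 𝓘(ℝ, VG) 𝓘(ℝ, VG) φ.symm (range 𝓘(ℝ, VG)) x).inverse =
        mfderiv 𝓘(ℝ, VG) 𝓘(ℝ, VG) φ (φ.symm x) :=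
      ContinuousLinearMap.inverse_eq
        (mfderivWithin_extChartAt_symm_comp_mfderiv_extChartAt hx)
        (mfderiv_extChartAt_comp_mfderivWithin_extChartAt_symm hx)
    rw [hinv]
    rfl
  have hder : ∀ Y Z : VG, fderiv ℝ (fun x => fderiv ℝ μ (x, x₀) (0, Y)) x₀ Z =
      fderiv ℝ (fderiv ℝ μ) (x₀, x₀) (Z, 0) (0, Y) := by
    intro Y Z
    have hd : DifferentiableAt ℝ (fderiv ℝ μ) (x₀, x₀) :=
      ((contDiffAt_chartMul_one VG G).fderiv_right (m := 1) (by norm_cast)).differentiableAt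
        (by simp)
    have h1 : HasFDerivAt (fun x => fderiv ℝ μ (x, x₀))
      ((fderiv ℝ (fderiv ℝ μ) (x₀, x₀)).comp (.inl ℝ VG VG)) x₀ :=
      HasFDerivAt.comp x₀ hd.hasFDerivAt (hasFDerivAt_prodMk_left x₀ x₀)
    have h2 := h1.clm_apply (hasFDerivAt_const ((0, Y) : VG × VG) x₀)
    rw [h2.fderiv]
    simp
  have hval : ∀ Y : VG, fderiv ℝ μ (x₀, x₀) (0, Y) = Y := by
    intro Y
    rw [fderiv_chartMul_inr chartOne_mem_target]
    rw [chart_symm_chartOne, lmul_one, md_extChart_self]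
    rfl
  change VectorField.mlieBracketWithin 𝓘(ℝ, VG) _ _ univ (1 : G) = _
  rw [VectorField.mlieBracketWithin_apply]
  have hinv : (mfderiv 𝓘(ℝ, VG) 𝓘(ℝ, VG) φ (1 : G)).inverse = ContinuousLinearMap.id ℝ VG := by
    rw [hφ, mfderiv_extChartAt_self]
    exact ContinuousLinearMap.inverse_id
  rw [hinv]
  simp only [preimage_univ, modelWithCornersSelf_coe, range_id, inter_univ]
  have hbr := Filter.EventuallyEq.lieBracket_vectorField_eq (𝕜 := ℝ) (hfield a) (hfield X)
  simp only [modelWithCornersSelf_coe, range_id] at hbr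
  have huniv : ∀ A B : VG → VG,
      VectorField.lieBracketWithin ℝ A B univ x₀ = VectorField.lieBracket ℝ A B x₀ :=
    fun A B => by rw [VectorField.lieBracketWithin_univ]
  refine (huniv _ _).trans (hbr.trans ?_)
  rw [VectorField.lieBracket_eq]
  simp only [hval, hder]

theorem contMDiff_Ad : ContMDiff 𝓘(ℝ, VG) 𝓘(ℝ, VG →L[ℝ] VG) ∞
    (fun g : G => (Ad g : VG →L[ℝ] VG)) := by
  refine contMDiff_md_of_fixed (f := fun g h : G => g * h * g⁻¹) (y := 1) (z := 1) ?_ (by simp)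
  exact (contMDiff_fst.mul contMDiff_snd).mul contMDiff_fst.inv

/-- Differentiating `x y = (x y x⁻¹) x` first in `y` and then in `x`, in the chart at `1`. -/
theorem md_Ad_one (a X : VG) :
    (md (fun g : G => (Ad g : VG →L[ℝ] VG)) 1 : VG →L[ℝ] VG →L[ℝ] VG) a X = lieBr G a X := by
  set φ := extChartAt 𝓘(ℝ, VG) (1 : G) with hφ
  set μ := chartMul VG G
  set x₀ := chartOne VG G
  have hd : DifferentiableAt ℝ (fderiv ℝ μ) (x₀, x₀) :=
    ((contDiffAt_chartMul_one VG G).fderiv_right (m := 1) (by norm_cast)).differentiableAt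
      (by simp)
  have hA : HasFDerivAt (fun x => (Ad (φ.symm x) : VG →L[ℝ] VG))
      (md (fun g : G => (Ad g : VG →L[ℝ] VG)) 1 : VG →L[ℝ] VG →L[ℝ] VG) x₀ := by
    have h1 : MDifferentiableAt 𝓘(ℝ, VG) 𝓘(ℝ, VG →L[ℝ] VG)
        (fun g : G => (Ad g : VG →L[ℝ] VG)) (φ.symm x₀) :=
      (contMDiff_Ad (VG := VG) (G := G)).mdifferentiable (by simp) _
    have h2 := md_comp (V := VG) (V' := VG) (V'' := VG →L[ℝ] VG) h1
      (mdifferentiableAt_extChart_symm chartOne_mem_target)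
    have h3 : DifferentiableAt ℝ (fun x => (Ad (φ.symm x) : VG →L[ℝ] VG)) x₀ :=
      (h1.comp x₀ (mdifferentiableAt_extChart_symm chartOne_mem_target)).differentiableAt
    have h4 := h3.hasFDerivAt
    have h5 : (md φ.symm x₀ : VG →L[ℝ] VG) = ContinuousLinearMap.id ℝ VG :=
      md_extChart_symm_self (1 : G)
    rw [md_eq_fderiv, h5, ContinuousLinearMap.comp_id] at h2
    rw [h2] at h4
    simpa only [φ, x₀, chart_symm_chartOne] using h4
  have hR : HasFDerivAt (fun x => (fderiv ℝ μ (x₀, x)).comp (.inl ℝ VG VG))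
      ((ContinuousLinearMap.precomp VG (.inl ℝ VG VG)).comp
        ((fderiv ℝ (fderiv ℝ μ) (x₀, x₀)).comp (.inr ℝ VG VG))) x₀ := by
    have h1 : HasFDerivAt (fun x => fderiv ℝ μ (x₀, x))
      ((fderiv ℝ (fderiv ℝ μ) (x₀, x₀)).comp (.inr ℝ VG VG)) x₀ :=
      HasFDerivAt.comp x₀ hd.hasFDerivAt (hasFDerivAt_prodMk_right x₀ x₀)
    exact (ContinuousLinearMap.precomp VG (.inl ℝ VG VG)).hasFDerivAt.comp x₀ h1
  have hL : HasFDerivAt (fun x => fderiv ℝ μ (x, x₀) (0, X))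
      (((fderiv ℝ (fderiv ℝ μ) (x₀, x₀)).comp (.inl ℝ VG VG)).flip (0, X)) x₀ := by
    have h1 : HasFDerivAt (fun x => fderiv ℝ μ (x, x₀))
      ((fderiv ℝ (fderiv ℝ μ) (x₀, x₀)).comp (.inl ℝ VG VG)) x₀ :=
      HasFDerivAt.comp x₀ hd.hasFDerivAt (hasFDerivAt_prodMk_left x₀ x₀)
    have h2 := h1.clm_apply (hasFDerivAt_const ((0, X) : VG × VG) x₀)
    convert! h2 using 1
    ext; simp
  have hident : (fun x => ((fderiv ℝ μ (x₀, x)).comp (.inl ℝ VG VG)) (Ad (φ.symm x) X))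
      =ᶠ[nhds x₀] fun x => fderiv ℝ μ (x, x₀) (0, X) := by
    filter_upwards [(isOpen_extChartAt_target (1 : G)).mem_nhds chartOne_mem_target] with x hx
    rw [ContinuousLinearMap.comp_apply, ContinuousLinearMap.inl_apply,
      fderiv_chartMul_inr hx, fderiv_chartMul_inl hx]
    congr 1
    have h1 := md_rmul_lmul (1 : G) (φ.symm x) (Ad (φ.symm x) X)
    rwa [Ad_inv_Ad, one_mul, lmul_one] at h1
  have h1 := hR.clm_apply (hA.clm_apply (hasFDerivAt_const X x₀))
  have h2 := DFunLike.congr_fun ((h1.congr_of_eventuallyEq hident.symm).unique hL) a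
  have hone : (Ad (φ.symm x₀) : VG →L[ℝ] VG) = ContinuousLinearMap.id ℝ VG := by
    simp only [φ, x₀, chart_symm_chartOne, Ad_one]
  have hval : ∀ Y : VG, fderiv ℝ μ (x₀, x₀) (Y, 0) = Y := by
    intro Y
    rw [fderiv_chartMul_inl chartOne_mem_target]
    rw [chart_symm_chartOne, md_extChart_self]
    simp only [mul_one]
    rw [md_id]
    rfl
  have hsymm : fderiv ℝ (fderiv ℝ μ) (x₀, x₀) (0, a) (X, 0) =
      fderiv ℝ (fderiv ℝ μ) (x₀, x₀) (X, 0) (0, a) :=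
    ((contDiffAt_chartMul_one VG G).isSymmSndFDerivAt (by simp; norm_cast)) _ _
  rw [lieBr_eq_chartMul]
  have h3 : fderiv ℝ μ (x₀, x₀) (Ad (φ.symm x₀) 0 +
        (md (fun g : G => (Ad g : VG →L[ℝ] VG)) 1 : VG →L[ℝ] VG →L[ℝ] VG) a X, 0) +
      fderiv ℝ (fderiv ℝ μ) (x₀, x₀) (0, a) (Ad (φ.symm x₀) X, 0) =
      fderiv ℝ (fderiv ℝ μ) (x₀, x₀) (a, 0) (0, X) := h2
  rw [map_zero, zero_add, hval, hone, ContinuousLinearMap.id_apply, hsymm] at h3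
  rw [← h3, add_sub_cancel_right]

/-- The adjoint action along a curve `g` with velocity `g a`, applied to a moving vector `X`. -/
theorem HasLeftVel.hasDerivWithinAt_Ad {g : ℝ → G} {s : Set ℝ} {t : ℝ} {a : VG}
    (hg : HasLeftVel g s t a) {X : ℝ → VG} {X' : VG} (hX : HasDerivWithinAt X X' s t) :
    HasDerivWithinAt (fun t => Ad (g t) (X t)) (Ad (g t) (lieBr G a (X t) + X')) s t := by
  have hd : MDifferentiable 𝓘(ℝ, VG) 𝓘(ℝ, VG →L[ℝ] VG) (fun g : G => (Ad g : VG →L[ℝ] VG)) :=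
    (contMDiff_Ad (VG := VG) (G := G)).mdifferentiable (by simp)
  have h1 : HasDerivWithinAt (fun t => (Ad (g t) : VG →L[ℝ] VG)) _ s t :=
    HasVelWithin.iff_hasDerivWithinAt.1 (HasVelWithin.comp hg (hd _))
  have h2 := md_comp (V := VG) (V' := VG) (V'' := VG →L[ℝ] VG) (x := 1)
    (g := fun g : G => (Ad g : VG →L[ℝ] VG)) (hd (g t * 1)) (mdifferentiable_lmul (g t) _)
  have h3 := md_comp (V := VG) (V' := VG →L[ℝ] VG) (V'' := VG →L[ℝ] VG) (x := (1 : G))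
    (g := fun A : VG →L[ℝ] VG => (Ad (g t) : VG →L[ℝ] VG).comp A)
    (f := fun g : G => (Ad g : VG →L[ℝ] VG))
    ((ContinuousLinearMap.compL ℝ VG VG VG (Ad (g t))).differentiableAt.mdifferentiableAt) (hd _)
  have h4 : (md (fun A : VG →L[ℝ] VG => (Ad (g t) : VG →L[ℝ] VG).comp A)
      (Ad (1 : G) : VG →L[ℝ] VG) : (VG →L[ℝ] VG) →L[ℝ] (VG →L[ℝ] VG)) =
      ContinuousLinearMap.compL ℝ VG VG VG (Ad (g t)) := by
    rw [md_eq_fderiv]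
    exact (ContinuousLinearMap.compL ℝ VG VG VG (Ad (g t))).fderiv
  simp only [Ad_mul, mul_one] at h2
  rw [h3, h4] at h2
  have h5 := DFunLike.congr_fun (DFunLike.congr_fun h2 a) (X t)
  have h6 : Ad (g t) ((md (fun g : G => (Ad g : VG →L[ℝ] VG)) 1 : VG →L[ℝ] VG →L[ℝ] VG)
      a (X t)) = (md (fun g : G => (Ad g : VG →L[ℝ] VG)) (g t) : VG →L[ℝ] VG →L[ℝ] VG)
      (lmul (g t) a) (X t) := h5
  rw [md_Ad_one] at h6
  rw [map_add, h6]
  exact h1.clm_apply hX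

end AdDerivative

/-! ### Path-ordered exponentials: estimates and existence -/

noncomputable section PathOrdered

open Topology

/-- The Picard-Lindelöf theorem, with the information that the solution stays in the ball. -/
theorem IsPicardLindelof.exists_solution_mem_closedBall {F : Type*} [NormedAddCommGroup F]
    [NormedSpace ℝ F] [CompleteSpace F] {f : ℝ → F → F} {a b : ℝ} {t₀ : Icc a b} {x₀ : F}
    {R L K : NNReal} (hf : IsPicardLindelof f t₀ x₀ R 0 L K) :
    ∃ x : ℝ → F, x t₀ = x₀ ∧ ∀ t ∈ Icc a b, x t ∈ Metric.closedBall x₀ R ∧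
      HasDerivWithinAt x (f t (x t)) (Icc a b) t := by
  have hx : x₀ ∈ Metric.closedBall x₀ ((0 : NNReal) : ℝ) := Metric.mem_closedBall_self le_rfl
  obtain ⟨α, hα⟩ := ODE.FunSpace.exists_isFixedPt_next hf hx
  refine ⟨α.compProj, by rw [ODE.FunSpace.compProj_val, ← hα, ODE.FunSpace.next_apply₀],
    fun t ht => ⟨α.compProj_mem_closedBall hf.mul_max_le, ?_⟩⟩
  apply ODE.hasDerivWithinAt_picard_Icc t₀.2 hf.continuousOn_uncurry
    α.continuous_compProj.continuousOn (fun _ _ ↦ α.compProj_mem_closedBall hf.mul_max_le)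
    x₀ ht |>.congr_of_mem _ ht
  intro t' ht'
  nth_rw 1 [← hα]
  rw [ODE.FunSpace.compProj_of_mem ht', ODE.FunSpace.next_apply]

variable {VG : Type*} [NormedAddCommGroup VG] [NormedSpace ℝ VG]
  {G : Type*} [TopologicalSpace G] [ChartedSpace VG G] [Group G] [LieGroup 𝓘(ℝ, VG) ∞ G]

/-- `g` is the path-ordered exponential of the Lie algebra valued function `α` on the unit
interval, i.e. `g' = g α` and `g 0 = 1`. -/
def IsPOE (α : ℝ → VG) (g : ℝ → G) : Prop :=
  g 0 = 1 ∧ ∀ t ∈ Icc (0 : ℝ) 1, HasLeftVel g (Icc 0 1) t (α t)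

theorem IsPOE.continuousOn {α : ℝ → VG} {g : ℝ → G} (h : IsPOE α g) :
    ContinuousOn g (Icc 0 1) := fun t ht => (h.2 t ht).continuousWithinAt

theorem IsPOE.eqOn [T2Space G] {α : ℝ → VG} {g h : ℝ → G} (hg : IsPOE α g) (hh : IsPOE α h)
    {t : ℝ} (ht : t ∈ Icc (0 : ℝ) 1) : g t = h t :=
  HasLeftVel.eq_of_eq_zero hg.2 hh.2 (hg.1.trans hh.1.symm) ht

variable (VG G) in
/-- The derivative of left translation in the chart at `1`, as a function of the chart point. -/
def chartField (x : VG) : VG →L[ℝ] VG :=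
  (fderiv ℝ (chartMul VG G) (x, chartOne VG G)).comp (.inr ℝ VG VG)

variable (VG G) in
theorem contDiffAt_chartField : ContDiffAt ℝ 1 (chartField VG G) (chartOne VG G) := by
  have h1 : ContDiffAt ℝ 1 (fderiv ℝ (chartMul VG G)) (chartOne VG G, chartOne VG G) :=
    (contDiffAt_chartMul_one VG G).fderiv_right (m := 1) (by norm_cast)
  have h2 : ContDiffAt ℝ 1 (fun x => fderiv ℝ (chartMul VG G) (x, chartOne VG G))
      (chartOne VG G) :=
    ContDiffAt.comp (g := fderiv ℝ (chartMul VG G)) (chartOne VG G) h1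
      (contDiffAt_id.prodMk contDiffAt_const)
  exact h2.clm_comp contDiffAt_const

theorem chartField_apply {x : VG} (hx : x ∈ (extChartAt 𝓘(ℝ, VG) (1 : G)).target) (X : VG) :
    chartField VG G x X = (md (extChartAt 𝓘(ℝ, VG) (1 : G))
      ((extChartAt 𝓘(ℝ, VG) (1 : G)).symm x) : VG →L[ℝ] VG)
        (lmul ((extChartAt 𝓘(ℝ, VG) (1 : G)).symm x) X) :=
  fderiv_chartMul_inr hx X

variable (VG G) in
theorem chartField_chartOne : chartField VG G (chartOne VG G) = ContinuousLinearMap.id ℝ VG := by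
  ext X
  rw [chartField_apply chartOne_mem_target, chart_symm_chartOne, lmul_one, md_extChart_self]
  rfl

theorem HasLeftVel.hasDerivWithinAt_chart {g : ℝ → G} {s : Set ℝ} {t : ℝ} {X : VG}
    (h : HasLeftVel g s t X) (hx : g t ∈ (extChartAt 𝓘(ℝ, VG) (1 : G)).source) :
    HasDerivWithinAt (fun t => extChartAt 𝓘(ℝ, VG) (1 : G) (g t))
      (chartField VG G (extChartAt 𝓘(ℝ, VG) (1 : G) (g t)) X) s t := by
  rw [chartField_apply ((extChartAt 𝓘(ℝ, VG) (1 : G)).map_source hx),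
    (extChartAt 𝓘(ℝ, VG) (1 : G)).left_inv hx]
  exact HasVelWithin.hasDerivWithinAt_extChart h hx

/-- A solution of the left-invariant equation in the chart gives one in the group. -/
theorem hasLeftVel_of_chart {x : ℝ → VG} {s : Set ℝ} {t : ℝ} {X : VG}
    (hx : x t ∈ (extChartAt 𝓘(ℝ, VG) (1 : G)).target)
    (h : HasDerivWithinAt x (chartField VG G (x t) X) s t) :
    HasLeftVel (fun t => (extChartAt 𝓘(ℝ, VG) (1 : G)).symm (x t)) s t X := by
  have h1 := HasVelWithin.comp (V' := VG) (HasVelWithin.iff_hasDerivWithinAt.2 h)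
    (mdifferentiableAt_extChart_symm hx)
  unfold HasLeftVel
  have h2 := md_symm_md_extChart ((extChartAt 𝓘(ℝ, VG) (1 : G)).map_target hx)
    (lmul ((extChartAt 𝓘(ℝ, VG) (1 : G)).symm (x t)) X)
  rw [← chartField_apply hx, (extChartAt 𝓘(ℝ, VG) (1 : G)).right_inv hx] at h2
  rwa [h2] at h1

/-- A path-ordered exponential of a small function stays close to `1`, and is to first order
given by the integral of that function. Here `A` is a primitive of `α'`, which approximates `α`
up to `δ`. -/
theorem IsPOE.small [FiniteDimensional ℝ VG] [T2Space G] {ε : ℝ} (hε : 0 < ε) :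
    ∃ η > 0, ∀ (g : ℝ → G) (α α' A : ℝ → VG) (M δ : ℝ), IsPOE α g →
      (∀ t ∈ Icc (0 : ℝ) 1, HasDerivWithinAt A (α' t) (Icc 0 1) t) → A 0 = 0 →
      (∀ t ∈ Icc (0 : ℝ) 1, ‖α t‖ ≤ M) → (∀ t ∈ Icc (0 : ℝ) 1, ‖α t - α' t‖ ≤ δ) → M ≤ η →
      ∀ t ∈ Icc (0 : ℝ) 1, g t ∈ (extChartAt 𝓘(ℝ, VG) (1 : G)).source ∧
        ‖extChartAt 𝓘(ℝ, VG) (1 : G) (g t) - chartOne VG G - A t‖ ≤ ε * M + δ := by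
  set φ := extChartAt 𝓘(ℝ, VG) (1 : G)
  set x₀ := chartOne VG G
  have hcont : ∀ᶠ x in 𝓝 x₀, x ∈ φ.target ∧
      ‖chartField VG G x - ContinuousLinearMap.id ℝ VG‖ < min ε 1 := by
    refine ((isOpen_extChartAt_target (1 : G)).eventually_mem chartOne_mem_target).and ?_
    have h := (contDiffAt_chartField VG G).continuousAt.sub_const (ContinuousLinearMap.id ℝ VG)
    refine h.norm.eventually_lt continuousAt_const ?_
    rw [chartField_chartOne]
    simpa using hε
  obtain ⟨r₀, hr₀, hball⟩ := Metric.eventually_nhds_iff_ball.1 hcont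
  obtain ⟨r, hr, hrr⟩ : ∃ r > 0, r < r₀ := ⟨r₀ / 2, by positivity, by linarith⟩
  have hsub : Metric.closedBall x₀ r ⊆ Metric.ball x₀ r₀ := Metric.closedBall_subset_ball hrr
  refine ⟨r / 4, by positivity, fun g α α' A M δ hg hA hA0 hM hδ hMr => ?_⟩
  have hM0 : 0 ≤ M := (norm_nonneg _).trans (hM 0 (by simp))
  set K : Set G := φ.symm '' Metric.closedBall x₀ r
  set U : Set G := φ.source ∩ φ ⁻¹' Metric.ball x₀ r
  have hKc : IsClosed K := by
    refine ((isCompact_closedBall x₀ r).image_of_continuousOn ?_).isClosed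
    exact (continuousOn_extChartAt_symm (1 : G)).mono fun x hx => (hball x (hsub hx)).1
  have hUo : IsOpen U := isOpen_extChartAt_preimage' (1 : G) Metric.isOpen_ball
  have hUK : U ⊆ K := fun x hx =>
    ⟨φ x, Metric.ball_subset_closedBall hx.2, φ.left_inv hx.1⟩
  have hKs : ∀ x ∈ K, x ∈ φ.source ∧ φ x ∈ Metric.closedBall x₀ r := by
    rintro _ ⟨y, hy, rfl⟩
    have hyt := (hball y (hsub hy)).1
    exact ⟨φ.map_target hyt, by rwa [φ.right_inv hyt]⟩
  have hfield : ∀ x ∈ K, ∀ X : VG, ‖chartField VG G (φ x) X - X‖ ≤ min ε 1 * ‖X‖ := by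
    intro x hx X
    have h1 := (hball _ (hsub (hKs x hx).2)).2.le
    exact ((chartField VG G (φ x) - ContinuousLinearMap.id ℝ VG).le_opNorm X).trans
      (mul_le_mul_of_nonneg_right h1 (norm_nonneg _))
  have hg0 : g 0 ∈ U := by
    rw [hg.1]
    exact ⟨mem_extChartAt_source _, Metric.mem_ball_self hr⟩
  have hφ0 : φ (g 0) = x₀ := by rw [hg.1]; rfl
  -- As long as the curve stays in `K`, the mean value inequality keeps it in the smaller set `U`.
  have hstay : ∀ t ∈ Icc (0 : ℝ) 1, (∀ τ ∈ Icc 0 t, g τ ∈ K) → g t ∈ U := by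
    intro t ht hτ
    have h1 : ∀ τ ∈ Icc 0 t, HasDerivWithinAt (fun t => φ (g t))
        (chartField VG G (φ (g τ)) (α τ)) (Icc 0 t) τ := fun τ h =>
      ((hg.2 τ ⟨h.1, h.2.trans ht.2⟩).hasDerivWithinAt_chart (hKs _ (hτ τ h)).1).mono
        (Icc_subset_Icc_right ht.2)
    have h2 := (convex_Icc 0 t).norm_image_sub_le_of_norm_hasDerivWithin_le (C := 2 * M) h1
      (fun τ h => ?_) ⟨le_rfl, ht.1⟩ ⟨ht.1, le_rfl⟩
    · refine ⟨(hKs _ (hτ t ⟨ht.1, le_rfl⟩)).1, ?_⟩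
      rw [mem_preimage, Metric.mem_ball, dist_eq_norm]
      rw [hφ0, sub_zero, Real.norm_of_nonneg ht.1] at h2
      calc _ ≤ 2 * M * t := h2
        _ ≤ 2 * M * 1 := by gcongr; exact ht.2
        _ < r := by linarith
    · have h3 := hfield _ (hτ τ h) (α τ)
      have h4 := hM τ ⟨h.1, h.2.trans ht.2⟩
      have h5 : min ε 1 * ‖α τ‖ ≤ 1 * ‖α τ‖ :=
        mul_le_mul_of_nonneg_right (min_le_right _ _) (norm_nonneg _)
      have h6 := norm_le_norm_sub_add (chartField VG G (φ (g τ)) (α τ)) (α τ)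
      linarith
  have hall : ∀ t ∈ Icc (0 : ℝ) 1, g t ∈ U := by
    by_contra! hcon
    have hcl : IsCompact (Icc (0 : ℝ) 1 ∩ g ⁻¹' Uᶜ) :=
      isCompact_Icc.of_isClosed_subset
        (hg.continuousOn.preimage_isClosed_of_isClosed isClosed_Icc hUo.isClosed_compl)
        inter_subset_left
    obtain ⟨t₁, ⟨ht₁, hgt₁⟩, hmin⟩ := hcl.exists_isLeast hcon
    have hbefore : ∀ τ ∈ Ico 0 t₁, g τ ∈ U := fun τ hτ => by
      by_contra h
      exact absurd (hmin ⟨⟨hτ.1, hτ.2.le.trans ht₁.2⟩, h⟩) (not_le.2 hτ.2)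
    have hpos : 0 < t₁ := ht₁.1.lt_of_ne fun h => hgt₁ (h ▸ hg0)
    have hlim : g t₁ ∈ K := by
      have hcl2 : t₁ ∈ closure (Ico 0 t₁) := by
        rw [closure_Ico hpos.ne]
        exact ⟨hpos.le, le_rfl⟩
      have : ContinuousWithinAt g (Ico 0 t₁) t₁ :=
        (hg.continuousOn t₁ ht₁).mono fun τ hτ => ⟨hτ.1, hτ.2.le.trans ht₁.2⟩
      rw [← hKc.closure_eq]
      exact this.mem_closure hcl2 fun τ hτ => hUK (hbefore τ hτ)
    refine hgt₁ (hstay t₁ ht₁ fun τ hτ => ?_)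
    rcases hτ.2.lt_or_eq with h | h
    · exact hUK (hbefore τ ⟨hτ.1, h⟩)
    · rwa [h]
  intro t ht
  refine ⟨(hall t ht).1, ?_⟩
  have h1 : ∀ τ ∈ Icc (0 : ℝ) 1, HasDerivWithinAt (fun t => φ (g t) - A t)
      (chartField VG G (φ (g τ)) (α τ) - α' τ) (Icc 0 1) τ := fun τ h =>
    ((hg.2 τ h).hasDerivWithinAt_chart (hall τ h).1).sub (hA τ h)
  have h2 := (convex_Icc (0 : ℝ) 1).norm_image_sub_le_of_norm_hasDerivWithin_le
    (C := ε * M + δ) h1 (fun τ h => ?_)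
    (⟨le_rfl, zero_le_one⟩ : (0 : ℝ) ∈ Icc (0 : ℝ) 1) ht
  · rw [hφ0, hA0, sub_zero, sub_zero, Real.norm_of_nonneg ht.1, sub_right_comm] at h2
    have h3 : 0 ≤ δ := (norm_nonneg _).trans (hδ t ht)
    calc _ ≤ (ε * M + δ) * t := h2
      _ ≤ (ε * M + δ) * 1 := by gcongr; exact ht.2
      _ = _ := mul_one _
  · have h3 := hfield _ (hUK (hall τ h)) (α τ)
    have h4 := hM τ h
    have h5 : min ε 1 * ‖α τ‖ ≤ ε * M :=
      mul_le_mul (min_le_left _ _) h4 (norm_nonneg _) hε.le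
    have h6 := norm_sub_le_norm_sub_add_norm_sub (chartField VG G (φ (g τ)) (α τ)) (α τ) (α' τ)
    have h7 := hδ τ h
    linarith

/-- Local existence of path-ordered exponentials, uniform in terms of a bound on the integrand. -/
theorem exists_hasLeftVel_of_small [FiniteDimensional ℝ VG] : ∃ η > 0, ∀ (a b M : ℝ) (α : ℝ → VG),
    a ≤ b → ContinuousOn α (Icc a b) → (∀ t ∈ Icc a b, ‖α t‖ ≤ M) → M * (b - a) ≤ η →
    ∃ k : ℝ → G, k a = 1 ∧ ∀ t ∈ Icc a b, HasLeftVel k (Icc a b) t (α t) := by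
  set φ := extChartAt 𝓘(ℝ, VG) (1 : G)
  set x₀ := chartOne VG G
  obtain ⟨K, S, hS, hlip⟩ := (contDiffAt_chartField VG G).exists_lipschitzOnWith
  have hnear : ∀ᶠ x in 𝓝 x₀, x ∈ S ∧ x ∈ φ.target ∧ ‖chartField VG G x‖ < 2 := by
    refine (Filter.eventually_mem_set.2 hS).and
      (((isOpen_extChartAt_target (1 : G)).eventually_mem chartOne_mem_target).and ?_)
    refine (contDiffAt_chartField VG G).continuousAt.norm.eventually_lt continuousAt_const ?_
    rw [chartField_chartOne]
    exact ContinuousLinearMap.norm_id_le.trans_lt one_lt_two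
  obtain ⟨r₀, hr₀, hball⟩ := Metric.eventually_nhds_iff_ball.1 hnear
  obtain ⟨r, hr, hrr⟩ : ∃ r > 0, r < r₀ := ⟨r₀ / 2, by positivity, by linarith⟩
  have hsub : Metric.closedBall x₀ r ⊆ Metric.ball x₀ r₀ := Metric.closedBall_subset_ball hrr
  refine ⟨r / 2, by positivity, fun a b M α hab hα hM hη => ?_⟩
  have hM0 : 0 ≤ M := (norm_nonneg _).trans (hM a ⟨le_rfl, hab⟩)
  lift r to NNReal using hr.le
  lift M to NNReal using hM0
  have hPL : IsPicardLindelof (fun t x => chartField VG G x (α t)) (⟨a, le_rfl, hab⟩ : Icc a b)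
      x₀ r 0 (2 * M) (K * M) := by
    refine ⟨fun t ht => ?_, fun x hx => ?_, fun t ht x hx => ?_, ?_⟩
    · refine LipschitzOnWith.of_dist_le_mul fun x hx y hy => ?_
      have h1 := hlip.dist_le_mul x (hball x (hsub hx)).1 y (hball y (hsub hy)).1
      rw [dist_eq_norm] at h1 ⊢
      rw [← sub_apply]
      calc _ ≤ ‖chartField VG G x - chartField VG G y‖ * ‖α t‖ :=
            ContinuousLinearMap.le_opNorm _ _
        _ ≤ (K * dist x y) * M := mul_le_mul h1 (hM t ht) (norm_nonneg _) (by positivity)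
        _ = _ := by push_cast; ring
    · exact (chartField VG G x).continuous.comp_continuousOn hα
    · exact ((chartField VG G x).le_opNorm _).trans
        (mul_le_mul (hball x (hsub hx)).2.2.le (hM t ht) (norm_nonneg _) zero_le_two)
    · have : max (b - a) (a - a) = b - a := by rw [sub_self]; exact max_eq_left (by linarith)
      simp only [this, NNReal.coe_zero, sub_zero, NNReal.coe_mul, NNReal.coe_ofNat]
      linarith
  obtain ⟨x, hx0, hx⟩ := hPL.exists_solution_mem_closedBall
  refine ⟨fun t => φ.symm (x t), ?_, fun t ht => ?_⟩
  · exact (congrArg φ.symm hx0).trans chart_symm_chartOne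
  · exact hasLeftVel_of_chart (hball _ (hsub (hx t ht).1)).2.1 (hx t ht).2

theorem HasLeftVel.congr_of_eventuallyEq {g g' : ℝ → G} {s : Set ℝ} {t : ℝ} {X : VG}
    (hg : HasLeftVel g s t X) (hc : g' =ᶠ[𝓝[s] t] g) (ht : g' t = g t) :
    HasLeftVel g' s t X := by
  unfold HasLeftVel at *
  rw [ht]
  exact HasVelWithin.congr_of_eventuallyEq hg hc ht

theorem exists_hasLeftVel_glue {a b c : ℝ} (hab : a ≤ b) (hbc : b ≤ c) {α : ℝ → VG}
    {g k : ℝ → G} (hg : ∀ t ∈ Icc a b, HasLeftVel g (Icc a b) t (α t))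
    (hk : ∀ t ∈ Icc b c, HasLeftVel k (Icc b c) t (α t)) (hb : g b = k b) :
    ∃ h : ℝ → G, h a = g a ∧ ∀ t ∈ Icc a c, HasLeftVel h (Icc a c) t (α t) := by
  refine ⟨fun t => if t ≤ b then g t else k t, if_pos hab, fun t ht => ?_⟩
  set h : ℝ → G := fun t => if t ≤ b then g t else k t
  have h1 : ∀ t ∈ Icc a b, HasLeftVel h (Icc a b) t (α t) := fun t ht =>
    (hg t ht).congr (fun x hx => if_pos hx.2) ht
  have hhk : ∀ x ∈ Icc b c, h x = k x := fun x hx => by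
    rcases hx.1.eq_or_lt with rfl | hlt
    · exact (if_pos le_rfl).trans hb
    · exact if_neg (not_le.2 hlt)
  have h2 : ∀ t ∈ Icc b c, HasLeftVel h (Icc b c) t (α t) := fun t ht =>
    (hk t ht).congr hhk ht
  rcases lt_trichotomy t b with hlt | rfl | hlt
  · refine HasVelWithin.mono_of_mem_nhdsWithin (h1 t ⟨ht.1, hlt.le⟩) ?_
    filter_upwards [self_mem_nhdsWithin, mem_nhdsWithin_of_mem_nhds (Iio_mem_nhds hlt)]
      with x hx hx' using ⟨hx.1, hx'.le⟩
  · have := HasVelWithin.union (h1 t ⟨hab, le_rfl⟩) (h2 t ⟨le_rfl, hbc⟩)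
    rwa [Icc_union_Icc_eq_Icc hab hbc] at this
  · refine HasVelWithin.mono_of_mem_nhdsWithin (h2 t ⟨hlt.le, ht.2⟩) ?_
    filter_upwards [self_mem_nhdsWithin, mem_nhdsWithin_of_mem_nhds (Ioi_mem_nhds hlt)]
      with x hx hx' using ⟨le_of_lt hx', hx.2⟩

variable (G) in
/-- Path-ordered exponentials of continuous functions exist on the whole unit interval: the local
solutions exist on intervals of a fixed length, and by left invariance the next one can be
translated to start where the previous one ends. -/
theorem exists_isPOE [FiniteDimensional ℝ VG] {α : ℝ → VG} (hα : ContinuousOn α (Icc 0 1)) :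
    ∃ g : ℝ → G, IsPOE α g := by
  obtain ⟨η, hη, hloc⟩ := exists_hasLeftVel_of_small (VG := VG) (G := G)
  obtain ⟨M, hM⟩ := isCompact_Icc.exists_bound_of_continuousOn hα
  have hM0 : 0 ≤ M := (norm_nonneg _).trans (hM 0 (by simp))
  obtain ⟨n, hn⟩ := exists_nat_gt (M / η)
  have hn0 : (0 : ℝ) < n := (div_nonneg hM0 hη.le).trans_lt hn
  have hstep : M * (1 / n) ≤ η := by
    rw [mul_one_div, div_le_iff₀ hn0]
    rw [div_lt_iff₀ hη] at hn
    linarith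
  have key : ∀ j : ℕ, j + 1 ≤ n → ∃ g : ℝ → G, g 0 = 1 ∧
      ∀ t ∈ Icc (0 : ℝ) ((j + 1 : ℕ) / n), HasLeftVel g (Icc 0 ((j + 1 : ℕ) / n)) t (α t) := by
    intro j
    induction j with
    | zero =>
      intro hj
      have h1 : (1 : ℝ) / n ≤ 1 := by
        rw [div_le_one hn0]
        exact_mod_cast hj
      have hs : Icc (0 : ℝ) (1 / n) ⊆ Icc 0 1 := Icc_subset_Icc_right h1
      simp only [zero_add, Nat.cast_one]
      exact hloc 0 (1 / n) M α (by positivity) (hα.mono hs) (fun t ht => hM t (hs ht))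
        (by rwa [sub_zero])
    | succ j ih =>
      intro hj
      obtain ⟨g, hg0, hg⟩ := ih (by omega)
      have hab : ((j + 1 : ℕ) : ℝ) / n ≤ ((j + 1 + 1 : ℕ) : ℝ) / n := by
        gcongr
        omega
      have hs : Icc (((j + 1 : ℕ) : ℝ) / n) (((j + 1 + 1 : ℕ) : ℝ) / n) ⊆ Icc 0 1 := by
        refine Icc_subset_Icc (by positivity) ?_
        rw [div_le_one hn0]
        exact_mod_cast hj
      obtain ⟨k, hk0, hk⟩ := hloc _ _ M α hab (hα.mono hs) (fun t ht => hM t (hs ht)) (by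
        have : ((j + 1 + 1 : ℕ) : ℝ) / n - ((j + 1 : ℕ) : ℝ) / n = 1 / n := by
          push_cast
          ring
        rwa [this])
      obtain ⟨h, hh0, hh⟩ := exists_hasLeftVel_glue (by positivity) hab hg
        (fun t ht => (hk t ht).const_mul (g (((j + 1 : ℕ) : ℝ) / n))) (by rw [hk0, mul_one])
      exact ⟨h, hh0.trans hg0, hh⟩
  have hn1 : n - 1 + 1 = n := Nat.sub_add_cancel (by exact_mod_cast hn0)
  obtain ⟨g, hg0, hg⟩ := key (n - 1) hn1.le
  rw [hn1, div_self hn0.ne'] at hg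
  exact ⟨g, hg0, hg⟩

end PathOrdered

/-! ### Path-ordered exponentials depending on a parameter -/

noncomputable section Parameters

open Topology

variable {VG : Type*} [NormedAddCommGroup VG] [NormedSpace ℝ VG] [FiniteDimensional ℝ VG]
  {G : Type*} [TopologicalSpace G] [T2Space G] [ChartedSpace VG G] [Group G]
  [LieGroup 𝓘(ℝ, VG) ∞ G]

/-- A continuous function on the unit square, as a family of functions on the unit interval, is
uniformly continuous in the parameter. -/
theorem eventually_forall_norm_sub_le {F : Type*} [NormedAddCommGroup F] {a : ℝ → ℝ → F}
    (ha : ContinuousOn (Function.uncurry a) (Icc 0 1 ×ˢ Icc 0 1)) {s₀ : ℝ}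
    (hs₀ : s₀ ∈ Icc (0 : ℝ) 1) {ε : ℝ} (hε : 0 < ε) :
    ∃ δ > 0, ∀ s ∈ Icc (0 : ℝ) 1, |s - s₀| < δ → ∀ t ∈ Icc (0 : ℝ) 1, ‖a s t - a s₀ t‖ ≤ ε := by
  have hu := (isCompact_Icc.prod isCompact_Icc).uniformContinuousOn_of_continuous ha
  obtain ⟨δ, hδ, h⟩ := Metric.uniformContinuousOn_iff.1 hu ε hε
  refine ⟨δ, hδ, fun s hs hss t ht => ?_⟩
  have := h (s, t) ⟨hs, ht⟩ (s₀, t) ⟨hs₀, ht⟩ (by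
    rw [Prod.dist_eq, dist_self, Real.dist_eq, max_eq_left (abs_nonneg _)]
    exact hss)
  rw [dist_eq_norm] at this
  exact this.le

theorem continuousOn_slice_right {X : Type*} [TopologicalSpace X] {a : ℝ → ℝ → X} {S T : Set ℝ}
    (ha : ContinuousOn (Function.uncurry a) (S ×ˢ T)) {s : ℝ} (hs : s ∈ S) :
    ContinuousOn (a s) T :=
  ha.comp (f := fun t => (s, t)) (by fun_prop) fun _ ht => ⟨hs, ht⟩

theorem continuousOn_slice_left {X : Type*} [TopologicalSpace X] {a : ℝ → ℝ → X} {S T : Set ℝ}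
    (ha : ContinuousOn (Function.uncurry a) (S ×ˢ T)) {t : ℝ} (ht : t ∈ T) :
    ContinuousOn (fun s => a s t) S :=
  ha.comp (f := fun s => (s, t)) (by fun_prop) fun _ hs => ⟨hs, ht⟩

theorem continuousOn_swap {X : Type*} [TopologicalSpace X] {a : ℝ → ℝ → X} {S T : Set ℝ}
    (ha : ContinuousOn (Function.uncurry a) (S ×ˢ T)) :
    ContinuousOn (Function.uncurry fun t s => a s t) (T ×ˢ S) :=
  ha.comp (f := fun p : ℝ × ℝ => (p.2, p.1)) (by fun_prop) fun _ hp => ⟨hp.2, hp.1⟩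

theorem continuousOn_Ad_comp {X : Type*} [TopologicalSpace X] {S : Set X} {g : X → G}
    (hg : ContinuousOn g S) : ContinuousOn (fun x => (Ad (g x) : VG →L[ℝ] VG)) S :=
  (contMDiff_Ad (VG := VG) (G := G)).continuous.comp_continuousOn hg

theorem IsPOE.exists_norm_Ad_le {α : ℝ → VG} {g : ℝ → G} (hg : IsPOE α g) :
    ∃ C > 0, ∀ t ∈ Icc (0 : ℝ) 1, ‖(Ad (g t) : VG →L[ℝ] VG)‖ ≤ C := by
  obtain ⟨C, hC⟩ := isCompact_Icc.exists_bound_of_continuousOn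
    (continuousOn_Ad_comp (VG := VG) hg.continuousOn)
  exact ⟨max C 1, lt_max_of_lt_right one_pos, fun t ht => (hC t ht).trans (le_max_left _ _)⟩

/-- The right quotient of two path-ordered exponentials is the path-ordered exponential of the
twisted difference. -/
theorem IsPOE.mul_inv {α β : ℝ → VG} {g h : ℝ → G} (hg : IsPOE α g) (hh : IsPOE β h) :
    IsPOE (fun t => Ad (h t) (α t - β t)) (fun t => g t * (h t)⁻¹) := by
  refine ⟨by simp [hg.1, hh.1], fun t ht => ?_⟩
  have := (hg.2 t ht).mul ((hh.2 t ht).inv (uniqueDiffOn_Icc_zero_one t ht))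
  rwa [inv_inv, ← sub_eq_add_neg, ← map_sub] at this

variable {a a' : ℝ → ℝ → VG} {g : ℝ → ℝ → G}

/-- Path-ordered exponentials depend continuously on parameters. -/
theorem IsPOE.continuousOn_param (ha : ContinuousOn (Function.uncurry a) (Icc 0 1 ×ˢ Icc 0 1))
    (hg : ∀ s ∈ Icc (0 : ℝ) 1, IsPOE (a s) (g s)) :
    ContinuousOn (Function.uncurry g) (Icc 0 1 ×ˢ Icc 0 1) := by
  set φ := extChartAt 𝓘(ℝ, VG) (1 : G)
  rintro ⟨s₀, t₀⟩ ⟨hs₀, ht₀⟩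
  obtain ⟨C, hC0, hC⟩ := (hg s₀ hs₀).exists_norm_Ad_le
  obtain ⟨η, hη, hsmall⟩ := IsPOE.small (VG := VG) (G := G) one_pos
  -- The quotient by the exponential for the parameter `s₀` is uniformly close to `1`.
  have hclose : ∀ ε > 0, ∃ δ > 0, ∀ s ∈ Icc (0 : ℝ) 1, |s - s₀| < δ → ∀ t ∈ Icc (0 : ℝ) 1,
      g s t * (g s₀ t)⁻¹ ∈ φ.source ∧ ‖φ (g s t * (g s₀ t)⁻¹) - chartOne VG G‖ ≤ ε := by
    intro ε hε
    obtain ⟨δ, hδ, hd⟩ := eventually_forall_norm_sub_le ha hs₀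
      (ε := min η (ε / 2) / C) (by positivity)
    refine ⟨δ, hδ, fun s hs hss t ht => ?_⟩
    have hM : ∀ t ∈ Icc (0 : ℝ) 1, ‖Ad (g s₀ t) (a s t - a s₀ t)‖ ≤ min η (ε / 2) := by
      intro t ht
      calc _ ≤ ‖(Ad (g s₀ t) : VG →L[ℝ] VG)‖ * ‖a s t - a s₀ t‖ :=
            ContinuousLinearMap.le_opNorm _ _
        _ ≤ C * (min η (ε / 2) / C) :=
            mul_le_mul (hC t ht) (hd s hs hss t ht) (norm_nonneg _) hC0.le
        _ = _ := by field_simp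
    have h1 := hsmall _ _ (fun _ => 0) (fun _ => 0) _ (min η (ε / 2))
      ((hg s hs).mul_inv (hg s₀ hs₀)) (fun t _ => hasDerivWithinAt_const _ _ _) rfl hM
      (by simpa using hM) (min_le_left _ _) t ht
    refine ⟨h1.1, ?_⟩
    rw [sub_zero, one_mul] at h1
    linarith [h1.2, min_le_right η (ε / 2)]
  have hlim : Filter.Tendsto (fun p : ℝ × ℝ => φ (g p.1 p.2 * (g s₀ p.2)⁻¹))
      (𝓝[Icc 0 1 ×ˢ Icc 0 1] (s₀, t₀)) (𝓝 (chartOne VG G)) := by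
    rw [Metric.tendsto_nhdsWithin_nhds]
    intro ε hε
    obtain ⟨δ, hδ, h⟩ := hclose (ε / 2) (by positivity)
    refine ⟨δ, hδ, fun {p} hp hd => ?_⟩
    have hp1 : |p.1 - s₀| < δ := (le_max_left _ _).trans_lt hd
    rw [dist_eq_norm]
    linarith [(h p.1 hp.1 hp1 p.2 hp.2).2]
  have hlim2 : Filter.Tendsto (fun p : ℝ × ℝ => g p.1 p.2 * (g s₀ p.2)⁻¹)
      (𝓝[Icc 0 1 ×ˢ Icc 0 1] (s₀, t₀)) (𝓝 1) := by
    have h1 := (continuousAt_extChartAt_symm (I := 𝓘(ℝ, VG)) (1 : G)).tendsto.comp hlim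
    rw [extChartAt_to_inv] at h1
    refine h1.congr' ?_
    obtain ⟨δ, hδ, h⟩ := hclose 1 one_pos
    filter_upwards [self_mem_nhdsWithin, mem_nhdsWithin_of_mem_nhds (Metric.ball_mem_nhds _ hδ)]
      with p hp hd
    have hp1 : |p.1 - s₀| < δ := (le_max_left _ _).trans_lt hd
    exact φ.left_inv (h p.1 hp.1 hp1 p.2 hp.2).1
  have hcont : Filter.Tendsto (fun p : ℝ × ℝ => g s₀ p.2)
      (𝓝[Icc 0 1 ×ˢ Icc 0 1] (s₀, t₀)) (𝓝 (g s₀ t₀)) := by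
    have h1 : ContinuousOn (fun p : ℝ × ℝ => g s₀ p.2) (Icc 0 1 ×ˢ Icc 0 1) :=
      (hg s₀ hs₀).continuousOn.comp continuousOn_snd fun p hp => hp.2
    exact h1 (s₀, t₀) ⟨hs₀, ht₀⟩
  have : ContinuousMul G := topologicalGroup_of_lieGroup 𝓘(ℝ, VG) ∞ |>.toContinuousMul
  have h2 := hlim2.mul hcont
  rw [one_mul] at h2
  exact h2.congr fun p => by simp [Function.uncurry]

/-- Differentiation of a path-ordered exponential with respect to a parameter (Duhamel's formula):
if `∂g/∂t = g a(s, t)` and `g s 0 = 1` then `∂g/∂s = K g` with `K = ∫₀ᵗ Ad_g (∂a/∂s)`. -/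
theorem IsPOE.hasLeftVel_param
    (ha : ∀ s ∈ Icc (0 : ℝ) 1, ∀ t ∈ Icc (0 : ℝ) 1,
      HasDerivWithinAt (fun s => a s t) (a' s t) (Icc 0 1) s)
    (ha' : ContinuousOn (Function.uncurry a') (Icc 0 1 ×ˢ Icc 0 1))
    (hg : ∀ s ∈ Icc (0 : ℝ) 1, IsPOE (a s) (g s)) {s₀ : ℝ} (hs₀ : s₀ ∈ Icc (0 : ℝ) 1)
    {K : ℝ → VG} (hK : ∀ t ∈ Icc (0 : ℝ) 1,
      HasDerivWithinAt K (Ad (g s₀ t) (a' s₀ t)) (Icc 0 1) t) (hK0 : K 0 = 0)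
    {t₀ : ℝ} (ht₀ : t₀ ∈ Icc (0 : ℝ) 1) :
    HasLeftVel (fun s => g s t₀) (Icc 0 1) s₀ (Ad (g s₀ t₀)⁻¹ (K t₀)) := by
  set φ := extChartAt 𝓘(ℝ, VG) (1 : G)
  obtain ⟨C, hC0, hC⟩ := (hg s₀ hs₀).exists_norm_Ad_le
  obtain ⟨A, hA⟩ := isCompact_Icc.exists_bound_of_continuousOn
    (continuousOn_slice_right ha' hs₀)
  have hA0 : 0 ≤ A := (norm_nonneg _).trans (hA 0 (by simp))
  -- The first order Taylor expansion of `a` in `s`, uniform in `t`.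
  have htaylor : ∀ ε > 0, ∃ δ > 0, ∀ s ∈ Icc (0 : ℝ) 1, |s - s₀| < δ → ∀ t ∈ Icc (0 : ℝ) 1,
      ‖a s t - a s₀ t - (s - s₀) • a' s₀ t‖ ≤ ε * |s - s₀| := by
    intro ε hε
    obtain ⟨δ, hδ, hd⟩ := eventually_forall_norm_sub_le ha' hs₀ hε
    refine ⟨δ, hδ, fun s hs hss t ht => ?_⟩
    have hconv : Convex ℝ (Icc (0 : ℝ) 1 ∩ Metric.ball s₀ δ) :=
      (convex_Icc 0 1).inter (convex_ball _ _)
    have h1 : ∀ σ ∈ Icc (0 : ℝ) 1 ∩ Metric.ball s₀ δ, HasDerivWithinAt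
        (fun σ => a σ t - (σ - s₀) • a' s₀ t) (a' σ t - (1 : ℝ) • a' s₀ t)
        (Icc 0 1 ∩ Metric.ball s₀ δ) σ := fun σ hσ =>
      ((ha σ hσ.1 t ht).mono inter_subset_left).sub
        (((hasDerivWithinAt_id σ _).sub_const s₀).smul_const _)
    have h2 := hconv.norm_image_sub_le_of_norm_hasDerivWithin_le (C := ε) h1
      (fun σ hσ => by rw [one_smul]; exact hd σ hσ.1 hσ.2 t ht)
      ⟨hs₀, Metric.mem_ball_self hδ⟩ ⟨hs, hss⟩
    simpa [sub_right_comm] using h2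
  -- The quotient by the exponential for the parameter `s₀`, in the chart at `1`.
  have hquot : ∀ ε > 0, ∃ δ > 0, ∀ s ∈ Icc (0 : ℝ) 1, |s - s₀| < δ →
      g s t₀ * (g s₀ t₀)⁻¹ ∈ φ.source ∧
      ‖φ (g s t₀ * (g s₀ t₀)⁻¹) - chartOne VG G - (s - s₀) • K t₀‖ ≤ ε * |s - s₀| := by
    intro ε hε
    obtain ⟨η, hη, hsmall⟩ := IsPOE.small (VG := VG) (G := G)
      (ε := ε / (2 * (C * (A + 1)))) (by positivity)
    obtain ⟨δ, hδ, hd⟩ := htaylor (min 1 (ε / (2 * C))) (by positivity)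
    refine ⟨min δ (η / (C * (A + 1))), by positivity, fun s hs hss => ?_⟩
    have hd' := hd s hs (hss.trans_le (min_le_left _ _))
    have hs' : C * (A + 1) * |s - s₀| ≤ η := by
      have := (hss.trans_le (min_le_right _ _)).le
      rwa [le_div_iff₀ (by positivity), mul_comm] at this
    have hM : ∀ t ∈ Icc (0 : ℝ) 1,
        ‖Ad (g s₀ t) (a s t - a s₀ t)‖ ≤ C * (A + 1) * |s - s₀| := by
      intro t ht
      have h1 : ‖a s t - a s₀ t‖ ≤ (A + 1) * |s - s₀| := by
        have h2 := norm_le_norm_sub_add (a s t - a s₀ t) ((s - s₀) • a' s₀ t)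
        have h3 : ‖(s - s₀) • a' s₀ t‖ ≤ A * |s - s₀| := by
          rw [norm_smul, Real.norm_eq_abs, mul_comm]
          exact mul_le_mul_of_nonneg_right (hA t ht) (abs_nonneg _)
        have h4 := mul_le_mul_of_nonneg_right (min_le_left 1 (ε / (2 * C))) (abs_nonneg (s - s₀))
        linarith [hd' t ht]
      calc _ ≤ ‖(Ad (g s₀ t) : VG →L[ℝ] VG)‖ * ‖a s t - a s₀ t‖ :=
            ContinuousLinearMap.le_opNorm _ _
        _ ≤ C * ((A + 1) * |s - s₀|) := mul_le_mul (hC t ht) h1 (norm_nonneg _) hC0.le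
        _ = _ := by ring
    have hdiff : ∀ t ∈ Icc (0 : ℝ) 1, ‖Ad (g s₀ t) (a s t - a s₀ t) -
        (s - s₀) • Ad (g s₀ t) (a' s₀ t)‖ ≤ ε / 2 * |s - s₀| := by
      intro t ht
      rw [← map_smul, ← map_sub]
      calc _ ≤ ‖(Ad (g s₀ t) : VG →L[ℝ] VG)‖ * _ := ContinuousLinearMap.le_opNorm _ _
        _ ≤ C * (ε / (2 * C) * |s - s₀|) := mul_le_mul (hC t ht)
            ((hd' t ht).trans (mul_le_mul_of_nonneg_right (min_le_right _ _) (abs_nonneg _)))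
            (norm_nonneg _) hC0.le
        _ = _ := by field_simp
    have h1 := hsmall _ _ _ (fun t => (s - s₀) • K t) _ _
      ((hg s hs).mul_inv (hg s₀ hs₀)) (fun t ht => (hK t ht).const_smul (s - s₀))
      (by simp [hK0]) hM hdiff hs' t₀ ht₀
    refine ⟨h1.1, h1.2.trans (le_of_eq ?_)⟩
    field_simp
    ring
  have hquot0 : φ (g s₀ t₀ * (g s₀ t₀)⁻¹) = chartOne VG G := by
    rw [mul_inv_cancel]
    rfl
  have hder : HasDerivWithinAt (fun s => φ (g s t₀ * (g s₀ t₀)⁻¹)) (K t₀) (Icc 0 1) s₀ := by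
    rw [hasDerivWithinAt_iff_isLittleO, Asymptotics.isLittleO_iff]
    intro ε hε
    obtain ⟨δ, hδ, h⟩ := hquot ε hε
    filter_upwards [self_mem_nhdsWithin, mem_nhdsWithin_of_mem_nhds (Metric.ball_mem_nhds _ hδ)]
      with s hs hd
    rw [hquot0, Real.norm_eq_abs]
    exact (h s hs hd).2
  have hvel : HasLeftVel (fun s => g s t₀ * (g s₀ t₀)⁻¹) (Icc 0 1) s₀ (K t₀) := by
    have h1 := hasLeftVel_of_chart (x := fun s => φ (g s t₀ * (g s₀ t₀)⁻¹)) (G := G)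
      (s := Icc 0 1) (t := s₀) (X := K t₀)
      (by rw [hquot0]; exact chartOne_mem_target)
      (by rwa [hquot0, chartField_chartOne])
    refine h1.congr_of_eventuallyEq ?_ ?_
    · obtain ⟨δ, hδ, h⟩ := hquot 1 one_pos
      filter_upwards [self_mem_nhdsWithin, mem_nhdsWithin_of_mem_nhds (Metric.ball_mem_nhds _ hδ)]
        with s hs hd
      exact (φ.left_inv (h s hs hd).1).symm
    · exact (φ.left_inv (by rw [mul_inv_cancel]; exact mem_extChartAt_source _)).symm
  simpa using hvel.mul_const (g s₀ t₀)

end Parameters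

/-! ### Primitives depending on a parameter -/

section Primitives

variable {F : Type*} [NormedAddCommGroup F] [NormedSpace ℝ F] [CompleteSpace F]
  {f : ℝ → ℝ → F}

theorem exists_continuous_extension (hf : ContinuousOn (Function.uncurry f) (Icc 0 1 ×ˢ Icc 0 1)) :
    ∃ f' : ℝ → ℝ → F, Continuous (Function.uncurry f') ∧
      ∀ s ∈ Icc (0 : ℝ) 1, ∀ t ∈ Icc (0 : ℝ) 1, f' s t = f s t := by
  refine ⟨fun s t => f (projIcc 0 1 zero_le_one s) (projIcc 0 1 zero_le_one t), ?_, ?_⟩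
  · refine hf.comp_continuous (f := fun p : ℝ × ℝ =>
      ((projIcc 0 1 zero_le_one p.1 : ℝ), (projIcc 0 1 zero_le_one p.2 : ℝ))) ?_ ?_
    · exact (continuous_subtype_val.comp (continuous_projIcc.comp continuous_fst)).prodMk
        (continuous_subtype_val.comp (continuous_projIcc.comp continuous_snd))
    · exact fun p => ⟨Subtype.coe_prop _, Subtype.coe_prop _⟩
  · intro s hs t ht
    simp only [projIcc_of_mem _ hs, projIcc_of_mem _ ht]

theorem uIcc_zero_subset {t : ℝ} (ht : t ∈ Icc (0 : ℝ) 1) : uIcc 0 t ⊆ Icc 0 1 := by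
  rw [uIcc_of_le ht.1]
  exact Icc_subset_Icc_right ht.2

theorem integral_zero_congr {f g : ℝ → F} {t : ℝ} (ht : t ∈ Icc (0 : ℝ) 1)
    (h : ∀ x ∈ Icc (0 : ℝ) 1, f x = g x) : ∫ x in (0 : ℝ)..t, f x = ∫ x in (0 : ℝ)..t, g x :=
  intervalIntegral.integral_congr fun _ hx => h _ (uIcc_zero_subset ht hx)

theorem continuousOn_primitive_param
    (hf : ContinuousOn (Function.uncurry f) (Icc 0 1 ×ˢ Icc 0 1)) :
    ContinuousOn (Function.uncurry fun s t => ∫ t' in (0 : ℝ)..t, f s t')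
      (Icc 0 1 ×ˢ Icc 0 1) := by
  obtain ⟨f', hf', heq⟩ := exists_continuous_extension hf
  have h1 : Continuous (fun p : ℝ × ℝ => ∫ t' in (0 : ℝ)..p.2, f' p.1 t') := by
    refine intervalIntegral.continuous_parametric_intervalIntegral_of_continuous
      (f := fun (p : ℝ × ℝ) t => f' p.1 t) ?_ continuous_snd
    exact hf'.comp (f := fun q : (ℝ × ℝ) × ℝ => (q.1.1, q.2)) (by fun_prop)
  refine h1.continuousOn.congr fun p hp => ?_
  exact integral_zero_congr hp.2 fun x hx => (heq _ hp.1 _ hx).symm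

theorem hasDerivWithinAt_primitive_zero {f : ℝ → F} (hf : ContinuousOn f (Icc 0 1)) {t : ℝ}
    (ht : t ∈ Icc (0 : ℝ) 1) :
    HasDerivWithinAt (fun t => ∫ t' in (0 : ℝ)..t, f t') (f t) (Icc 0 1) t := by
  have h := hf.comp_continuous (f := fun x => (projIcc (0 : ℝ) 1 zero_le_one x : ℝ))
    (continuous_subtype_val.comp continuous_projIcc) fun x => Subtype.coe_prop _
  have h1 := (h.integral_hasStrictDerivAt 0 t).hasDerivAt.hasDerivWithinAt (s := Icc 0 1)
  have hft : (f ∘ fun x => (projIcc (0 : ℝ) 1 zero_le_one x : ℝ)) t = f t := by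
    rw [Function.comp_apply, projIcc_of_mem _ ht]
  rw [hft] at h1
  have h2 : ∀ x ∈ Icc (0 : ℝ) 1, ∫ t' in (0 : ℝ)..x, f t' =
      ∫ t' in (0 : ℝ)..x, f (projIcc (0 : ℝ) 1 zero_le_one t' : ℝ) := fun x hx =>
    integral_zero_congr hx fun y hy => by rw [projIcc_of_mem _ hy]
  exact h1.congr h2 (h2 t ht)

theorem eq_of_hasDerivWithinAt_eq {f g f' : ℝ → F}
    (hf : ∀ t ∈ Icc (0 : ℝ) 1, HasDerivWithinAt f (f' t) (Icc 0 1) t)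
    (hg : ∀ t ∈ Icc (0 : ℝ) 1, HasDerivWithinAt g (f' t) (Icc 0 1) t) (h0 : f 0 = g 0)
    {t : ℝ} (ht : t ∈ Icc (0 : ℝ) 1) : f t = g t := by
  have h := (convex_Icc (0 : ℝ) 1).norm_image_sub_le_of_norm_hasDerivWithin_le (C := 0)
    (fun τ h => (hf τ h).sub (hg τ h)) (fun τ _ => by simp)
    (⟨le_rfl, zero_le_one⟩ : (0 : ℝ) ∈ Icc (0 : ℝ) 1) ht
  rw [zero_mul, norm_le_zero_iff] at h
  simp only [Pi.sub_apply, h0, sub_self, sub_zero] at h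
  exact sub_eq_zero.1 h

end Primitives

/-! ### Surface-ordered exponentials on the unit square -/

noncomputable section SquareLevel

variable {VG : Type*} [NormedAddCommGroup VG] [NormedSpace ℝ VG] [FiniteDimensional ℝ VG]
  {VE : Type*} [NormedAddCommGroup VE] [NormedSpace ℝ VE] [FiniteDimensional ℝ VE]
  {G : Type*} [TopologicalSpace G] [T2Space G] [ChartedSpace VG G] [Group G]
  [LieGroup 𝓘(ℝ, VG) ∞ G]
  {E : Type*} [TopologicalSpace E] [T2Space E] [ChartedSpace VE E] [Group E]
  [LieGroup 𝓘(ℝ, VE) ∞ E]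

theorem lieBr_swap (X Y : VG) : lieBr G X Y = -lieBr G Y X := by
  rw [lieBr_eq_chartMul, lieBr_eq_chartMul, neg_sub]

namespace LieCrossedModule

/-- The differential `𝔢 → 𝔤` of `∂` as a continuous linear map. -/
def bdL (𝒢 : LieCrossedModule VG VE G E) : VE →L[ℝ] VG := md 𝒢.bd 1

/-- The action of `g` on `𝔢` as a continuous linear map. -/
def actL (𝒢 : LieCrossedModule VG VE G E) (g : G) : VE →L[ℝ] VE := md (fun e : E => 𝒢.act g e) 1

variable (𝒢 : LieCrossedModule VG VE G E)

theorem mdifferentiable_bd : MDifferentiable 𝓘(ℝ, VE) 𝓘(ℝ, VG) 𝒢.bd :=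
  𝒢.smooth_bd.mdifferentiable (by simp)

theorem mdifferentiable_act (g : G) :
    MDifferentiable 𝓘(ℝ, VE) 𝓘(ℝ, VE) (fun e : E => 𝒢.act g e) := by
  have h : ContMDiff 𝓘(ℝ, VE) 𝓘(ℝ, VE) ∞ (fun e : E => 𝒢.act g e) :=
    𝒢.smooth_act.comp (contMDiff_const.prodMk contMDiff_id)
  exact h.mdifferentiable (by simp)

theorem actL_mul (g h : G) : 𝒢.actL (g * h) = (𝒢.actL g).comp (𝒢.actL h) := by
  have h2 := md_comp (V := VE) (V' := VE) (V'' := VE) (g := fun e : E => 𝒢.act g e)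
    (f := fun e : E => 𝒢.act h e) (x := 1) (𝒢.mdifferentiable_act g _)
    (𝒢.mdifferentiable_act h _)
  simp only [map_one] at h2
  unfold actL
  rw [← h2]
  simp only [map_mul, MulAut.mul_apply]

theorem bdL_actL (g : G) (v : VE) : 𝒢.bdL (𝒢.actL g v) = Ad g (𝒢.bdL v) := by
  have h1 := md_comp (V := VE) (V' := VE) (V'' := VG) (g := 𝒢.bd)
    (f := fun e : E => 𝒢.act g e) (x := 1) (𝒢.mdifferentiable_bd _)
    (𝒢.mdifferentiable_act g _)
  have h2 := md_comp (V := VE) (V' := VG) (V'' := VG) (g := fun x : G => g * x * g⁻¹)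
    (f := 𝒢.bd) (x := 1) (mdifferentiable_conj g _) (𝒢.mdifferentiable_bd _)
  simp only [map_one, 𝒢.bd_act] at h1 h2
  unfold bdL actL Ad
  rw [← ContinuousLinearMap.comp_apply, ← h1, h2]
  rfl

/-- The infinitesimal form of the Peiffer identity. -/
theorem Ad_eq_actL (e : E) : (Ad e : VE →L[ℝ] VE) = 𝒢.actL (𝒢.bd e) := by
  unfold Ad actL
  simp only [𝒢.peiffer]

theorem continuousOn_actL {X : Type*} [TopologicalSpace X] {S : Set X} {g : X → G} {v : X → VE}
    (hg : ContinuousOn g S) (hv : ContinuousOn v S) :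
    ContinuousOn (fun x => 𝒢.actL (g x) (v x)) S := by
  have h : ContMDiff 𝓘(ℝ, VG) 𝓘(ℝ, VE →L[ℝ] VE) ∞ (fun g : G => 𝒢.actL g) :=
    contMDiff_md_of_fixed (f := fun (g : G) (e : E) => 𝒢.act g e) (z := 1) 𝒢.smooth_act (by simp)
  exact (h.continuous.comp_continuousOn hg).clm_apply hv

theorem hasLeftVel_bd {e : ℝ → E} {s : Set ℝ} {t : ℝ} {Z : VE} (he : HasLeftVel e s t Z) :
    HasLeftVel (fun t => 𝒢.bd (e t)) s t (𝒢.bdL Z) :=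
  he.hom 𝒢.bd 𝒢.mdifferentiable_bd

theorem hasLeftVel_act {e : ℝ → E} {s : Set ℝ} {t : ℝ} {Z : VE} (g : G)
    (he : HasLeftVel e s t Z) : HasLeftVel (fun t => 𝒢.act g (e t)) s t (𝒢.actL g Z) :=
  he.hom (𝒢.act g).toMonoidHom (𝒢.mdifferentiable_act g)

end LieCrossedModule

/-- The coefficients `A = a dt + b ds` of a connection on the unit square, with partial
derivatives `as = ∂a/∂s` and `bt = ∂b/∂t`, and a 2-form `β dt ∧ ds` such that `∂(β)` is the
curvature of `A`. All functions take the arguments `t` and `s`, in this order. -/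
structure SquareData (𝒢 : LieCrossedModule VG VE G E) (a b as bt : ℝ → ℝ → VG)
    (β : ℝ → ℝ → VE) : Prop where
  cont_a : ContinuousOn (Function.uncurry a) (Icc 0 1 ×ˢ Icc 0 1)
  cont_b : ContinuousOn (Function.uncurry b) (Icc 0 1 ×ˢ Icc 0 1)
  cont_as : ContinuousOn (Function.uncurry as) (Icc 0 1 ×ˢ Icc 0 1)
  cont_bt : ContinuousOn (Function.uncurry bt) (Icc 0 1 ×ˢ Icc 0 1)
  cont_β : ContinuousOn (Function.uncurry β) (Icc 0 1 ×ˢ Icc 0 1)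
  deriv_a : ∀ t ∈ Icc (0 : ℝ) 1, ∀ s ∈ Icc (0 : ℝ) 1,
    HasDerivWithinAt (fun s => a t s) (as t s) (Icc 0 1) s
  deriv_b : ∀ t ∈ Icc (0 : ℝ) 1, ∀ s ∈ Icc (0 : ℝ) 1,
    HasDerivWithinAt (fun t => b t s) (bt t s) (Icc 0 1) t
  curv : ∀ t ∈ Icc (0 : ℝ) 1, ∀ s ∈ Icc (0 : ℝ) 1,
    𝒢.bdL (β t s) = bt t s - as t s + lieBr G (a t s) (b t s)

/-- `(t, s) ↦ e t s` is the surface-ordered exponential for the coefficients `a`, `b`, `β`. -/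
def IsSurf (𝒢 : LieCrossedModule VG VE G E) (a b : ℝ → ℝ → VG) (β : ℝ → ℝ → VE)
    (e : ℝ → ℝ → E) : Prop :=
  ∃ (z : ℝ → G) (y : ℝ → ℝ → G), IsPOE (fun s => b 0 s) z ∧
    (∀ s ∈ Icc (0 : ℝ) 1, IsPOE (fun t => a t s) (y s)) ∧
    ∀ t ∈ Icc (0 : ℝ) 1, IsPOE
      (fun s => ∫ t' in (0 : ℝ)..t, 𝒢.actL (z s * y s t') (β t' s)) (fun s => e t s)

variable {𝒢 : LieCrossedModule VG VE G E} {a b as bt : ℝ → ℝ → VG} {β : ℝ → ℝ → VE}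

namespace SquareData

/-- The data for the square reflected in the diagonal. -/
theorem swap (D : SquareData 𝒢 a b as bt β) :
    SquareData 𝒢 (fun t s => b s t) (fun t s => a s t) (fun t s => bt s t) (fun t s => as s t)
      (fun t s => -β s t) where
  cont_a := continuousOn_swap D.cont_b
  cont_b := continuousOn_swap D.cont_a
  cont_as := continuousOn_swap D.cont_bt
  cont_bt := continuousOn_swap D.cont_as
  cont_β := (continuousOn_swap D.cont_β).neg
  deriv_a t ht s hs := D.deriv_b s hs t ht
  deriv_b t ht s hs := D.deriv_a s hs t ht
  curv t ht s hs := by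
    rw [map_neg, D.curv s hs t ht, lieBr_swap]
    abel

/-- The 2-form, transported to the corner `(0, 0)` along left edge and horizontal line, is
continuous. -/
theorem continuousOn_integrand (D : SquareData 𝒢 a b as bt β) {z : ℝ → G} {y : ℝ → ℝ → G}
    (hz : IsPOE (fun s => b 0 s) z) (hy : ∀ s ∈ Icc (0 : ℝ) 1, IsPOE (fun t => a t s) (y s)) :
    ContinuousOn (Function.uncurry fun s t => 𝒢.actL (z s * y s t) (β t s))
      (Icc 0 1 ×ˢ Icc 0 1) := by
  have : ContinuousMul G := topologicalGroup_of_lieGroup 𝓘(ℝ, VG) ∞ |>.toContinuousMul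
  refine 𝒢.continuousOn_actL (g := fun p : ℝ × ℝ => z p.1 * y p.1 p.2)
    (v := fun p : ℝ × ℝ => β p.2 p.1) ?_ (continuousOn_swap D.cont_β)
  refine ContinuousOn.mul (hz.continuousOn.comp continuousOn_fst fun p hp => hp.1) ?_
  exact IsPOE.continuousOn_param (a := fun s t => a t s) (continuousOn_swap D.cont_a) hy

theorem exists_isSurf (D : SquareData 𝒢 a b as bt β) : ∃ e, IsSurf 𝒢 a b β e := by
  obtain ⟨z, hz⟩ := exists_isPOE G
    (continuousOn_slice_right D.cont_b (⟨le_rfl, zero_le_one⟩ : (0 : ℝ) ∈ Icc (0 : ℝ) 1))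
  have hy : ∀ s, ∃ y : ℝ → G, s ∈ Icc (0 : ℝ) 1 → IsPOE (fun t => a t s) y := fun s => by
    by_cases hs : s ∈ Icc (0 : ℝ) 1
    · obtain ⟨y, hy⟩ := exists_isPOE G (continuousOn_slice_left D.cont_a hs)
      exact ⟨y, fun _ => hy⟩
    · exact ⟨fun _ => 1, fun h => absurd h hs⟩
  choose y hy using hy
  have hJ := continuousOn_primitive_param (D.continuousOn_integrand hz hy)
  have he : ∀ t, ∃ e : ℝ → E, t ∈ Icc (0 : ℝ) 1 → IsPOE
      (fun s => ∫ t' in (0 : ℝ)..t, 𝒢.actL (z s * y s t') (β t' s)) e := fun t => by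
    by_cases ht : t ∈ Icc (0 : ℝ) 1
    · obtain ⟨e, he⟩ := exists_isPOE E (continuousOn_slice_left hJ ht)
      exact ⟨e, fun _ => he⟩
    · exact ⟨fun _ => 1, fun h => absurd h ht⟩
  choose e he using he
  exact ⟨e, z, y, hz, hy, he⟩

/-- Non-abelian Stokes theorem: the surface-ordered exponential compares the transport along the
left and top edges of the rectangle `[0, t] × [0, s]` with that along its bottom and right
edges. -/
theorem bd_mul (D : SquareData 𝒢 a b as bt β) {z x : ℝ → G} {y w : ℝ → ℝ → G} {e : ℝ → ℝ → E}
    (hz : IsPOE (fun s => b 0 s) z) (hy : ∀ s ∈ Icc (0 : ℝ) 1, IsPOE (fun t => a t s) (y s))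
    (he : ∀ t ∈ Icc (0 : ℝ) 1, IsPOE
      (fun s => ∫ t' in (0 : ℝ)..t, 𝒢.actL (z s * y s t') (β t' s)) (fun s => e t s))
    (hx : IsPOE (fun t => a t 0) x) (hw : ∀ t ∈ Icc (0 : ℝ) 1, IsPOE (fun s => b t s) (w t))
    {t s : ℝ} (ht : t ∈ Icc (0 : ℝ) 1) (hs : s ∈ Icc (0 : ℝ) 1) :
    𝒢.bd (e t s) * (z s * y s t) = x t * w t s := by
  have h0 : (0 : ℝ) ∈ Icc (0 : ℝ) 1 := ⟨le_rfl, zero_le_one⟩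
  have hintegrand := D.continuousOn_integrand hz hy
  refine HasLeftVel.eq_of_eq_zero (α := fun s => b t s)
    (g := fun s => 𝒢.bd (e t s) * (z s * y s t)) (h := fun s => x t * w t s)
    (fun s hs => ?_) (fun s hs => ((hw t ht).2 s hs).const_mul (x t)) ?_ hs
  · -- The derivative of `y` in the direction of `s`.
    set K : ℝ → VG := fun t => ∫ t' in (0 : ℝ)..t, Ad (y s t') (as t' s) with hKdef
    have hAd : ContinuousOn (fun t => Ad (y s t) (as t s)) (Icc 0 1) :=
      (continuousOn_Ad_comp (hy s hs).continuousOn).clm_apply (continuousOn_slice_left D.cont_as hs)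
    have hK := fun t (ht : t ∈ Icc (0 : ℝ) 1) => hasDerivWithinAt_primitive_zero hAd ht
    have hys : HasLeftVel (fun s => y s t) (Icc 0 1) s (Ad (y s t)⁻¹ (K t)) :=
      IsPOE.hasLeftVel_param (a := fun s t => a t s) (a' := fun s t => as t s)
        (fun s hs t ht => D.deriv_a t ht s hs) (continuousOn_swap D.cont_as) hy hs hK
        (by simp) ht
    have hprod := (𝒢.hasLeftVel_bd ((he t ht).2 s hs)).mul ((hz.2 s hs).mul hys)
    -- The coefficient `b` in the gauge in which `a` and `b 0` vanish is `∂` of the integral of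
    -- the transported 2-form: both have the same derivative in `t`.
    have hgauge : Ad (y s t) (b t s) = Ad (z s)⁻¹ (𝒢.bdL
        (∫ t' in (0 : ℝ)..t, 𝒢.actL (z s * y s t') (β t' s))) + (b 0 s + K t) := by
      have hder1 : ∀ t ∈ Icc (0 : ℝ) 1, HasDerivWithinAt (fun t => Ad (y s t) (b t s))
          (Ad (y s t) (lieBr G (a t s) (b t s) + bt t s)) (Icc 0 1) t := fun t ht =>
        ((hy s hs).2 t ht).hasDerivWithinAt_Ad (D.deriv_b t ht s hs)
      refine eq_of_hasDerivWithinAt_eq (f := fun t => Ad (y s t) (b t s))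
        (g := fun t => Ad (z s)⁻¹ (𝒢.bdL
          (∫ t' in (0 : ℝ)..t, 𝒢.actL (z s * y s t') (β t' s))) + (b 0 s + K t))
        hder1 (fun t ht => ?_) ?_ ht
      · have h1 := hasDerivWithinAt_primitive_zero (continuousOn_slice_right hintegrand hs) ht
        have h2 := (((Ad (z s)⁻¹ : VG →L[ℝ] VG).comp 𝒢.bdL).hasFDerivAt.comp_hasDerivWithinAt
          t h1).add ((hK t ht).const_add (b 0 s))
        convert! h2 using 1
        rw [ContinuousLinearMap.comp_apply, 𝒢.bdL_actL, Ad_mul, ContinuousLinearMap.comp_apply,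
          Ad_inv_Ad, ← map_add, D.curv t ht s hs]
        congr 1
        abel
      · simp [K, (hy s hs).1, Ad_one]
    convert! hprod using 1
    apply (Function.LeftInverse.injective (Ad_inv_Ad (y s t)) : Function.Injective _)
    beta_reduce
    rw [hgauge, map_add, map_add, Ad_Ad_inv, Ad_Ad_inv, mul_inv_rev, Ad_mul,
      ContinuousLinearMap.comp_apply, Ad_Ad_inv]
  · simp only [(he t ht).1, hz.1, (hw t ht).1, map_one, one_mul, mul_one]
    exact (hy 0 h0).eqOn hx ht

/-- Interchanging the roles of the two coordinates inverts the surface-ordered exponential. -/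
theorem isSurf_swap_mul (D : SquareData 𝒢 a b as bt β) {e f : ℝ → ℝ → E}
    (he : IsSurf 𝒢 a b β e)
    (hf : IsSurf 𝒢 (fun t s => b s t) (fun t s => a s t) (fun t s => -β s t) f)
    {t s : ℝ} (ht : t ∈ Icc (0 : ℝ) 1) (hs : s ∈ Icc (0 : ℝ) 1) : e t s * f s t = 1 := by
  have h0 : (0 : ℝ) ∈ Icc (0 : ℝ) 1 := ⟨le_rfl, zero_le_one⟩
  obtain ⟨z, y, hz, hy, he⟩ := he
  obtain ⟨x, w, hx, hw, hf⟩ := hf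
  have hintegrand := D.continuousOn_integrand hz hy
  have hJ := continuousOn_primitive_param hintegrand
  -- The derivative of `e` in the direction of `t`.
  set K : ℝ → ℝ → VE := fun t s =>
    ∫ s' in (0 : ℝ)..s, Ad (e t s') (𝒢.actL (z s' * y s' t) (β t s')) with hKdef
  have het : ∀ t ∈ Icc (0 : ℝ) 1,
      HasLeftVel (fun t => e t s) (Icc 0 1) t (Ad (e t s)⁻¹ (K t s)) := fun t ht => by
    have hAd : ContinuousOn (fun s => Ad (e t s) (𝒢.actL (z s * y s t) (β t s))) (Icc 0 1) :=
      (continuousOn_Ad_comp (he t ht).continuousOn).clm_apply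
        (continuousOn_slice_left hintegrand ht)
    exact IsPOE.hasLeftVel_param
      (a := fun t s => ∫ t' in (0 : ℝ)..t, 𝒢.actL (z s * y s t') (β t' s))
      (a' := fun t s => 𝒢.actL (z s * y s t) (β t s)) (g := e)
      (fun t ht s hs => hasDerivWithinAt_primitive_zero (continuousOn_slice_right hintegrand hs) ht)
      (continuousOn_swap hintegrand) he ht
      (fun s hs => hasDerivWithinAt_primitive_zero hAd hs) (by simp) hs
  have hft : ∀ t ∈ Icc (0 : ℝ) 1,
      HasLeftVel (fun t => f s t) (Icc 0 1) t (-K t s) := fun t ht => by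
    have h1 := (hf s hs).2 t ht
    convert! h1 using 1
    rw [hKdef, ← intervalIntegral.integral_neg]
    refine integral_zero_congr hs fun s' hs' => ?_
    rw [𝒢.Ad_eq_actL, ← ContinuousLinearMap.comp_apply, ← 𝒢.actL_mul, map_neg,
      D.bd_mul hz hy he hx hw ht hs']
  have hconst : f s t * e t s = f s 0 * e 0 s := by
    refine HasVelWithin.eq_of_zero (V := VE) (c := fun t => f s t * e t s) (fun t ht => ?_) ht
    have h1 := (hft t ht).mul (het t ht)
    rw [map_neg, neg_add_cancel] at h1
    unfold HasLeftVel at h1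
    rwa [map_zero] at h1
  have he0 : e 0 s = 1 := by
    refine IsPOE.eqOn (he 0 h0) (h := fun _ => (1 : E)) ⟨rfl, fun s _ => ?_⟩ hs
    beta_reduce
    rw [intervalIntegral.integral_same]
    exact HasLeftVel.const 1
  have hf0 : f s 0 = 1 := (hf s hs).1
  rw [hf0, he0, one_mul] at hconst
  exact mul_eq_one_iff_eq_inv.2 (eq_inv_of_mul_eq_one_right hconst)

end SquareData

theorem IsSurf.eqOn {e e' : ℝ → ℝ → E} (he : IsSurf 𝒢 a b β e) (he' : IsSurf 𝒢 a b β e')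
    {t s : ℝ} (ht : t ∈ Icc (0 : ℝ) 1) (hs : s ∈ Icc (0 : ℝ) 1) : e t s = e' t s := by
  obtain ⟨z, y, hz, hy, he⟩ := he
  obtain ⟨z', y', hz', hy', he'⟩ := he'
  refine HasLeftVel.eq_of_eq_zero (he t ht).2 (fun s hs => ?_)
    ((he t ht).1.trans (he' t ht).1.symm) hs
  have h1 := (he' t ht).2 s hs
  convert! h1 using 1
  refine integral_zero_congr ht fun t' ht' => ?_
  rw [hz.eqOn hz' hs, (hy s hs).eqOn (hy' s hs) ht']

theorem IsSurf.congr {a' b' : ℝ → ℝ → VG} {β' : ℝ → ℝ → VE} {e : ℝ → ℝ → E}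
    (he : IsSurf 𝒢 a b β e) (ha : ∀ t ∈ Icc (0 : ℝ) 1, ∀ s ∈ Icc (0 : ℝ) 1, a' t s = a t s)
    (hb : ∀ s ∈ Icc (0 : ℝ) 1, b' 0 s = b 0 s)
    (hβ : ∀ t ∈ Icc (0 : ℝ) 1, ∀ s ∈ Icc (0 : ℝ) 1, β' t s = β t s) :
    IsSurf 𝒢 a' b' β' e := by
  obtain ⟨z, y, hz, hy, he⟩ := he
  refine ⟨z, y, ⟨hz.1, fun s hs => ?_⟩, fun s hs => ⟨(hy s hs).1, fun t ht => ?_⟩,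
    fun t ht => ⟨(he t ht).1, fun s hs => ?_⟩⟩
  · beta_reduce
    rw [hb s hs]
    exact hz.2 s hs
  · beta_reduce
    rw [ha t ht s hs]
    exact (hy s hs).2 t ht
  · have h1 := (he t ht).2 s hs
    convert! h1 using 1
    exact integral_zero_congr ht fun t' ht' => by rw [hβ t' ht' s hs]

/-- Reversal of time. -/
theorem HasVelWithin.reverse {V : Type*} [NormedAddCommGroup V] [NormedSpace ℝ V]
    {N : Type*} [TopologicalSpace N] [ChartedSpace V N] {c : ℝ → N} {t : ℝ} {v : V}
    (h : HasVelWithin c (Icc 0 1) (1 - t) v) :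
    HasVelWithin (fun t => c (1 - t)) (Icc 0 1) t (-v) := by
  have h1 : HasMFDerivWithinAt 𝓘(ℝ, ℝ) 𝓘(ℝ, ℝ) (fun t : ℝ => 1 - t) (Icc 0 1) t
      (-ContinuousLinearMap.id ℝ ℝ) :=
    ((hasFDerivWithinAt_id t _).const_sub 1).hasMFDerivWithinAt
  have h2 := HasMFDerivWithinAt.comp t h h1 (fun x hx => ⟨by linarith [hx.2], by linarith [hx.1]⟩)
  have h3 := HasVelWithin.of_hasMFDerivWithinAt
    (D := ((1 : ℝ →L[ℝ] ℝ).smulRight v).comp (-ContinuousLinearMap.id ℝ ℝ)) h2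
  simpa using! h3

theorem HasLeftVel.reverse {g : ℝ → G} {t : ℝ} {X : VG}
    (h : HasLeftVel g (Icc 0 1) (1 - t) X) :
    HasLeftVel (fun t => g (1 - t)) (Icc 0 1) t (-X) := by
  have := HasVelWithin.reverse h
  unfold HasLeftVel
  rwa [map_neg]

theorem one_sub_mem_Icc {t : ℝ} (ht : t ∈ Icc (0 : ℝ) 1) : 1 - t ∈ Icc (0 : ℝ) 1 :=
  ⟨by linarith [ht.2], by linarith [ht.1]⟩

theorem IsPOE.reverse {α : ℝ → VG} {g : ℝ → G} (h : IsPOE α g) :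
    IsPOE (fun t => -α (1 - t)) (fun t => (g 1)⁻¹ * g (1 - t)) :=
  ⟨by simp, fun t ht => (h.2 _ (one_sub_mem_Icc ht)).reverse.const_mul _⟩

/-- Reflecting the square in the horizontal axis moves the base point along the left edge and
inverts the surface-ordered exponential. -/
theorem SquareData.isSurf_reflect (D : SquareData 𝒢 a b as bt β) {z : ℝ → G} {y : ℝ → ℝ → G}
    {e : ℝ → ℝ → E} (hz : IsPOE (fun s => b 0 s) z)
    (hy : ∀ s ∈ Icc (0 : ℝ) 1, IsPOE (fun t => a t s) (y s))
    (he : ∀ t ∈ Icc (0 : ℝ) 1, IsPOE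
      (fun s => ∫ t' in (0 : ℝ)..t, 𝒢.actL (z s * y s t') (β t' s)) (fun s => e t s)) :
    IsSurf 𝒢 (fun t s => a t (1 - s)) (fun t s => -b t (1 - s)) (fun t s => -β t (1 - s))
      (fun t s => 𝒢.act (z 1)⁻¹ ((e t 1)⁻¹ * e t (1 - s))) := by
  refine ⟨_, fun s => y (1 - s), hz.reverse, fun s hs => hy _ (one_sub_mem_Icc hs),
    fun t ht => ⟨by simp, fun s hs => ?_⟩⟩
  have hs' := one_sub_mem_Icc hs
  have h1 := 𝒢.hasLeftVel_act (z 1)⁻¹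
    ((((he t ht).2 _ hs').reverse).const_mul (e t 1)⁻¹)
  convert! h1 using 1
  rw [← intervalIntegral.integral_neg, ← ContinuousLinearMap.intervalIntegral_comp_comm]
  · refine integral_zero_congr ht fun t' ht' => ?_
    rw [map_neg, map_neg, ← ContinuousLinearMap.comp_apply, ← 𝒢.actL_mul, mul_assoc]
  · refine ContinuousOn.intervalIntegrable (ContinuousOn.neg ?_)
    exact (continuousOn_slice_right (D.continuousOn_integrand hz hy) hs').mono
      (uIcc_zero_subset ht)

end SquareLevel

/-! ### Pulling forms back along a square -/

noncomputable section Pullback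

variable {V : Type*} [NormedAddCommGroup V] [NormedSpace ℝ V]
  {N : Type*} [TopologicalSpace N] [ChartedSpace V N]
  {F : Type*} [NormedAddCommGroup F] [NormedSpace ℝ F]

theorem contDiffOn_alternating_apply_one {X : Type*} [NormedAddCommGroup X] [NormedSpace ℝ X]
    {n : WithTop ℕ∞} {S : Set X} {α : X → V [⋀^Fin 1]→L[ℝ] F} {v : X → V}
    (hα : ContDiffOn ℝ n α S) (hv : ContDiffOn ℝ n v S) :
    ContDiffOn ℝ n (fun x => α x ![v x]) S := by
  let L : (V →L[ℝ] F) ≃ₗᵢ[ℝ] (V [⋀^Fin 1]→L[ℝ] F) :=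
    ContinuousAlternatingMap.ofSubsingletonLIE (0 : Fin 1)
  have h1 := (L.symm.contDiff (n := n)).comp_contDiffOn hα
  refine (h1.clm_apply hv).congr fun x _ => ?_
  obtain ⟨l, hl⟩ := L.surjective (α x)
  rw [Function.comp_apply, ← hl, LinearIsometryEquiv.symm_apply_apply]
  rfl

theorem contDiffOn_alternating_apply_two {X : Type*} [NormedAddCommGroup X] [NormedSpace ℝ X]
    {n : WithTop ℕ∞} {S : Set X} {α : X → V [⋀^Fin 2]→L[ℝ] F} {v w : X → V}
    (hα : ContDiffOn ℝ n α S) (hv : ContDiffOn ℝ n v S) (hw : ContDiffOn ℝ n w S) :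
    ContDiffOn ℝ n (fun x => α x ![v x, w x]) S := by
  have h1 := (ContinuousLinearMap.contDiff (𝕜 := ℝ) (E := V [⋀^Fin 2]→L[ℝ] F)
    (F := V →L[ℝ] V [⋀^Fin 1]→L[ℝ] F) (n := n)
    (ContinuousAlternatingMap.curryLeftLI (𝕜 := ℝ) (E := V) (F := F)
      (n := 1)).toContinuousLinearMap).comp_contDiffOn hα
  exact contDiffOn_alternating_apply_one (h1.clm_apply hv) hw

theorem DiffForm.inChart_apply {k : ℕ} (α : DiffForm V N k F) [IsManifold 𝓘(ℝ, V) ∞ N] {x y : N}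
    (hy : y ∈ (extChartAt 𝓘(ℝ, V) x).source) {w w' : Fin k → V}
    (hw : ∀ i, w' i = (md (extChartAt 𝓘(ℝ, V) x) y : V →L[ℝ] V) (w i)) :
    α.inChart x (extChartAt 𝓘(ℝ, V) x y) w' = α y w := by
  have h : w' = fun i => (md (extChartAt 𝓘(ℝ, V) x) y : V →L[ℝ] V) (w i) := funext hw
  have h2 : (fun i => (md (extChartAt 𝓘(ℝ, V) x).symm (extChartAt 𝓘(ℝ, V) x y) : V →L[ℝ] V)
      (w' i)) = w := by
    funext i
    rw [hw, md_symm_md_extChart hy]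
  have h3 : ∀ z : N, z = y → ∀ u : Fin k → V, u = w →
      (show V [⋀^Fin k]→L[ℝ] F from α z) u = (show V [⋀^Fin k]→L[ℝ] F from α y) w := by
    rintro z rfl u rfl
    rfl
  exact h3 _ ((extChartAt 𝓘(ℝ, V) x).left_inv hy) _ h2

theorem DiffForm.extd_apply {k : ℕ} [IsManifold 𝓘(ℝ, V) ∞ N] (α : DiffForm V N k F) (x : N)
    (w : Fin (k + 1) → V) :
    α.extd x w = extDeriv (α.inChart x) (extChartAt 𝓘(ℝ, V) x x) w := by
  have h : (fun i => (md (extChartAt 𝓘(ℝ, V) x) x : V →L[ℝ] V) (w i)) = w := by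
    rw [md_extChart_self]
    rfl
  exact congrArg (extDeriv (α.inChart x) (extChartAt 𝓘(ℝ, V) x x)) h

theorem uniqueDiffOn_unitSquare : UniqueDiffOn ℝ unitSquare :=
  uniqueDiffOn_Icc_zero_one.prod uniqueDiffOn_Icc_zero_one

theorem subset_closure_interior_unitSquare : unitSquare ⊆ closure (interior unitSquare) := by
  have h : unitSquare.Nonempty := ⟨(0, 0), by simp [unitSquare]⟩
  have h1 : Convex ℝ unitSquare := (convex_Icc 0 1).prod (convex_Icc 0 1)
  have h2 : (interior unitSquare).Nonempty := by
    refine ⟨(1 / 2, 1 / 2), ?_⟩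
    rw [unitSquare, interior_prod_eq, interior_Icc]
    norm_num
  rw [h1.closure_interior_eq_closure_of_nonempty_interior h2]
  exact subset_closure

/-- A relatively open part of the unit square which a given map sends into a chart domain. -/
structure IsChartPatch (Φ : ℝ × ℝ → N) (x : N) (S : Set (ℝ × ℝ)) : Prop where
  subset : S ⊆ unitSquare
  mem_nhdsWithin : ∀ q ∈ S, S ∈ nhdsWithin q unitSquare
  uniqueDiffOn : UniqueDiffOn ℝ S
  closure_interior : S ⊆ closure (interior S)
  mapsTo : MapsTo Φ S (extChartAt 𝓘(ℝ, V) x).source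
  contDiffOn : ContDiffOn ℝ ∞ (fun q => extChartAt 𝓘(ℝ, V) x (Φ q)) S

variable [IsManifold 𝓘(ℝ, V) ∞ N] {Φ : ℝ × ℝ → N}

theorem exists_isChartPatch (hΦ : ContMDiffOn 𝓘(ℝ, ℝ × ℝ) 𝓘(ℝ, V) ∞ Φ unitSquare)
    {q : ℝ × ℝ} (hq : q ∈ unitSquare) : ∃ S, q ∈ S ∧ IsChartPatch (V := V) Φ (Φ q) S := by
  obtain ⟨O, hO, hOeq⟩ := continuousOn_iff'.1 hΦ.continuousOn
    (extChartAt 𝓘(ℝ, V) (Φ q)).source (isOpen_extChartAt_source _)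
  have hsub : unitSquare ∩ O ⊆ Φ ⁻¹' (extChartAt 𝓘(ℝ, V) (Φ q)).source := by
    rw [inter_comm, ← hOeq]
    exact inter_subset_left
  have hqO : q ∈ O := by
    have : q ∈ Φ ⁻¹' (extChartAt 𝓘(ℝ, V) (Φ q)).source ∩ unitSquare :=
      ⟨mem_extChartAt_source _, hq⟩
    rw [hOeq] at this
    exact this.1
  refine ⟨unitSquare ∩ O, ⟨hq, hqO⟩, inter_subset_left, fun p hp => ?_,
    uniqueDiffOn_unitSquare.inter hO, ?_, hsub, ?_⟩
  · exact inter_mem_nhdsWithin _ (hO.mem_nhds hp.2)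
  · rw [interior_inter, hO.interior_eq]
    exact (inter_subset_inter_left O subset_closure_interior_unitSquare).trans
      (by rw [inter_comm, inter_comm (interior _)]; exact hO.inter_closure)
  · rw [← contMDiffOn_iff_contDiffOn]
    exact (contMDiffOn_extChartAt (n := ∞)).comp (hΦ.mono inter_subset_left)
      (by simpa using! hsub)

theorem hasVelWithin_comp_line (hΦ : ContMDiffOn 𝓘(ℝ, ℝ × ℝ) 𝓘(ℝ, V) ∞ Φ unitSquare)
    {l : ℝ → ℝ × ℝ} {d : ℝ × ℝ} {t : ℝ} (hl : HasDerivWithinAt l d (Icc 0 1) t)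
    (hmaps : MapsTo l (Icc 0 1) unitSquare) (ht : t ∈ Icc (0 : ℝ) 1) :
    HasVelWithin (V := V) (fun t => Φ (l t)) (Icc 0 1) t
      (velocity (V := V) (fun t => Φ (l t)) t) :=
  HasVelWithin.of_mdifferentiableWithinAt
    (((hΦ _ (hmaps ht)).mdifferentiableWithinAt (by simp)).comp t
      hl.hasFDerivWithinAt.hasMFDerivWithinAt.mdifferentiableWithinAt hmaps)

theorem IsChartPatch.md_velocity {x : N} {S : Set (ℝ × ℝ)} (hS : IsChartPatch (V := V) Φ x S)
    (hΦ : ContMDiffOn 𝓘(ℝ, ℝ × ℝ) 𝓘(ℝ, V) ∞ Φ unitSquare)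
    {l : ℝ → ℝ × ℝ} {d : ℝ × ℝ} {t : ℝ} (hl : HasDerivWithinAt l d (Icc 0 1) t)
    (hmaps : MapsTo l (Icc 0 1) unitSquare) (ht : t ∈ Icc (0 : ℝ) 1) (hlt : l t ∈ S) :
    fderivWithin ℝ (fun q => extChartAt 𝓘(ℝ, V) x (Φ q)) S (l t) d =
      (md (extChartAt 𝓘(ℝ, V) x) (Φ (l t)) : V →L[ℝ] V)
        (velocity (V := V) (fun t => Φ (l t)) t) := by
  have h1 := (hasVelWithin_comp_line hΦ hl hmaps ht).hasDerivWithinAt_extChart (hS.mapsTo hlt)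
  have h2 : HasFDerivWithinAt (fun q => extChartAt 𝓘(ℝ, V) x (Φ q))
      (fderivWithin ℝ (fun q => extChartAt 𝓘(ℝ, V) x (Φ q)) S (l t)) unitSquare (l t) :=
    ((hS.contDiffOn.differentiableOn (by simp) _ hlt).hasFDerivWithinAt).mono_of_mem_nhdsWithin
      (hS.mem_nhdsWithin _ hlt)
  have h3 := h2.comp_hasDerivWithinAt t hl hmaps
  exact (uniqueDiffOn_Icc_zero_one t ht).eq_deriv _ h3 h1

theorem IsChartPatch.form_one {x : N} {S : Set (ℝ × ℝ)} (hS : IsChartPatch (V := V) Φ x S)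
    (hΦ : ContMDiffOn 𝓘(ℝ, ℝ × ℝ) 𝓘(ℝ, V) ∞ Φ unitSquare) (α : DiffForm V N 1 F)
    {l : ℝ → ℝ × ℝ} {d : ℝ × ℝ} {t : ℝ} (hl : HasDerivWithinAt l d (Icc 0 1) t)
    (hmaps : MapsTo l (Icc 0 1) unitSquare) (ht : t ∈ Icc (0 : ℝ) 1) (hlt : l t ∈ S) :
    α (Φ (l t)) ![velocity (V := V) (fun t => Φ (l t)) t] =
      α.inChart x (extChartAt 𝓘(ℝ, V) x (Φ (l t)))
        ![fderivWithin ℝ (fun q => extChartAt 𝓘(ℝ, V) x (Φ q)) S (l t) d] := by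
  refine (α.inChart_apply (hS.mapsTo hlt) fun i => ?_).symm
  fin_cases i
  exact hS.md_velocity hΦ hl hmaps ht hlt

theorem hasDerivWithinAt_hline (t s : ℝ) :
    HasDerivWithinAt (fun t : ℝ => (t, s)) ((1 : ℝ), (0 : ℝ)) (Icc 0 1) t :=
  (hasDerivWithinAt_id t _).prodMk (hasDerivWithinAt_const t _ s)

theorem hasDerivWithinAt_vline (t s : ℝ) :
    HasDerivWithinAt (fun s : ℝ => (t, s)) ((0 : ℝ), (1 : ℝ)) (Icc 0 1) s :=
  (hasDerivWithinAt_const s _ t).prodMk (hasDerivWithinAt_id s _)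

theorem mapsTo_hline {s : ℝ} (hs : s ∈ Icc (0 : ℝ) 1) :
    MapsTo (fun t : ℝ => (t, s)) (Icc 0 1) unitSquare := fun _ ht => ⟨ht, hs⟩

theorem mapsTo_vline {t : ℝ} (ht : t ∈ Icc (0 : ℝ) 1) :
    MapsTo (fun s : ℝ => (t, s)) (Icc 0 1) unitSquare := fun _ hs => ⟨ht, hs⟩

theorem IsChartPatch.form_two {x : N} {S : Set (ℝ × ℝ)} (hS : IsChartPatch (V := V) Φ x S)
    (hΦ : ContMDiffOn 𝓘(ℝ, ℝ × ℝ) 𝓘(ℝ, V) ∞ Φ unitSquare) (B : DiffForm V N 2 F)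
    {q : ℝ × ℝ} (hq : q ∈ S) :
    B (Φ q) ![velocity (V := V) (fun t => Φ (t, q.2)) q.1,
        velocity (V := V) (fun s => Φ (q.1, s)) q.2] =
      B.inChart x (extChartAt 𝓘(ℝ, V) x (Φ q))
        ![fderivWithin ℝ (fun q => extChartAt 𝓘(ℝ, V) x (Φ q)) S q (1, 0),
          fderivWithin ℝ (fun q => extChartAt 𝓘(ℝ, V) x (Φ q)) S q (0, 1)] := by
  have hq' := hS.subset hq
  refine (B.inChart_apply (hS.mapsTo hq) fun i => ?_).symm
  fin_cases i
  · exact hS.md_velocity hΦ (hasDerivWithinAt_hline q.1 q.2) (mapsTo_hline hq'.2) hq'.1 hq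
  · exact hS.md_velocity hΦ (hasDerivWithinAt_vline q.1 q.2) (mapsTo_vline hq'.1) hq'.2 hq

theorem IsChartPatch.mapsTo_target {x : N} {S : Set (ℝ × ℝ)} (hS : IsChartPatch (V := V) Φ x S) :
    MapsTo (fun q => extChartAt 𝓘(ℝ, V) x (Φ q)) S (extChartAt 𝓘(ℝ, V) x).target :=
  fun _ hq => (extChartAt 𝓘(ℝ, V) x).map_source (hS.mapsTo hq)

theorem IsChartPatch.contDiffOn_inChart {k : ℕ} {x : N} {S : Set (ℝ × ℝ)}
    (hS : IsChartPatch (V := V) Φ x S) {α : DiffForm V N k F} (hα : α.IsSmooth) :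
    ContDiffOn ℝ ∞ (fun q => α.inChart x (extChartAt 𝓘(ℝ, V) x (Φ q))) S :=
  (hα x).comp hS.contDiffOn hS.mapsTo_target

theorem IsChartPatch.contDiffOn_fderivWithin {x : N} {S : Set (ℝ × ℝ)}
    (hS : IsChartPatch (V := V) Φ x S) (d : ℝ × ℝ) :
    ContDiffOn ℝ ∞ (fun q => fderivWithin ℝ (fun q => extChartAt 𝓘(ℝ, V) x (Φ q)) S q d) S :=
  (hS.contDiffOn.fderivWithin hS.uniqueDiffOn (by simp)).clm_apply contDiffOn_const

theorem contDiffOn_unitSquare_of_patch {f : ℝ × ℝ → F}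
    (h : ∀ q ∈ unitSquare, ∃ S, q ∈ S ∧ S ∈ nhdsWithin q unitSquare ∧ ContDiffOn ℝ ∞ f S) :
    ContDiffOn ℝ ∞ f unitSquare := fun q hq => by
  obtain ⟨S, hqS, hS, hf⟩ := h q hq
  exact (hf q hqS).mono_of_mem_nhdsWithin hS

theorem contDiffOn_form_hline (hΦ : ContMDiffOn 𝓘(ℝ, ℝ × ℝ) 𝓘(ℝ, V) ∞ Φ unitSquare)
    {α : DiffForm V N 1 F} (hα : α.IsSmooth) :
    ContDiffOn ℝ ∞ (fun q : ℝ × ℝ => α (Φ (q.1, q.2))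
      ![velocity (V := V) (fun t => Φ (t, q.2)) q.1]) unitSquare := by
  refine contDiffOn_unitSquare_of_patch fun q hq => ?_
  obtain ⟨S, hqS, hS⟩ := exists_isChartPatch hΦ hq
  refine ⟨S, hqS, hS.mem_nhdsWithin q hqS, (contDiffOn_alternating_apply_one
    (hS.contDiffOn_inChart hα) (hS.contDiffOn_fderivWithin (1, 0))).congr fun p hp => ?_⟩
  exact hS.form_one hΦ α (hasDerivWithinAt_hline p.1 p.2) (mapsTo_hline (hS.subset hp).2)
    (hS.subset hp).1 hp

theorem contDiffOn_form_vline (hΦ : ContMDiffOn 𝓘(ℝ, ℝ × ℝ) 𝓘(ℝ, V) ∞ Φ unitSquare)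
    {α : DiffForm V N 1 F} (hα : α.IsSmooth) :
    ContDiffOn ℝ ∞ (fun q : ℝ × ℝ => α (Φ (q.1, q.2))
      ![velocity (V := V) (fun s => Φ (q.1, s)) q.2]) unitSquare := by
  refine contDiffOn_unitSquare_of_patch fun q hq => ?_
  obtain ⟨S, hqS, hS⟩ := exists_isChartPatch hΦ hq
  refine ⟨S, hqS, hS.mem_nhdsWithin q hqS, (contDiffOn_alternating_apply_one
    (hS.contDiffOn_inChart hα) (hS.contDiffOn_fderivWithin (0, 1))).congr fun p hp => ?_⟩
  exact hS.form_one hΦ α (hasDerivWithinAt_vline p.1 p.2) (mapsTo_vline (hS.subset hp).1)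
    (hS.subset hp).2 hp

theorem contDiffOn_form_two (hΦ : ContMDiffOn 𝓘(ℝ, ℝ × ℝ) 𝓘(ℝ, V) ∞ Φ unitSquare)
    {B : DiffForm V N 2 F} (hB : B.IsSmooth) :
    ContDiffOn ℝ ∞ (fun q : ℝ × ℝ => B (Φ (q.1, q.2))
      ![velocity (V := V) (fun t => Φ (t, q.2)) q.1,
        velocity (V := V) (fun s => Φ (q.1, s)) q.2]) unitSquare := by
  refine contDiffOn_unitSquare_of_patch fun q hq => ?_
  obtain ⟨S, hqS, hS⟩ := exists_isChartPatch hΦ hq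
  exact ⟨S, hqS, hS.mem_nhdsWithin q hqS, (contDiffOn_alternating_apply_two
    (hS.contDiffOn_inChart hB) (hS.contDiffOn_fderivWithin (1, 0))
    (hS.contDiffOn_fderivWithin (0, 1))).congr fun p hp => hS.form_two hΦ B hp⟩

/-- The exterior derivative commutes with the pull-back along a square. -/
theorem extd_velocity_velocity (hΦ : ContMDiffOn 𝓘(ℝ, ℝ × ℝ) 𝓘(ℝ, V) ∞ Φ unitSquare)
    {α : DiffForm V N 1 F} (hα : α.IsSmooth) {q : ℝ × ℝ} (hq : q ∈ unitSquare) :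
    α.extd (Φ q) ![velocity (V := V) (fun t => Φ (t, q.2)) q.1,
        velocity (V := V) (fun s => Φ (q.1, s)) q.2] =
      fderivWithin ℝ (fun q : ℝ × ℝ => α (Φ (q.1, q.2))
        ![velocity (V := V) (fun s => Φ (q.1, s)) q.2]) unitSquare q (1, 0) -
      fderivWithin ℝ (fun q : ℝ × ℝ => α (Φ (q.1, q.2))
        ![velocity (V := V) (fun t => Φ (t, q.2)) q.1]) unitSquare q (0, 1) := by
  obtain ⟨S, hqS, hS⟩ := exists_isChartPatch hΦ hq
  set x := Φ q with hx
  set φ : ℝ × ℝ → V := fun q => extChartAt 𝓘(ℝ, V) x (Φ q) with hφ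
  set ψ : ℝ × ℝ → (ℝ × ℝ) [⋀^Fin 1]→L[ℝ] F := fun q =>
    (α.inChart x (φ q)).compContinuousLinearMap (fderivWithin ℝ φ S q) with hψ
  have hform : DifferentiableWithinAt ℝ (α.inChart x) (extChartAt 𝓘(ℝ, V) x).target (φ q) :=
    (hα x).differentiableOn (by simp) _ (hS.mapsTo_target hqS)
  have hpull := extDerivWithin_pullback (r := ∞) hform (hS.contDiffOn q hqS)
    (by rw [minSmoothness_of_isRCLikeNormedField]; exact WithTop.coe_le_coe.2 le_top) hS.uniqueDiffOn
    (hS.closure_interior hqS) hqS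
    hS.mapsTo_target
  have hψd : DifferentiableWithinAt ℝ ψ S q :=
    (hform.comp q (hS.contDiffOn.differentiableOn (by simp) q hqS)
      hS.mapsTo_target).continuousAlternatingMapCompContinuousLinearMap
      ((hS.contDiffOn.fderivWithin (m := ∞) hS.uniqueDiffOn (by simp)).differentiableOn
        (by simp) q hqS)
  have hψe : ∀ p d, ψ p ![d] = α.inChart x (φ p) ![fderivWithin ℝ φ S p d] := fun p d => by
    simp only [hψ, ContinuousAlternatingMap.compContinuousLinearMap_apply]
    congr 1
    funext i
    fin_cases i
    rfl
  have hloc : ∀ f : ℝ × ℝ → F, fderivWithin ℝ f unitSquare q = fderivWithin ℝ f S q := fun f => by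
    refine fderivWithin_congr_set ?_
    have := nhdsWithin_eq_iff_eventuallyEq.1
      (le_antisymm (nhdsWithin_le_iff.2 (hS.mem_nhdsWithin q hqS)) (nhdsWithin_mono q hS.subset))
    exact this
  have hu := hS.uniqueDiffOn q hqS
  have ha : ∀ p ∈ S, α (Φ (p.1, p.2)) ![velocity (V := V) (fun t => Φ (t, p.2)) p.1] =
      ψ p ![(1, 0)] := fun p hp => by
    rw [hψe]
    exact hS.form_one hΦ α (hasDerivWithinAt_hline p.1 p.2) (mapsTo_hline (hS.subset hp).2)
      (hS.subset hp).1 hp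
  have hb : ∀ p ∈ S, α (Φ (p.1, p.2)) ![velocity (V := V) (fun s => Φ (p.1, s)) p.2] =
      ψ p ![(0, 1)] := fun p hp => by
    rw [hψe]
    exact hS.form_one hΦ α (hasDerivWithinAt_vline p.1 p.2) (mapsTo_vline (hS.subset hp).1)
      (hS.subset hp).2 hp
  rw [hloc, hloc, fderivWithin_congr hb (hb q hqS), fderivWithin_congr ha (ha q hqS)]
  have h1 := extDerivWithin_apply hψd hu ![(1, 0), (0, 1)]
  have h2 := DFunLike.congr_fun hpull ![(1, 0), (0, 1)]
  have e0 : (0 : Fin 2).removeNth ![((1 : ℝ), (0 : ℝ)), (0, 1)] = ![((0 : ℝ), (1 : ℝ))] := by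
    funext i; fin_cases i; rfl
  have e1 : (1 : Fin 2).removeNth ![((1 : ℝ), (0 : ℝ)), (0, 1)] = ![((1 : ℝ), (0 : ℝ))] := by
    funext i; fin_cases i; rfl
  rw [Fin.sum_univ_two, e0, e1] at h1
  simp only [Fin.val_zero, pow_zero, one_smul, Fin.val_one, pow_one, neg_smul,
    Matrix.cons_val_zero, Matrix.cons_val_one] at h1
  rw [sub_eq_add_neg, ← h1]
  refine Eq.trans ?_ h2.symm
  rw [ContinuousAlternatingMap.compContinuousLinearMap_apply, extDerivWithin,
    fderivWithin_of_isOpen (isOpen_extChartAt_target x) (hS.mapsTo_target hqS)]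
  refine (α.extd_apply x _).trans ?_
  change extDeriv (α.inChart x) (φ q) _ = extDeriv (α.inChart x) (φ q) _
  congr 1
  funext i
  have hid := md_extChart_self (V := V) x
  fin_cases i
  · have h := hS.md_velocity hΦ (hasDerivWithinAt_hline q.1 q.2) (mapsTo_hline hq.2) hq.1 hqS
    change _ = fderivWithin ℝ φ S q (1, 0)
    refine Eq.trans ?_ h.symm
    exact (DFunLike.congr_fun hid _).symm
  · have h := hS.md_velocity hΦ (hasDerivWithinAt_vline q.1 q.2) (mapsTo_vline hq.1) hq.2 hqS
    change _ = fderivWithin ℝ φ S q (0, 1)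
    refine Eq.trans ?_ h.symm
    exact (DFunLike.congr_fun hid _).symm

variable {VG : Type*} [NormedAddCommGroup VG] [NormedSpace ℝ VG] [FiniteDimensional ℝ VG]
  {VE : Type*} [NormedAddCommGroup VE] [NormedSpace ℝ VE] [FiniteDimensional ℝ VE]
  {G : Type*} [TopologicalSpace G] [T2Space G] [ChartedSpace VG G] [Group G]
  [LieGroup 𝓘(ℝ, VG) ∞ G]
  {E : Type*} [TopologicalSpace E] [T2Space E] [ChartedSpace VE E] [Group E]
  [LieGroup 𝓘(ℝ, VE) ∞ E]
  {𝒢 : LieCrossedModule VG VE G E}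

/-- A connection with vanishing fake curvature pulls back to such a connection on the square. -/
theorem exists_squareData (hΦ : ContMDiffOn 𝓘(ℝ, ℝ × ℝ) 𝓘(ℝ, V) ∞ Φ unitSquare)
    {α : DiffForm V N 1 VG} (hα : α.IsSmooth) {B : DiffForm V N 2 VE} (hB : B.IsSmooth)
    (hcurv : ∀ (x : N) (X Y : TangentSpace 𝓘(ℝ, V) x),
      𝒢.bdLie (B x ![X, Y]) = curvature G α x X Y) :
    ∃ as bt, SquareData 𝒢
      (fun t s => α (Φ (t, s)) ![velocity (V := V) (fun t => Φ (t, s)) t])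
      (fun t s => α (Φ (t, s)) ![velocity (V := V) (fun s => Φ (t, s)) s]) as bt
      (fun t s => B (Φ (t, s)) ![velocity (V := V) (fun t => Φ (t, s)) t,
        velocity (V := V) (fun s => Φ (t, s)) s]) := by
  have ha := contDiffOn_form_hline hΦ hα
  have hb := contDiffOn_form_vline hΦ hα
  refine ⟨fun t s => fderivWithin ℝ (fun q : ℝ × ℝ => α (Φ (q.1, q.2))
      ![velocity (V := V) (fun t => Φ (t, q.2)) q.1]) unitSquare (t, s) (0, 1),
    fun t s => fderivWithin ℝ (fun q : ℝ × ℝ => α (Φ (q.1, q.2))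
      ![velocity (V := V) (fun s => Φ (q.1, s)) q.2]) unitSquare (t, s) (1, 0),
    ha.continuousOn, hb.continuousOn,
    (ha.continuousOn_fderivWithin uniqueDiffOn_unitSquare (by simp)).clm_apply continuousOn_const,
    (hb.continuousOn_fderivWithin uniqueDiffOn_unitSquare (by simp)).clm_apply continuousOn_const,
    (contDiffOn_form_two hΦ hB).continuousOn, fun t ht s hs => ?_, fun t ht s hs => ?_,
    fun t ht s hs => ?_⟩
  · exact (ha.differentiableOn (by simp) (t, s) ⟨ht, hs⟩).hasFDerivWithinAt.comp_hasDerivWithinAt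
      s (hasDerivWithinAt_vline t s) (mapsTo_vline ht)
  · exact (hb.differentiableOn (by simp) (t, s) ⟨ht, hs⟩).hasFDerivWithinAt.comp_hasDerivWithinAt
      t (hasDerivWithinAt_hline t s) (mapsTo_hline hs)
  · rw [← extd_velocity_velocity hΦ hα (q := (t, s)) ⟨ht, hs⟩]
    exact hcurv _ _ _

end Pullback

/-! ### Covariance of the local holonomy -/

noncomputable section LocalHolonomy

variable {VG : Type*} [NormedAddCommGroup VG] [NormedSpace ℝ VG] [FiniteDimensional ℝ VG]
  {VE : Type*} [NormedAddCommGroup VE] [NormedSpace ℝ VE] [FiniteDimensional ℝ VE]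
  {VM : Type*} [NormedAddCommGroup VM] [NormedSpace ℝ VM]
  {G : Type*} [TopologicalSpace G] [T2Space G] [ChartedSpace VG G] [Group G]
  [LieGroup 𝓘(ℝ, VG) ∞ G]
  {E : Type*} [TopologicalSpace E] [T2Space E] [ChartedSpace VE E] [Group E]
  [LieGroup 𝓘(ℝ, VE) ∞ E]
  {M : Type*} [TopologicalSpace M] [ChartedSpace VM M] [IsManifold 𝓘(ℝ, VM) ∞ M]
  {𝒢 : LieCrossedModule VG VE G E}

theorem form_one_neg {V : Type*} [NormedAddCommGroup V] [NormedSpace ℝ V]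
    {F : Type*} [NormedAddCommGroup F] [NormedSpace ℝ F] (α : V [⋀^Fin 1]→L[ℝ] F) (v : V) :
    α ![-v] = -α ![v] := by
  have h := α.map_update_smul ![v] 0 (-1) v
  have e : ∀ u : V, Function.update ![v] 0 u = ![u] := fun u => by
    funext i
    fin_cases i
    rfl
  rwa [neg_one_smul, neg_one_smul, e, e] at h

theorem form_two_neg_left {V : Type*} [NormedAddCommGroup V] [NormedSpace ℝ V]
    {F : Type*} [NormedAddCommGroup F] [NormedSpace ℝ F] (α : V [⋀^Fin 2]→L[ℝ] F) (v w : V) :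
    α ![-v, w] = -α ![v, w] := by
  have h := α.map_update_smul ![v, w] 0 (-1) v
  have e : ∀ u : V, Function.update ![v, w] 0 u = ![u, w] := fun u => by
    funext i
    fin_cases i <;> rfl
  rwa [neg_one_smul, neg_one_smul, e, e] at h

theorem form_two_swap {V : Type*} [NormedAddCommGroup V] [NormedSpace ℝ V]
    {F : Type*} [NormedAddCommGroup F] [NormedSpace ℝ F] (α : V [⋀^Fin 2]→L[ℝ] F) (v w : V) :
    α ![v, w] = -α ![w, v] := by
  refine Eq.trans ?_ (α.map_swap ![w, v] (i := 0) (j := 1) (by simp))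
  refine congrArg α ?_
  funext i
  fin_cases i <;> rfl

theorem form_two_neg_right {V : Type*} [NormedAddCommGroup V] [NormedSpace ℝ V]
    {F : Type*} [NormedAddCommGroup F] [NormedSpace ℝ F] (α : V [⋀^Fin 2]→L[ℝ] F) (v w : V) :
    α ![v, -w] = -α ![v, w] := by
  rw [form_two_swap, form_two_neg_left, form_two_swap α v w]

theorem velocity_reverse {V : Type*} [NormedAddCommGroup V] [NormedSpace ℝ V]
    {N : Type*} [TopologicalSpace N] [ChartedSpace V N] {c : ℝ → N} {t : ℝ}
    (hc : HasVelWithin (V := V) c (Icc 0 1) (1 - t) (velocity (V := V) c (1 - t)))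
    (ht : t ∈ Icc (0 : ℝ) 1) :
    (velocity (V := V) (fun t => c (1 - t)) t : V) = -(velocity (V := V) c (1 - t) : V) :=
  hc.reverse.velocity_eq ht

theorem IsPathExp.isPOE {A : DiffForm VM M 1 VG} {γ : ℝ → M} {g : ℝ → G} (h : IsPathExp A γ g) :
    IsPOE (fun t => A (γ t) ![velocity (V := VM) γ t]) g := h

theorem IsPathExp.reverse {A : DiffForm VM M 1 VG} {γ : ℝ → M} {g : ℝ → G}
    (h : IsPathExp A γ g)
    (hγ : ∀ t ∈ Icc (0 : ℝ) 1, HasVelWithin (V := VM) γ (Icc 0 1) t (velocity (V := VM) γ t)) :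
    IsPathExp A (fun t => γ (1 - t)) (fun t => (g 1)⁻¹ * g (1 - t)) := by
  have h1 := IsPOE.reverse h
  refine ⟨h1.1, fun t ht => ?_⟩
  have h2 := h1.2 t ht
  have h3 : A (γ (1 - t)) ![velocity (V := VM) (fun t => γ (1 - t)) t] =
      -A (γ (1 - t)) ![velocity (V := VM) γ (1 - t)] := by
    have := velocity_reverse (hγ _ (one_sub_mem_Icc ht)) ht
    exact (congrArg (fun v : VM => (show VM [⋀^Fin 1]→L[ℝ] VG from A (γ (1 - t))) ![v]) this).trans
      (form_one_neg (V := VM) _ _)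
  rw [h3]
  exact h2

namespace LocalConnectionPair

variable (C : LocalConnectionPair VM 𝒢 M) {Γ : ℝ × ℝ → M}

theorem isHolonomy_exists (hΓ : ContMDiffOn 𝓘(ℝ, ℝ × ℝ) 𝓘(ℝ, VM) ∞ Γ unitSquare) :
    ∃ q : 𝒢.Square, C.IsHolonomy Γ q := by
  have h0 : (0 : ℝ) ∈ Icc (0 : ℝ) 1 := ⟨le_rfl, zero_le_one⟩
  have h1 : (1 : ℝ) ∈ Icc (0 : ℝ) 1 := ⟨zero_le_one, le_rfl⟩
  obtain ⟨as, bt, D⟩ := exists_squareData hΓ C.smooth_A C.smooth_B C.fakeCurvature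
  obtain ⟨e, z, y, hz, hy, he⟩ := D.exists_isSurf
  obtain ⟨x, hx⟩ := exists_isPOE G (continuousOn_slice_left D.cont_a h0)
  have hw : ∀ t, ∃ w : ℝ → G, t ∈ Icc (0 : ℝ) 1 → IsPOE (fun s =>
      C.A (Γ (t, s)) ![velocity (V := VM) (fun s => Γ (t, s)) s]) w := fun t => by
    by_cases ht : t ∈ Icc (0 : ℝ) 1
    · obtain ⟨w, hw⟩ := exists_isPOE G (continuousOn_slice_right D.cont_b ht)
      exact ⟨w, fun _ => hw⟩
    · exact ⟨fun _ => 1, fun h => absurd h ht⟩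
  choose w hw using hw
  have hflat := D.bd_mul hz hy he hx hw h1 h1
  refine ⟨⟨x 1, w 1 1, z 1, y 1 1, e 1 1, ?_⟩, ⟨x, hx, rfl⟩, ⟨w 1, hw 1 h1, rfl⟩,
    ⟨z, hz, rfl⟩, ⟨y 1, hy 1 h1, rfl⟩, ⟨e, ⟨z, y, hz, hy, fun t ht => he t ht⟩, rfl⟩⟩
  rw [mul_assoc, ← hflat, inv_mul_cancel_left]

variable {C}

theorem IsSurfaceExp.isSurf {e : ℝ → ℝ → E} (h : C.IsSurfaceExp Γ e) :
    IsSurf 𝒢 (fun t s => C.A (Γ (t, s)) ![velocity (V := VM) (fun t => Γ (t, s)) t])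
      (fun t s => C.A (Γ (t, s)) ![velocity (V := VM) (fun s => Γ (t, s)) s])
      (fun t s => C.B (Γ (t, s)) ![velocity (V := VM) (fun t => Γ (t, s)) t,
        velocity (V := VM) (fun s => Γ (t, s)) s]) e := h

theorem isSurfaceExp_of_isSurf {e : ℝ → ℝ → E}
    (h : IsSurf 𝒢 (fun t s => C.A (Γ (t, s)) ![velocity (V := VM) (fun t => Γ (t, s)) t])
      (fun t s => C.A (Γ (t, s)) ![velocity (V := VM) (fun s => Γ (t, s)) s])
      (fun t s => C.B (Γ (t, s)) ![velocity (V := VM) (fun t => Γ (t, s)) t,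
        velocity (V := VM) (fun s => Γ (t, s)) s]) e) : C.IsSurfaceExp Γ e := h

theorem IsHolonomy.eq {q q' : 𝒢.Square} (h : C.IsHolonomy Γ q) (h' : C.IsHolonomy Γ q') :
    q = q' := by
  have h1 : (1 : ℝ) ∈ Icc (0 : ℝ) 1 := ⟨zero_le_one, le_rfl⟩
  obtain ⟨⟨g₁, hg₁, e₁⟩, ⟨g₂, hg₂, e₂⟩, ⟨g₃, hg₃, e₃⟩, ⟨g₄, hg₄, e₄⟩, ⟨e, he, e₅⟩⟩ := h
  obtain ⟨⟨k₁, hk₁, f₁⟩, ⟨k₂, hk₂, f₂⟩, ⟨k₃, hk₃, f₃⟩, ⟨k₄, hk₄, f₄⟩, ⟨f, hf, f₅⟩⟩ := h'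
  ext
  · rw [e₁, f₁, hg₁.isPOE.eqOn hk₁.isPOE h1]
  · rw [e₂, f₂, hg₂.isPOE.eqOn hk₂.isPOE h1]
  · rw [e₃, f₃, hg₃.isPOE.eqOn hk₃.isPOE h1]
  · rw [e₄, f₄, hg₄.isPOE.eqOn hk₄.isPOE h1]
  · rw [e₅, f₅, he.isSurf.eqOn hf.isSurf h1 h1]

theorem contMDiffOn_comp_square {r : ℝ × ℝ → ℝ × ℝ}
    (hΓ : ContMDiffOn 𝓘(ℝ, ℝ × ℝ) 𝓘(ℝ, VM) ∞ Γ unitSquare) (hr : ContDiff ℝ ∞ r)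
    (hmaps : MapsTo r unitSquare unitSquare) :
    ContMDiffOn 𝓘(ℝ, ℝ × ℝ) 𝓘(ℝ, VM) ∞ (fun p => Γ (r p)) unitSquare :=
  hΓ.comp hr.contMDiff.contMDiffOn hmaps

theorem IsSurfaceExp.exists_swap (hΓ : ContMDiffOn 𝓘(ℝ, ℝ × ℝ) 𝓘(ℝ, VM) ∞ Γ unitSquare)
    {e : ℝ → ℝ → E} (he : C.IsSurfaceExp Γ e) :
    ∃ f : ℝ → ℝ → E, C.IsSurfaceExp (fun p => Γ (p.2, p.1)) f ∧ f 1 1 = (e 1 1)⁻¹ := by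
  have h1 : (1 : ℝ) ∈ Icc (0 : ℝ) 1 := ⟨zero_le_one, le_rfl⟩
  obtain ⟨as, bt, D⟩ := exists_squareData hΓ C.smooth_A C.smooth_B C.fakeCurvature
  obtain ⟨f, hf⟩ := D.swap.exists_isSurf
  refine ⟨f, isSurfaceExp_of_isSurf (hf.congr (fun t _ s _ => rfl) (fun s _ => rfl)
    fun t _ s _ => ?_), eq_inv_of_mul_eq_one_right (D.isSurf_swap_mul he.isSurf hf h1 h1)⟩
  exact form_two_swap (V := VM) _ _ _

theorem IsHolonomy.swap (hΓ : ContMDiffOn 𝓘(ℝ, ℝ × ℝ) 𝓘(ℝ, VM) ∞ Γ unitSquare)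
    {q : 𝒢.Square} (h : C.IsHolonomy Γ q) : C.IsHolonomy (fun p => Γ (p.2, p.1)) q.swap := by
  obtain ⟨hX, hY, hZ, hW, ⟨e, he, hqe⟩⟩ := h
  obtain ⟨f, hf, hfe⟩ := he.exists_swap hΓ
  exact ⟨hZ, hW, hX, hY, f, hf, by rw [hfe, ← hqe]; rfl⟩

theorem hasVelWithin_vline (hΓ : ContMDiffOn 𝓘(ℝ, ℝ × ℝ) 𝓘(ℝ, VM) ∞ Γ unitSquare)
    {t s : ℝ} (ht : t ∈ Icc (0 : ℝ) 1) (hs : s ∈ Icc (0 : ℝ) 1) :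
    HasVelWithin (V := VM) (fun s => Γ (t, s)) (Icc 0 1) s
      (velocity (V := VM) (fun s => Γ (t, s)) s) :=
  hasVelWithin_comp_line hΓ (hasDerivWithinAt_vline t s) (mapsTo_vline ht) hs

/-- Reflecting the square in the horizontal axis inverts the face and moves its base point along the
left edge. -/
theorem IsSurfaceExp.exists_reflect (hΓ : ContMDiffOn 𝓘(ℝ, ℝ × ℝ) 𝓘(ℝ, VM) ∞ Γ unitSquare)
    {e : ℝ → ℝ → E} (he : C.IsSurfaceExp Γ e) {g : ℝ → G}
    (hg : IsPathExp C.A (fun s => Γ (0, s)) g) :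
    ∃ r : ℝ → ℝ → E, C.IsSurfaceExp (fun p => Γ (p.1, 1 - p.2)) r ∧
      r 1 1 = 𝒢.act (g 1)⁻¹ (e 1 1)⁻¹ := by
  have h0 : (0 : ℝ) ∈ Icc (0 : ℝ) 1 := ⟨le_rfl, zero_le_one⟩
  have h1 : (1 : ℝ) ∈ Icc (0 : ℝ) 1 := ⟨zero_le_one, le_rfl⟩
  obtain ⟨as, bt, D⟩ := exists_squareData hΓ C.smooth_A C.smooth_B C.fakeCurvature
  obtain ⟨z, y, hz, hy, he⟩ := he
  have hrev : ∀ t ∈ Icc (0 : ℝ) 1, ∀ s ∈ Icc (0 : ℝ) 1,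
      (velocity (V := VM) (fun s => Γ (t, 1 - s)) s : VM) =
        -(velocity (V := VM) (fun s => Γ (t, s)) (1 - s) : VM) := fun t ht s hs =>
    velocity_reverse (hasVelWithin_vline hΓ ht (one_sub_mem_Icc hs)) hs
  refine ⟨_, isSurfaceExp_of_isSurf ((D.isSurf_reflect hz hy he).congr (fun t _ s _ => rfl)
    (fun s hs => ?_) fun t ht s hs => ?_), ?_⟩
  · exact (congrArg (fun v : VM => (show VM [⋀^Fin 1]→L[ℝ] VG from C.A (Γ (0, 1 - s))) ![v])
      (hrev 0 h0 s hs)).trans (form_one_neg (V := VM) _ _)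
  · exact (congrArg (fun v : VM => (show VM [⋀^Fin 2]→L[ℝ] VE from C.B (Γ (t, 1 - s)))
      ![(velocity (V := VM) (fun t => Γ (t, 1 - s)) t : VM), v])
      (hrev t ht s hs)).trans (form_two_neg_right (V := VM) _ _ _)
  · have he0 : e 1 0 = 1 := (he 1 h1).1
    have hzg : z 1 = g 1 := IsPOE.eqOn hz hg.isPOE h1
    rw [sub_self, he0, mul_one, hzg]

/-- The rotation is the reflection `s ↦ 1 - s` followed by the interchange of the coordinates; the
two inversions of the face cancel, and the reflection contributes the action of the left edge. -/
theorem IsHolonomy.rot (hΓ : ContMDiffOn 𝓘(ℝ, ℝ × ℝ) 𝓘(ℝ, VM) ∞ Γ unitSquare)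
    {q : 𝒢.Square} (h : C.IsHolonomy Γ q) :
    C.IsHolonomy (fun p => Γ (p.2, 1 - p.1)) q.rot := by
  have h0 : (0 : ℝ) ∈ Icc (0 : ℝ) 1 := ⟨le_rfl, zero_le_one⟩
  have h1 : (1 : ℝ) ∈ Icc (0 : ℝ) 1 := ⟨zero_le_one, le_rfl⟩
  obtain ⟨⟨g₁, hg₁, e₁⟩, ⟨g₂, hg₂, e₂⟩, ⟨g₃, hg₃, e₃⟩, ⟨g₄, hg₄, e₄⟩, ⟨e, he, e₅⟩⟩ := h
  have hrefl : ContMDiffOn 𝓘(ℝ, ℝ × ℝ) 𝓘(ℝ, VM) ∞ (fun p => Γ (p.1, 1 - p.2)) unitSquare :=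
    contMDiffOn_comp_square hΓ (contDiff_fst.prodMk (contDiff_const.sub contDiff_snd))
      fun p hp => ⟨hp.1, one_sub_mem_Icc hp.2⟩
  obtain ⟨r, hr, hr1⟩ := he.exists_reflect hΓ hg₃
  obtain ⟨f, hf, hf1⟩ := hr.exists_swap hrefl
  have hg₂' := hg₂.reverse fun s hs => hasVelWithin_vline hΓ h1 hs
  have hg₃' := hg₃.reverse fun s hs => hasVelWithin_vline hΓ h0 hs
  refine ⟨⟨fun t => (g₃ 1)⁻¹ * g₃ (1 - t), hg₃', ?_⟩, ⟨g₁, by simpa using hg₁, e₁⟩,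
    ⟨g₄, by simpa using hg₄, e₄⟩, ⟨fun t => (g₂ 1)⁻¹ * g₂ (1 - t), hg₂', ?_⟩, ⟨f, hf, ?_⟩⟩
  · beta_reduce
    rw [sub_self, hg₃.1, mul_one, ← e₃]
    rfl
  · beta_reduce
    rw [sub_self, hg₂.1, mul_one, ← e₂]
    rfl
  · rw [hf1, hr1, ← map_inv, inv_inv, ← e₃, ← e₅]
    rfl

/-- Both sides are actions of the dihedral group, so that only its generators have to be
considered. -/
theorem IsHolonomy.transform {Γ : SmoothSquare VM M} {q : 𝒢.Square}
    (h : C.IsHolonomy Γ.toFun q) (r : DihedralGroup 4) :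
    C.IsHolonomy (Γ.transform r).toFun (LieCrossedModule.squareAction 𝒢 r q) := by
  have hmul : ∀ r r' : DihedralGroup 4,
      (∀ (Γ : SmoothSquare VM M) (q : 𝒢.Square), C.IsHolonomy Γ.toFun q →
        C.IsHolonomy (Γ.transform r).toFun (LieCrossedModule.squareAction 𝒢 r q)) →
      (∀ (Γ : SmoothSquare VM M) (q : 𝒢.Square), C.IsHolonomy Γ.toFun q →
        C.IsHolonomy (Γ.transform r').toFun (LieCrossedModule.squareAction 𝒢 r' q)) →
      ∀ (Γ : SmoothSquare VM M) (q : 𝒢.Square), C.IsHolonomy Γ.toFun q →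
        C.IsHolonomy (Γ.transform (r * r')).toFun
          (LieCrossedModule.squareAction 𝒢 (r * r') q) := by
    intro r r' hr hr' Γ q h
    have h1 := hr _ _ (hr' Γ q h)
    have h2 : ((Γ.transform r').transform r).toFun = (Γ.transform (r * r')).toFun := by
      change (Γ.toFun ∘ planeAction r'⁻¹) ∘ planeAction r⁻¹ = Γ.toFun ∘ planeAction (r * r')⁻¹
      rw [mul_inv_rev, map_mul, Equiv.Perm.coe_mul, Function.comp_assoc]
    rw [h2] at h1
    rwa [map_mul, Equiv.Perm.mul_apply]
  have hone : ∀ (Γ : SmoothSquare VM M) (q : 𝒢.Square), C.IsHolonomy Γ.toFun q →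
      C.IsHolonomy (Γ.transform 1).toFun (LieCrossedModule.squareAction 𝒢 1 q) := by
    intro Γ q h
    have h2 : (Γ.transform 1).toFun = Γ.toFun := by
      change Γ.toFun ∘ planeAction 1⁻¹ = Γ.toFun
      rw [inv_one, map_one]
      rfl
    rwa [h2, map_one]
  have hrot : ∀ (Γ : SmoothSquare VM M) (q : 𝒢.Square), C.IsHolonomy Γ.toFun q →
      C.IsHolonomy (Γ.transform (.r 1)).toFun (LieCrossedModule.squareAction 𝒢 (.r 1) q) := by
    intro Γ q h
    have h2 : (Γ.transform (.r 1)).toFun = fun p => Γ.toFun (p.2, 1 - p.1) := by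
      change Γ.toFun ∘ planeAction (DihedralGroup.r 1)⁻¹ = _
      rw [map_inv]
      rfl
    rw [h2]
    exact h.rot Γ.smooth
  have hswap : ∀ (Γ : SmoothSquare VM M) (q : 𝒢.Square), C.IsHolonomy Γ.toFun q →
      C.IsHolonomy (Γ.transform (.sr 0)).toFun (LieCrossedModule.squareAction 𝒢 (.sr 0) q) := by
    intro Γ q h
    exact h.swap Γ.smooth
  have hpow : ∀ (k : ℕ) (Γ : SmoothSquare VM M) (q : 𝒢.Square), C.IsHolonomy Γ.toFun q →
      C.IsHolonomy (Γ.transform (.r 1 ^ k)).toFun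
        (LieCrossedModule.squareAction 𝒢 (.r 1 ^ k) q) := by
    intro k
    induction k with
    | zero => simpa only [pow_zero] using hone
    | succ k ih => simpa only [pow_succ] using hmul _ _ ih hrot
  rcases r with i | i
  · have := hpow i.val Γ q h
    rwa [DihedralGroup.r_one_pow, ZMod.natCast_zmod_val] at this
  · have := hmul _ _ hswap (hpow i.val) Γ q h
    rwa [DihedralGroup.r_one_pow, ZMod.natCast_zmod_val, DihedralGroup.sr_mul_r, zero_add] at this

end LocalConnectionPair

end LocalHolonomy

/-! ### Lifting squares to a principal bundle -/

noncomputable section BundleLifts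

variable {VG : Type*} [NormedAddCommGroup VG] [NormedSpace ℝ VG]
  {VM : Type*} [NormedAddCommGroup VM] [NormedSpace ℝ VM]
  {VP : Type*} [NormedAddCommGroup VP] [NormedSpace ℝ VP]
  {G : Type*} [TopologicalSpace G] [ChartedSpace VG G] [Group G]
  [LieGroup 𝓘(ℝ, VG) ∞ G]
  {M : Type*} [TopologicalSpace M] [ChartedSpace VM M] [IsManifold 𝓘(ℝ, VM) ∞ M]
  {P : Type*} [TopologicalSpace P] [ChartedSpace VP P] [IsManifold 𝓘(ℝ, VP) ∞ P]

namespace SmoothPrincipalBundle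

variable (𝓟 : SmoothPrincipalBundle VG VM VP G M P)

/-- A local trivialization of a smooth principal bundle which is smooth and equivariant. -/
structure IsGoodTriv (e : Bundle.Trivialization G 𝓟.proj) : Prop where
  smooth : ContMDiffOn 𝓘(ℝ, VP) (𝓘(ℝ, VM).prod 𝓘(ℝ, VG)) ∞ e e.source
  smooth_symm : ContMDiffOn (𝓘(ℝ, VM).prod 𝓘(ℝ, VG)) 𝓘(ℝ, VP) ∞
    e.toOpenPartialHomeomorph.symm e.target
  equivariant : ∀ u ∈ e.source, ∀ g : G, e (𝓟.act u g) = ((e u).1, (e u).2 * g)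

theorem exists_isGoodTriv (x : M) : ∃ e : Bundle.Trivialization G 𝓟.proj,
    x ∈ e.baseSet ∧ 𝓟.IsGoodTriv e := by
  obtain ⟨e, hx, h1, h2, h3⟩ := 𝓟.locallyTrivial x
  exact ⟨e, hx, h1, h2, h3⟩

/-- For two points of the same fibre, the element of `G` which moves the first to the second. -/
def diff (u v : P) : G := Classical.epsilon fun g => 𝓟.act u g = v

variable {𝓟}

/-- In a trivialization, the element of `G` which moves `u` to `v` is the quotient of the fibre
coordinates. -/
theorem IsGoodTriv.act_eq {e : Bundle.Trivialization G 𝓟.proj} (he : 𝓟.IsGoodTriv e) {u v : P}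
    (hu : u ∈ e.source) (huv : 𝓟.proj u = 𝓟.proj v) : 𝓟.act u ((e u).2⁻¹ * (e v).2) = v := by
  have hv : v ∈ e.source := by
    rw [e.mem_source] at hu ⊢
    rwa [← huv]
  have hw : 𝓟.act u ((e u).2⁻¹ * (e v).2) ∈ e.source := by
    rw [e.mem_source] at hu ⊢
    rwa [𝓟.proj_act]
  refine e.injOn hw hv ?_
  have h1 := he.equivariant u hu ((e u).2⁻¹ * (e v).2)
  rw [mul_inv_cancel_left] at h1
  refine h1.trans (Prod.ext ?_ rfl)
  exact (e.coe_fst hu).trans (huv.trans (e.coe_fst hv).symm)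

theorem IsGoodTriv.act_injective {e : Bundle.Trivialization G 𝓟.proj} (he : 𝓟.IsGoodTriv e)
    {u : P} (hu : u ∈ e.source) {g h : G} (hgh : 𝓟.act u g = 𝓟.act u h) : g = h := by
  have h1 := congrArg (fun v => (e v).2) hgh
  simpa [he.equivariant u hu] using h1

theorem act_left_injective {u : P} {g h : G} (hgh : 𝓟.act u g = 𝓟.act u h) : g = h := by
  obtain ⟨e, hx, he⟩ := 𝓟.exists_isGoodTriv (𝓟.proj u)
  exact he.act_injective (e.mem_source.2 hx) hgh

theorem act_diff {u v : P} (huv : 𝓟.proj u = 𝓟.proj v) : 𝓟.act u (𝓟.diff u v) = v := by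
  obtain ⟨e, hx, he⟩ := 𝓟.exists_isGoodTriv (𝓟.proj u)
  exact Classical.epsilon_spec (p := fun g => 𝓟.act u g = v) ⟨_, he.act_eq (e.mem_source.2 hx) huv⟩

theorem IsGoodTriv.diff_eq {e : Bundle.Trivialization G 𝓟.proj} (he : 𝓟.IsGoodTriv e) {u v : P}
    (hu : u ∈ e.source) (huv : 𝓟.proj u = 𝓟.proj v) :
    𝓟.diff u v = (e u).2⁻¹ * (e v).2 :=
  he.act_injective hu ((act_diff huv).trans (he.act_eq hu huv).symm)

theorem IsGoodTriv.smooth_snd {e : Bundle.Trivialization G 𝓟.proj} (he : 𝓟.IsGoodTriv e) :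
    ContMDiffOn 𝓘(ℝ, VP) 𝓘(ℝ, VG) ∞ (fun u => (e u).2) e.source :=
  contMDiff_snd.comp_contMDiffOn he.smooth

variable {X : Type*} [NormedAddCommGroup X] [NormedSpace ℝ X] {S : Set X} {f f' : X → P}

/-- The difference of two lifts of the same map depends smoothly on the point. -/
theorem contMDiffOn_diff (hf : ContMDiffOn 𝓘(ℝ, X) 𝓘(ℝ, VP) ∞ f S)
    (hf' : ContMDiffOn 𝓘(ℝ, X) 𝓘(ℝ, VP) ∞ f' S) (hπ : ∀ x ∈ S, 𝓟.proj (f x) = 𝓟.proj (f' x)) :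
    ContMDiffOn 𝓘(ℝ, X) 𝓘(ℝ, VG) ∞ (fun x => 𝓟.diff (f x) (f' x)) S := fun x hx => by
  obtain ⟨e, hex, he⟩ := 𝓟.exists_isGoodTriv (𝓟.proj (f x))
  have hfx : f x ∈ e.source := e.mem_source.2 hex
  have hfx' : f' x ∈ e.source := e.mem_source.2 (by rwa [← hπ x hx])
  have h1 : ContMDiffWithinAt 𝓘(ℝ, X) 𝓘(ℝ, VG) ∞ (fun x => (e (f x)).2) S x :=
    (he.smooth_snd.contMDiffAt (e.open_source.mem_nhds hfx)).comp_contMDiffWithinAt x (hf x hx)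
  have h2 : ContMDiffWithinAt 𝓘(ℝ, X) 𝓘(ℝ, VG) ∞ (fun x => (e (f' x)).2) S x :=
    (he.smooth_snd.contMDiffAt (e.open_source.mem_nhds hfx')).comp_contMDiffWithinAt x (hf' x hx)
  refine (h1.inv.mul h2).congr_of_eventuallyEq ?_ (he.diff_eq hfx (hπ x hx))
  filter_upwards [(hf x hx).continuousWithinAt.preimage_mem_nhdsWithin
    (e.open_source.mem_nhds hfx), self_mem_nhdsWithin] with y hy hyS
  exact he.diff_eq hy (hπ y hyS)

theorem mdifferentiableWithinAt_diff {x : X} (hx : x ∈ S)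
    (hf : MDifferentiableWithinAt 𝓘(ℝ, X) 𝓘(ℝ, VP) f S x)
    (hf' : MDifferentiableWithinAt 𝓘(ℝ, X) 𝓘(ℝ, VP) f' S x)
    (hπ : ∀ x ∈ S, 𝓟.proj (f x) = 𝓟.proj (f' x)) :
    MDifferentiableWithinAt 𝓘(ℝ, X) 𝓘(ℝ, VG) (fun x => 𝓟.diff (f x) (f' x)) S x := by
  obtain ⟨e, hex, he⟩ := 𝓟.exists_isGoodTriv (𝓟.proj (f x))
  have hfx : f x ∈ e.source := e.mem_source.2 hex
  have hfx' : f' x ∈ e.source := e.mem_source.2 (by rwa [← hπ x hx])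
  have h1 : MDifferentiableWithinAt 𝓘(ℝ, X) 𝓘(ℝ, VG) (fun x => (e (f x)).2) S x :=
    ((he.smooth_snd.contMDiffAt (e.open_source.mem_nhds hfx)).mdifferentiableAt
      (by simp)).comp_mdifferentiableWithinAt x hf
  have h2 : MDifferentiableWithinAt 𝓘(ℝ, X) 𝓘(ℝ, VG) (fun x => (e (f' x)).2) S x :=
    ((he.smooth_snd.contMDiffAt (e.open_source.mem_nhds hfx')).mdifferentiableAt
      (by simp)).comp_mdifferentiableWithinAt x hf'
  have hinv : MDifferentiable 𝓘(ℝ, VG) 𝓘(ℝ, VG) (fun x : G => x⁻¹) :=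
    (contMDiff_inv 𝓘(ℝ, VG) ∞).mdifferentiable (by simp)
  have h3 : MDifferentiableWithinAt 𝓘(ℝ, X) 𝓘(ℝ, VG)
      (fun x => (e (f x)).2⁻¹ * (e (f' x)).2) S x :=
    (mdifferentiable_mul_pair _).comp_mdifferentiableWithinAt x
      (((hinv _).comp_mdifferentiableWithinAt x h1).prodMk h2)
  refine h3.congr_of_eventuallyEq ?_ (he.diff_eq hfx (hπ x hx))
  filter_upwards [hf.continuousWithinAt.preimage_mem_nhdsWithin
    (e.open_source.mem_nhds hfx), self_mem_nhdsWithin] with y hy hyS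
  exact he.diff_eq hy (hπ y hyS)

theorem _root_.ContMDiffOn.bundleAct {k : X → G} (hf : ContMDiffOn 𝓘(ℝ, X) 𝓘(ℝ, VP) ∞ f S)
    (hk : ContMDiffOn 𝓘(ℝ, X) 𝓘(ℝ, VG) ∞ k S) :
    ContMDiffOn 𝓘(ℝ, X) 𝓘(ℝ, VP) ∞ (fun x => 𝓟.act (f x) (k x)) S :=
  𝓟.smooth_act.comp_contMDiffOn (hf.prodMk hk)

variable (𝓟) in
/-- The map `Γ` has a smooth lift to `P` over the set `S`. -/
def HasLift (Γ : ℝ × ℝ → M) (S : Set (ℝ × ℝ)) : Prop :=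
  ∃ σ : ℝ × ℝ → P, ContMDiffOn 𝓘(ℝ, ℝ × ℝ) 𝓘(ℝ, VP) ∞ σ S ∧ ∀ q ∈ S, 𝓟.proj (σ q) = Γ q

variable {Γ : ℝ × ℝ → M}

theorem HasLift.mono {S S' : Set (ℝ × ℝ)} (h : 𝓟.HasLift Γ S) (hS : S' ⊆ S) : 𝓟.HasLift Γ S' := by
  obtain ⟨σ, hσ, hπ⟩ := h
  exact ⟨σ, hσ.mono hS, fun q hq => hπ q (hS hq)⟩

theorem HasLift.swap {S : Set (ℝ × ℝ)} (h : 𝓟.HasLift (fun q => Γ q.swap) S) :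
    𝓟.HasLift Γ (Prod.swap ⁻¹' S) := by
  obtain ⟨σ, hσ, hπ⟩ := h
  refine ⟨fun q => σ q.swap, hσ.comp (ContDiff.contMDiff ?_).contMDiffOn subset_rfl, fun q hq => ?_⟩
  · exact contDiff_snd.prodMk contDiff_fst
  · exact hπ _ hq

theorem IsGoodTriv.hasLift {e : Bundle.Trivialization G 𝓟.proj} (he : 𝓟.IsGoodTriv e)
    {S : Set (ℝ × ℝ)} (hΓ : ContMDiffOn 𝓘(ℝ, ℝ × ℝ) 𝓘(ℝ, VM) ∞ Γ S)
    (hS : MapsTo Γ S e.baseSet) : 𝓟.HasLift Γ S := by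
  have hmem : ∀ q ∈ S, (Γ q, (1 : G)) ∈ e.target := fun q hq => e.mem_target.2 (hS hq)
  exact ⟨fun q => e.toOpenPartialHomeomorph.symm (Γ q, 1),
    he.smooth_symm.comp (hΓ.prodMk contMDiffOn_const) hmem,
    fun q hq => e.proj_symm_apply (hmem q hq)⟩

/-- A smooth function which is the identity up to `c` and stays in `[c, d]` afterwards. -/
theorem exists_smooth_arrest {c d : ℝ} (hcd : c < d) : ∃ χ : ℝ → ℝ, ContDiff ℝ ∞ χ ∧
    (∀ t ≤ c, χ t = t) ∧ ∀ t, c ≤ t → c ≤ χ t ∧ χ t ≤ d ∧ χ t ≤ t := by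
  refine ⟨fun t => t - (t - c) * Real.smoothTransition ((t - c) / (d - c)), ?_, ?_, ?_⟩
  · exact contDiff_id.sub ((contDiff_id.sub contDiff_const).mul
      (Real.smoothTransition.contDiff.comp ((contDiff_id.sub contDiff_const).div_const _)))
  · intro t ht
    beta_reduce
    rw [Real.smoothTransition.zero_of_nonpos (div_nonpos_of_nonpos_of_nonneg (by linarith)
      (by linarith)), mul_zero, sub_zero]
  · intro t ht
    have h0 := Real.smoothTransition.nonneg ((t - c) / (d - c))
    have h1 := Real.smoothTransition.le_one ((t - c) / (d - c))
    refine ⟨by nlinarith, ?_, by nlinarith⟩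
    rcases le_total t d with htd | htd
    · nlinarith
    · beta_reduce
      rw [Real.smoothTransition.one_of_one_le ((one_le_div (by linarith)).2 (by linarith))]
      linarith

/-- Two lifts over overlapping strips can be glued: on the second strip, the second lift is
multiplied by the difference of the two, evaluated at a point which stays in the overlap. -/
theorem HasLift.glue {I J : Set ℝ} {c' c d d' : ℝ} (hI : I.OrdConnected) (hc : c ∈ I)
    (hc' : c' < c) (hcd : c < d) (hd : d ≤ d') (h₁ : 𝓟.HasLift Γ ((I ∩ Iic d) ×ˢ J))
    (h₂ : 𝓟.HasLift Γ ((I ∩ Icc c' d') ×ˢ J)) : 𝓟.HasLift Γ ((I ∩ Iic d') ×ˢ J) := by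
  obtain ⟨σ₁, hσ₁, hπ₁⟩ := h₁
  obtain ⟨σ₂, hσ₂, hπ₂⟩ := h₂
  obtain ⟨χ, hχ, hχ1, hχ2⟩ := exists_smooth_arrest hcd
  have hk : ContMDiffOn 𝓘(ℝ, ℝ × ℝ) 𝓘(ℝ, VG) ∞ (fun q => 𝓟.diff (σ₂ q) (σ₁ q))
      ((I ∩ Icc c' d) ×ˢ J) :=
    contMDiffOn_diff (hσ₂.mono fun q hq => ⟨⟨hq.1.1, hq.1.2.1, hq.1.2.2.trans hd⟩, hq.2⟩)
      (hσ₁.mono fun q hq => ⟨⟨hq.1.1, hq.1.2.2⟩, hq.2⟩)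
      fun q hq => (hπ₂ q ⟨⟨hq.1.1, hq.1.2.1, hq.1.2.2.trans hd⟩, hq.2⟩).trans
        (hπ₁ q ⟨⟨hq.1.1, hq.1.2.2⟩, hq.2⟩).symm
  have hpair : ContMDiff 𝓘(ℝ, ℝ × ℝ) 𝓘(ℝ, ℝ × ℝ) ∞ (fun q : ℝ × ℝ => (χ q.1, q.2)) :=
    ((hχ.comp contDiff_fst).prodMk contDiff_snd).contMDiff
  have hmaps : MapsTo (fun q : ℝ × ℝ => (χ q.1, q.2)) ((I ∩ Icc c' d') ×ˢ J)
      ((I ∩ Icc c' d) ×ˢ J) := by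
    rintro ⟨t, s⟩ ⟨⟨htI, ht1, ht2⟩, hs⟩
    refine ⟨?_, hs⟩
    rcases le_total t c with h | h
    · change χ t ∈ _
      rw [hχ1 t h]
      exact ⟨htI, ht1, h.trans hcd.le⟩
    · obtain ⟨h1, h2, h3⟩ := hχ2 t h
      exact ⟨hI.out hc htI ⟨h1, h3⟩, hc'.le.trans h1, h2⟩
  set τ : ℝ × ℝ → P := fun q => 𝓟.act (σ₂ q) (𝓟.diff (σ₂ (χ q.1, q.2)) (σ₁ (χ q.1, q.2))) with hτ
  have hτs : ContMDiffOn 𝓘(ℝ, ℝ × ℝ) 𝓘(ℝ, VP) ∞ τ ((I ∩ Icc c' d') ×ˢ J) :=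
    hσ₂.bundleAct (hk.comp hpair.contMDiffOn hmaps)
  have hτeq : ∀ q ∈ (I ∩ Icc c' d') ×ˢ J, q.1 ≤ c → τ q = σ₁ q := fun q hq hqc => by
    simp only [hτ, hχ1 q.1 hqc]
    exact act_diff ((hπ₂ q hq).trans (hπ₁ q ⟨⟨hq.1.1, hqc.trans hcd.le⟩, hq.2⟩).symm)
  have hστ : ∀ q ∈ (I ∩ Icc c' d') ×ˢ J, (if q.1 ≤ c then σ₁ q else τ q) = τ q := fun q hq => by
    split_ifs with h
    · exact (hτeq q hq h).symm
    · rfl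
  refine ⟨fun q => if q.1 ≤ c then σ₁ q else τ q, fun q hq => ?_, fun q hq => ?_⟩
  · rcases lt_or_ge q.1 c with h | h
    · have hU : {p : ℝ × ℝ | p.1 < c} ∈ nhds q :=
        (isOpen_lt continuous_fst continuous_const).mem_nhds h
      have h1 : ContMDiffWithinAt 𝓘(ℝ, ℝ × ℝ) 𝓘(ℝ, VP) ∞ σ₁ ((I ∩ Iic d') ×ˢ J) q := by
        refine (hσ₁ q ⟨⟨hq.1.1, (h.trans hcd).le⟩, hq.2⟩).mono_of_mem_nhdsWithin ?_
        filter_upwards [self_mem_nhdsWithin, mem_nhdsWithin_of_mem_nhds hU] with p hp hpc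
        exact ⟨⟨hp.1.1, (lt_trans hpc hcd).le⟩, hp.2⟩
      refine h1.congr_of_eventuallyEq ?_ (if_pos h.le)
      filter_upwards [mem_nhdsWithin_of_mem_nhds hU] with p hpc
      exact if_pos (le_of_lt hpc)
    · have hU : {p : ℝ × ℝ | c' < p.1} ∈ nhds q :=
        (isOpen_lt continuous_const continuous_fst).mem_nhds (hc'.trans_le h)
      have hq' : q ∈ (I ∩ Icc c' d') ×ˢ J := ⟨⟨hq.1.1, hc'.le.trans h, hq.1.2⟩, hq.2⟩
      refine ((hτs.congr hστ) q hq').mono_of_mem_nhdsWithin ?_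
      filter_upwards [self_mem_nhdsWithin, mem_nhdsWithin_of_mem_nhds hU] with p hp hpc
      exact ⟨⟨hp.1.1, le_of_lt hpc, hp.1.2⟩, hp.2⟩
  · change 𝓟.proj (if q.1 ≤ c then σ₁ q else τ q) = Γ q
    split_ifs with h
    · exact hπ₁ q ⟨⟨hq.1.1, h.trans hcd.le⟩, hq.2⟩
    · rw [hτ, 𝓟.proj_act]
      exact hπ₂ q ⟨⟨hq.1.1, hc'.le.trans (not_le.1 h).le, hq.1.2⟩, hq.2⟩

/-- Lifts over strips of a fixed width can be glued to a lift over the whole square. -/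
theorem HasLift.of_strips {J : Set ℝ} {δ : ℝ} (hδ : 0 < δ)
    (h : ∀ t ∈ Icc (0 : ℝ) 1, 𝓟.HasLift Γ ((Icc 0 1 ∩ Icc (t - δ) (t + δ)) ×ˢ J)) :
    𝓟.HasLift Γ (Icc 0 1 ×ˢ J) := by
  have key : ∀ n : ℕ, n * δ ≤ 1 → 𝓟.HasLift Γ ((Icc 0 1 ∩ Iic (n * δ + δ)) ×ˢ J) := by
    intro n
    induction n with
    | zero =>
      intro _
      refine (h 0 ⟨le_rfl, zero_le_one⟩).mono (prod_mono_left fun t ht => ⟨ht.1, ?_, ?_⟩)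
      · linarith [ht.1.1]
      · simpa using ht.2
    | succ n ih =>
      intro hn
      push_cast at hn ⊢
      have hnδ : 0 ≤ n * δ := by positivity
      refine HasLift.glue (c' := (n + 1) * δ - δ) (c := (n + 1) * δ - δ / 2) (d := n * δ + δ)
        ordConnected_Icc ⟨?_, ?_⟩ ?_ ?_ ?_ (ih ?_) (h _ ⟨?_, hn⟩) <;> linarith
  obtain ⟨n, hn1, hn2⟩ : ∃ n : ℕ, n * δ ≤ 1 ∧ 1 ≤ n * δ + δ := by
    refine ⟨⌊1 / δ⌋₊, ?_, ?_⟩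
    · have := Nat.floor_le (a := 1 / δ) (by positivity)
      rwa [le_div_iff₀ hδ] at this
    · have := (Nat.lt_floor_add_one (1 / δ)).le
      rw [div_le_iff₀ hδ] at this
      linarith
  exact (key n hn1).mono (prod_mono_left fun t ht => ⟨ht, ht.2.trans hn2⟩)

/-- A smooth square has a smooth lift to the total space, through any given point over its
corner. -/
theorem exists_lift (hΓ : ContMDiffOn 𝓘(ℝ, ℝ × ℝ) 𝓘(ℝ, VM) ∞ Γ unitSquare) {u : P}
    (hu : 𝓟.proj u = Γ (0, 0)) :
    ∃ σ : ℝ × ℝ → P, ContMDiffOn 𝓘(ℝ, ℝ × ℝ) 𝓘(ℝ, VP) ∞ σ unitSquare ∧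
      (∀ q ∈ unitSquare, 𝓟.proj (σ q) = Γ q) ∧ σ (0, 0) = u := by
  have hloc : ∀ q ∈ unitSquare, ∃ O : Set (ℝ × ℝ), IsOpen O ∧ q ∈ O ∧
      𝓟.HasLift Γ (unitSquare ∩ O) := fun q hq => by
    obtain ⟨e, hex, he⟩ := 𝓟.exists_isGoodTriv (Γ q)
    obtain ⟨O, hO, hOeq⟩ := continuousOn_iff'.1 hΓ.continuousOn e.baseSet e.open_baseSet
    rw [inter_comm _ unitSquare, inter_comm _ unitSquare] at hOeq
    refine ⟨O, hO, ?_, he.hasLift (hΓ.mono inter_subset_left) ?_⟩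
    · have : q ∈ unitSquare ∩ Γ ⁻¹' e.baseSet := ⟨hq, hex⟩
      rw [hOeq] at this
      exact this.2
    · rw [← hOeq]
      exact fun p hp => hp.2
  choose! O hO hqO hOlift using hloc
  have hcompact : IsCompact unitSquare := isCompact_Icc.prod isCompact_Icc
  obtain ⟨δ, hδ, hball⟩ := lebesgue_number_lemma_of_metric (c := fun q : unitSquare => O q)
    hcompact (fun q => hO q q.2) (fun q hq => mem_iUnion.2 ⟨⟨q, hq⟩, hqO q hq⟩)
  have hsmall : ∀ s ∈ Icc (0 : ℝ) 1, ∀ t ∈ Icc (0 : ℝ) 1, 𝓟.HasLift Γ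
      ((Icc 0 1 ∩ Icc (t - δ / 2) (t + δ / 2)) ×ˢ (Icc 0 1 ∩ Icc (s - δ / 2) (s + δ / 2))) := by
    intro s hs t ht
    obtain ⟨q, hq⟩ := hball (t, s) ⟨ht, hs⟩
    refine (hOlift q q.2).mono fun p hp => ⟨⟨hp.1.1, hp.2.1⟩, hq ?_⟩
    have h1 : dist p.1 t ≤ δ / 2 := by
      rw [Real.dist_eq, abs_le]
      exact ⟨by linarith [hp.1.2.1], by linarith [hp.1.2.2]⟩
    have h2 : dist p.2 s ≤ δ / 2 := by
      rw [Real.dist_eq, abs_le]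
      exact ⟨by linarith [hp.2.2.1], by linarith [hp.2.2.2]⟩
    rw [Metric.mem_ball, Prod.dist_eq]
    exact (max_le h1 h2).trans_lt (by linarith)
  have hrow : ∀ s ∈ Icc (0 : ℝ) 1, 𝓟.HasLift (fun q => Γ q.swap)
      ((Icc 0 1 ∩ Icc (s - δ / 2) (s + δ / 2)) ×ˢ Icc 0 1) := fun s hs => by
    have h1 := HasLift.of_strips (half_pos hδ) (hsmall s hs)
    refine (HasLift.swap (Γ := fun q => Γ q.swap) h1).mono fun p hp => ⟨hp.2, hp.1⟩
  obtain ⟨σ, hσ, hπ⟩ := (HasLift.swap (HasLift.of_strips (half_pos hδ) hrow)).mono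
    (S' := unitSquare) fun p hp => ⟨hp.2, hp.1⟩
  have h00 : ((0 : ℝ), (0 : ℝ)) ∈ unitSquare := ⟨⟨le_rfl, zero_le_one⟩, le_rfl, zero_le_one⟩
  exact ⟨fun q => 𝓟.act (σ q) (𝓟.diff (σ (0, 0)) u), hσ.bundleAct contMDiffOn_const,
    fun q hq => (𝓟.proj_act _ _).trans (hπ q hq), act_diff ((hπ _ h00).trans hu.symm)⟩

end SmoothPrincipalBundle

end BundleLifts

/-! ### Parallel transport and surface holonomy in a principal bundle -/

noncomputable section BundleHolonomy

variable {VG : Type*} [NormedAddCommGroup VG] [NormedSpace ℝ VG] [FiniteDimensional ℝ VG]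
  {VE : Type*} [NormedAddCommGroup VE] [NormedSpace ℝ VE] [FiniteDimensional ℝ VE]
  {VM : Type*} [NormedAddCommGroup VM] [NormedSpace ℝ VM]
  {VP : Type*} [NormedAddCommGroup VP] [NormedSpace ℝ VP]
  {G : Type*} [TopologicalSpace G] [T2Space G] [ChartedSpace VG G] [Group G]
  [LieGroup 𝓘(ℝ, VG) ∞ G]
  {E : Type*} [TopologicalSpace E] [T2Space E] [ChartedSpace VE E] [Group E]
  [LieGroup 𝓘(ℝ, VE) ∞ E]
  {M : Type*} [TopologicalSpace M] [ChartedSpace VM M] [IsManifold 𝓘(ℝ, VM) ∞ M]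
  {P : Type*} [TopologicalSpace P] [ChartedSpace VP P] [IsManifold 𝓘(ℝ, VP) ∞ P]

namespace SmoothPrincipalBundle

variable (𝓟 : SmoothPrincipalBundle VG VM VP G M P)

/-- The vertical vectors at `u`, as a continuous linear map on the Lie algebra. -/
def vertL (u : P) : VG →L[ℝ] VP := md (fun g : G => 𝓟.act u g) 1

/-- The differential of the right translation by `g` at `u`, as a continuous linear map. -/
def dRL (g : G) (u : P) : VP →L[ℝ] VP := md (fun v : P => 𝓟.act v g) u

/-- The differential of the projection at `u`, as a continuous linear map. -/
def dπ (u : P) : VP →L[ℝ] VM := md 𝓟.proj u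

theorem mdifferentiable_proj : MDifferentiable 𝓘(ℝ, VP) 𝓘(ℝ, VM) 𝓟.proj :=
  𝓟.smooth_proj.mdifferentiable (by simp)

theorem mdifferentiable_act_pair : MDifferentiable (𝓘(ℝ, VP).prod 𝓘(ℝ, VG)) 𝓘(ℝ, VP)
    (fun p : P × G => 𝓟.act p.1 p.2) :=
  𝓟.smooth_act.mdifferentiable (by simp)

theorem mdifferentiable_act_right (u : P) :
    MDifferentiable 𝓘(ℝ, VG) 𝓘(ℝ, VP) (fun g : G => 𝓟.act u g) := by
  have h : ContMDiff 𝓘(ℝ, VG) 𝓘(ℝ, VP) ∞ (fun g : G => 𝓟.act u g) :=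
    𝓟.smooth_act.comp (contMDiff_const.prodMk contMDiff_id)
  exact h.mdifferentiable (by simp)

theorem dπ_vertL (u : P) (A : VG) : 𝓟.dπ u (𝓟.vertL u A) = 0 := by
  have h := md_comp (V := VG) (V' := VP) (V'' := VM) (g := 𝓟.proj)
    (f := fun g : G => 𝓟.act u g) (x := 1) (𝓟.mdifferentiable_proj _)
    (𝓟.mdifferentiable_act_right u _)
  simp only [𝓟.proj_act, 𝓟.act_one] at h
  rw [md_const] at h
  exact (DFunLike.congr_fun h A).symm

theorem md_act_lmul (u : P) (g : G) (X : VG) :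
    (md (fun k : G => 𝓟.act u k) g : VG →L[ℝ] VP) (lmul g X) = 𝓟.vertL (𝓟.act u g) X := by
  have h := md_comp (V := VG) (V' := VG) (V'' := VP) (g := fun k : G => 𝓟.act u k)
    (f := fun k : G => g * k) (x := 1) (𝓟.mdifferentiable_act_right u _)
    (mdifferentiable_lmul _ _)
  simp only [mul_one, 𝓟.act_mul] at h
  exact (DFunLike.congr_fun h X).symm

variable {𝓟}

/-- The Leibniz rule for the right action. -/
theorem _root_.HasVelWithin.bundleAct {h : ℝ → P} {k : ℝ → G} {s : Set ℝ} {t : ℝ} {v : VP} {X : VG}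
    (hh : HasVelWithin h s t v) (hk : HasLeftVel k s t X) :
    HasVelWithin (fun t => 𝓟.act (h t) (k t)) s t
      (𝓟.dRL (k t) (h t) v + 𝓟.vertL (𝓟.act (h t) (k t)) X) := by
  have h1 := HasVelWithin.comp₂ (V'' := VP) hh hk (𝓟.mdifferentiable_act_pair _)
  rw [𝓟.md_act_lmul] at h1
  exact h1

/-- Every tangent vector of the total space is the velocity of a curve. -/
theorem exists_hasVelWithin_univ (u : P) (v : VP) :
    ∃ c : ℝ → P, c 0 = u ∧ HasVelWithin c univ 0 v := by
  set φ := extChartAt 𝓘(ℝ, VP) u with hφ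
  have h1 : HasVelWithin (fun t : ℝ => φ u + t • v) univ 0 v := by
    rw [HasVelWithin.iff_hasDerivWithinAt]
    have := (((hasDerivAt_id (0 : ℝ)).smul_const v).const_add (φ u)).hasDerivWithinAt (s := univ)
    rwa [one_smul] at this
  have h0 : φ u + (0 : ℝ) • v = φ u := by rw [zero_smul, add_zero]
  have h2 := HasVelWithin.comp (V' := VP) (f := φ.symm) h1
    (mdifferentiableAt_extChart_symm (by rw [h0]; exact mem_extChartAt_target u))
  refine ⟨fun t => φ.symm (φ u + t • v), ?_, ?_⟩
  · beta_reduce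
    rw [h0]
    exact extChartAt_to_inv (I := 𝓘(ℝ, VP)) u
  · convert! h2 using 1
    rw [h0, md_extChart_symm_self]
    rfl

/-- The kernel of the differential of the projection consists of the vertical vectors. -/
theorem exists_vertL_eq {u : P} {v : VP} (hv : 𝓟.dπ u v = 0) : ∃ A : VG, 𝓟.vertL u A = v := by
  obtain ⟨c, rfl, hc⟩ := exists_hasVelWithin_univ u v
  obtain ⟨e, hex, he⟩ := 𝓟.exists_isGoodTriv (𝓟.proj (c 0))
  -- On a neighbourhood of `0`, the curve `c` is obtained by the action of a curve in `G` from its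
  -- image `σ` under the projection followed by a local section, which has velocity `0` at `0`.
  set S : Set ℝ := c ⁻¹' e.source with hS
  have hS0 : S ∈ nhds (0 : ℝ) := by
    have := hc.continuousWithinAt.preimage_mem_nhdsWithin
      (e.open_source.mem_nhds (e.mem_source.2 hex))
    rwa [nhdsWithin_univ] at this
  have h0S : (0 : ℝ) ∈ S := mem_of_mem_nhds hS0
  have hsec : ContMDiffAt 𝓘(ℝ, VM) 𝓘(ℝ, VP) ∞
      (fun x => e.toOpenPartialHomeomorph.symm (x, (1 : G))) (𝓟.proj (c 0)) :=
    ContMDiffAt.comp (g := e.toOpenPartialHomeomorph.symm) (f := fun x : M => (x, (1 : G)))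
      (𝓟.proj (c 0)) (he.smooth_symm.contMDiffAt
        (e.open_target.mem_nhds (e.mem_target.2 hex)))
      (contMDiffAt_id.prodMk contMDiffAt_const)
  have hσ := HasVelWithin.comp (V' := VP)
    (HasVelWithin.comp (V' := VM) hc (𝓟.mdifferentiable_proj (c 0)))
    (f := fun x => e.toOpenPartialHomeomorph.symm (x, (1 : G)))
    (hsec.mdifferentiableAt (by simp))
  have hσ0 := hσ.mono (subset_univ S)
  have hπ : ∀ τ ∈ S, 𝓟.proj (e.toOpenPartialHomeomorph.symm (𝓟.proj (c τ), (1 : G))) =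
      𝓟.proj (c τ) := fun τ hτ =>
    e.proj_symm_apply (e.mem_target.2 (e.mem_source.1 hτ))
  have hk := mdifferentiableWithinAt_diff h0S hσ0.mdifferentiableWithinAt
    (hc.mono (subset_univ S)).mdifferentiableWithinAt hπ
  obtain ⟨X, hX⟩ := (HasVelWithin.of_hasMFDerivWithinAt hk.hasMFDerivWithinAt).exists_hasLeftVel
  have h1 := HasVelWithin.bundleAct (𝓟 := 𝓟) hσ0 hX
  have h2 := (h1.congr (fun τ hτ => (act_diff (hπ τ hτ)).symm) (act_diff (hπ 0 h0S)).symm).eq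
    (hc.mono (subset_univ S)) (uniqueDiffWithinAt_of_mem_nhds hS0)
  refine ⟨X, ?_⟩
  change (md 𝓟.proj (c 0) : VP →L[ℝ] VM) v = 0 at hv
  rw [hv, map_zero, map_zero, zero_add, act_diff (hπ 0 h0S)] at h2
  exact h2

theorem isHorizontalLift_iff {θ : DiffForm VP P 1 VG} {u : P} {x : M} (hx : 𝓟.proj u = x)
    {v : VM} {X : VP} : 𝓟.IsHorizontalLift θ u (x := x) v X ↔ θ u ![X] = 0 ∧ 𝓟.dπ u X = v := by
  subst hx
  refine and_congr_right fun _ => ?_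
  constructor
  · intro h
    exact eq_of_heq (Bundle.TotalSpace.mk.inj h).2
  · intro h
    exact congrArg (Bundle.TotalSpace.mk (𝓟.proj u)) h

end SmoothPrincipalBundle

namespace CategoricalConnection

variable {𝒢 : LieCrossedModule VG VE G E} {𝓟 : SmoothPrincipalBundle VG VM VP G M P}
  (C : CategoricalConnection 𝒢 𝓟)

/-- The connection 1-form at `u`, as a linear map. -/
def omegaL (u : P) : VP →L[ℝ] VG :=
  (ContinuousAlternatingMap.ofSubsingletonLIE (𝕜 := ℝ) (E := VP) (F := VG) (0 : Fin 1)).symm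
    (C.omega u)

theorem omegaL_apply (u : P) (X : VP) : C.omegaL u X = C.omega u ![X] := by
  let L : (VP →L[ℝ] VG) ≃ₗᵢ[ℝ] (VP [⋀^Fin 1]→L[ℝ] VG) :=
    ContinuousAlternatingMap.ofSubsingletonLIE (0 : Fin 1)
  have h : ∀ a : VP [⋀^Fin 1]→L[ℝ] VG, L.symm a X = a ![X] := fun a => by
    obtain ⟨l, rfl⟩ := L.surjective a
    rw [LinearIsometryEquiv.symm_apply_apply]
    rfl
  exact h _

theorem omegaL_vertL (u : P) (A : VG) : C.omegaL u (𝓟.vertL u A) = A :=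
  (C.omegaL_apply u _).trans (C.omega_vert A u)

theorem omegaL_dRL (g : G) (u : P) (X : VP) :
    C.omegaL (𝓟.act u g) (𝓟.dRL g u X) = Ad g⁻¹ (C.omegaL u X) := by
  rw [C.omegaL_apply, C.omegaL_apply]
  exact C.omega_equivariant g u X

/-- A tangent vector is determined by its vertical part and its projection. -/
theorem eq_of_omegaL_eq {u : P} {X Y : VP} (hω : C.omegaL u X = C.omegaL u Y)
    (hπ : 𝓟.dπ u X = 𝓟.dπ u Y) : X = Y := by
  obtain ⟨A, hA⟩ := 𝓟.exists_vertL_eq (v := X - Y) (by rw [map_sub, hπ, sub_self])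
  have h1 := C.omegaL_vertL u A
  rw [hA, map_sub, hω, sub_self] at h1
  rw [← h1, map_zero] at hA
  exact sub_eq_zero.1 hA.symm

/-- The horizontal lift of the projection of a tangent vector `X` is the horizontal part
of `X`. -/
theorem horLift_eq {u : P} {x : M} (hx : 𝓟.proj u = x) {v : VM} {X : VP} (hX : 𝓟.dπ u X = v) :
    𝓟.horLift C.omega u (x := x) v = X - 𝓟.vertL u (C.omegaL u X) := by
  have hω : C.omegaL u (X - 𝓟.vertL u (C.omegaL u X)) = 0 := by
    rw [map_sub, omegaL_vertL, sub_self]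
  have hπ : 𝓟.dπ u (X - 𝓟.vertL u (C.omegaL u X)) = v := by
    rw [map_sub, 𝓟.dπ_vertL, sub_zero, hX]
  have h1 := Classical.epsilon_spec (p := 𝓟.IsHorizontalLift C.omega u (x := x) v)
    ⟨_, (𝓟.isHorizontalLift_iff hx).2 ⟨(C.omegaL_apply u _).symm.trans hω, hπ⟩⟩
  have h2 := (𝓟.isHorizontalLift_iff hx).1 h1
  exact C.eq_of_omegaL_eq (((C.omegaL_apply u _).trans h2.1).trans hω.symm) (h2.2.trans hπ.symm)

/-- By horizontality, `m` may be evaluated on any lifts of two tangent vectors instead of the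
horizontal ones. -/
theorem m_horLift {u : P} {x : M} (hx : 𝓟.proj u = x) {v w : VM} {X Y : VP}
    (hX : 𝓟.dπ u X = v) (hY : 𝓟.dπ u Y = w) :
    C.m u ![𝓟.horLift C.omega u (x := x) v, 𝓟.horLift C.omega u (x := x) w] = C.m u ![X, Y] := by
  have h : ∀ Z : VP, 𝓟.horProj C.omega u Z = Z - 𝓟.vertL u (C.omegaL u Z) := fun Z => by
    rw [C.omegaL_apply]
    rfl
  have h1 : (𝓟.horProj C.omega u X : VP) = 𝓟.horLift C.omega u (x := x) v :=
    (h X).trans (C.horLift_eq hx hX).symm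
  have h2 : (𝓟.horProj C.omega u Y : VP) = 𝓟.horLift C.omega u (x := x) w :=
    (h Y).trans (C.horLift_eq hx hY).symm
  exact ((C.m_horizontal u X Y).trans (congrArg₂ (fun a b : VP =>
    (show VP [⋀^Fin 2]→L[ℝ] VE from C.m u) ![a, b]) h1 h2)).symm

theorem dπ_velocity {γ : ℝ → M} {h : ℝ → P} {t : ℝ} {w : VP}
    (hπ : ∀ t ∈ Icc (0 : ℝ) 1, 𝓟.proj (h t) = γ t) (hw : HasVelWithin h (Icc 0 1) t w)
    (ht : t ∈ Icc (0 : ℝ) 1) : 𝓟.dπ (h t) w = velocity (V := VM) γ t := by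
  have h1 := HasVelWithin.comp (V' := VM) hw (𝓟.mdifferentiable_proj (h t))
  exact ((h1.congr (fun x hx => (hπ x hx).symm) (hπ t ht).symm).velocity_eq ht).symm

variable {C}

/-- Parallel transport from a path-ordered exponential in the gauge given by a lift `σ` of the
curve. -/
theorem isParallelTransport_of_hasLeftVel {γ : ℝ → M} {σ : ℝ → P} {v : ℝ → VP} {g : ℝ → G} {u : P}
    (hπ : ∀ t ∈ Icc (0 : ℝ) 1, 𝓟.proj (σ t) = γ t)
    (hσ : ∀ t ∈ Icc (0 : ℝ) 1, HasVelWithin σ (Icc 0 1) t (v t))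
    (hg : ∀ t ∈ Icc (0 : ℝ) 1, HasLeftVel g (Icc 0 1) t (C.omegaL (σ t) (v t)))
    (hu : 𝓟.act (σ 0) (g 0)⁻¹ = u) :
    𝓟.IsParallelTransport C.omega γ u (fun t => 𝓟.act (σ t) (g t)⁻¹) := by
  have hπ' : ∀ t ∈ Icc (0 : ℝ) 1, 𝓟.proj (𝓟.act (σ t) (g t)⁻¹) = γ t := fun t ht =>
    (𝓟.proj_act _ _).trans (hπ t ht)
  refine ⟨hu, fun t ht => ⟨hπ' t ht, ?_⟩⟩
  have hw := HasVelWithin.bundleAct (𝓟 := 𝓟) (hσ t ht)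
    ((hg t ht).inv (uniqueDiffOn_Icc_zero_one t ht))
  have h1 := C.horLift_eq (hπ' t ht) (dπ_velocity hπ' hw ht)
  rw [map_add, C.omegaL_vertL, C.omegaL_dRL, inv_inv, add_neg_cancel, map_zero,
    sub_zero] at h1
  unfold HasVelWithin at hw
  rw [← h1] at hw
  exact hw

/-- Every parallel transport is given by a path-ordered exponential in the gauge given by a lift
of the curve. -/
theorem exists_hasLeftVel_of_isParallelTransport {γ : ℝ → M} {σ h : ℝ → P} {v : ℝ → VP} {u : P}
    (hπ : ∀ t ∈ Icc (0 : ℝ) 1, 𝓟.proj (σ t) = γ t)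
    (hσ : ∀ t ∈ Icc (0 : ℝ) 1, HasVelWithin σ (Icc 0 1) t (v t))
    (hh : 𝓟.IsParallelTransport C.omega γ u h) :
    ∃ g : ℝ → G, (∀ t ∈ Icc (0 : ℝ) 1, h t = 𝓟.act (σ t) (g t)⁻¹) ∧
      ∀ t ∈ Icc (0 : ℝ) 1, HasLeftVel g (Icc 0 1) t (C.omegaL (σ t) (v t)) := by
  have hhπ : ∀ t ∈ Icc (0 : ℝ) 1, 𝓟.proj (h t) = γ t := fun t ht => (hh.2 t ht).1
  have hσh : ∀ t ∈ Icc (0 : ℝ) 1, 𝓟.proj (σ t) = 𝓟.proj (h t) := fun t ht =>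
    (hπ t ht).trans (hhπ t ht).symm
  refine ⟨fun t => (𝓟.diff (σ t) (h t))⁻¹, fun t ht => ?_, fun t ht => ?_⟩
  · rw [inv_inv, SmoothPrincipalBundle.act_diff (hσh t ht)]
  · obtain ⟨w, hwdef⟩ : ∃ w : VP, w = 𝓟.horLift C.omega (h t) (velocity (V := VM) γ t) := ⟨_, rfl⟩
    have hw : HasVelWithin h (Icc 0 1) t w := by
      rw [hwdef]
      exact (hh.2 t ht).2
    have hω : C.omegaL (h t) w = 0 := by
      have h1 : w = w - 𝓟.vertL (h t) (C.omegaL (h t) w) :=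
        hwdef.trans (C.horLift_eq (hhπ t ht) (dπ_velocity hhπ hw ht))
      have h2 := congrArg (C.omegaL (h t)) h1
      rwa [map_sub, C.omegaL_vertL, sub_self] at h2
    obtain ⟨X, hX⟩ := (HasVelWithin.of_hasMFDerivWithinAt
      (SmoothPrincipalBundle.mdifferentiableWithinAt_diff ht (hσ t ht).mdifferentiableWithinAt
        hw.mdifferentiableWithinAt hσh).hasMFDerivWithinAt).exists_hasLeftVel
    have h1 := HasVelWithin.bundleAct (𝓟 := 𝓟) (hσ t ht) hX
    have h2 := (h1.congr (fun τ hτ => (SmoothPrincipalBundle.act_diff (hσh τ hτ)).symm)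
      (SmoothPrincipalBundle.act_diff (hσh t ht)).symm).eq hw (uniqueDiffOn_Icc_zero_one t ht)
    have h3 : C.omegaL (h t) w = Ad (𝓟.diff (σ t) (h t))⁻¹
        (C.omegaL (σ t) (v t)) + X := by
      rw [← h2]
      have h4 := C.omegaL_dRL (𝓟.diff (σ t) (h t)) (σ t) (v t)
      have h5 := C.omegaL_vertL (𝓟.act (σ t) (𝓟.diff (σ t) (h t))) X
      rw [SmoothPrincipalBundle.act_diff (hσh t ht)] at h4 h5
      rw [SmoothPrincipalBundle.act_diff (hσh t ht), map_add, h4, h5]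
    have h6 := hX.inv (uniqueDiffOn_Icc_zero_one t ht)
    rw [eq_neg_of_add_eq_zero_right (h3.symm.trans hω), map_neg, neg_neg, Ad_Ad_inv] at h6
    exact h6

theorem m_dRL (g : G) (u : P) (X Y : VP) :
    C.m (𝓟.act u g) ![𝓟.dRL g u X, 𝓟.dRL g u Y] = 𝒢.actL g⁻¹ (C.m u ![X, Y]) :=
  C.m_equivariant g u X Y

theorem dπ_dRL (g : G) (u : P) (X : VP) : 𝓟.dπ (𝓟.act u g) (𝓟.dRL g u X) = 𝓟.dπ u X := by
  have h1 : MDifferentiable 𝓘(ℝ, VP) 𝓘(ℝ, VP) (fun v : P => 𝓟.act v g) := by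
    have h : ContMDiff 𝓘(ℝ, VP) 𝓘(ℝ, VP) ∞ (fun v : P => 𝓟.act v g) :=
      𝓟.smooth_act.comp (contMDiff_id.prodMk contMDiff_const)
    exact h.mdifferentiable (by simp)
  have h := md_comp (V := VP) (V' := VP) (V'' := VM) (g := 𝓟.proj)
    (f := fun v : P => 𝓟.act v g) (x := u) (𝓟.mdifferentiable_proj _) (h1 _)
  simp only [𝓟.proj_act] at h
  exact (DFunLike.congr_fun h X).symm

/-- In the gauge given by a lift `σ` of the square, the value of `m` on horizontal lifts is the
value on the velocities of `σ`, transported by the action. -/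
theorem m_horLift_act {u p : P} {g : G} (hp : p = 𝓟.act u g⁻¹) {x : M} (hx : 𝓟.proj u = x)
    {v w : VM} {X Y : VP} (hX : 𝓟.dπ u X = v) (hY : 𝓟.dπ u Y = w) :
    C.m p ![𝓟.horLift C.omega p (x := x) v, 𝓟.horLift C.omega p (x := x) w] =
      𝒢.actL g (C.m u ![X, Y]) := by
  subst hp
  have h1 := C.m_horLift ((𝓟.proj_act u g⁻¹).trans hx) ((dπ_dRL g⁻¹ u X).trans hX)
    ((dπ_dRL g⁻¹ u Y).trans hY)
  refine h1.trans ((m_dRL g⁻¹ u X Y).trans ?_)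
  rw [inv_inv]

theorem _root_.HasLeftVel.of_eq {g : ℝ → G} {s : Set ℝ} {t : ℝ} {X Y : VG}
    (h : HasLeftVel g s t X) (e : X = Y) : HasLeftVel g s t Y := e ▸ h

/-- The surface holonomy of a square is the surface-ordered exponential of the categorical
connection, pulled back along a lift `σ` of the square. -/
theorem isSurfaceHolonomy_iff {Γ : ℝ × ℝ → M} {σ : ℝ × ℝ → P}
    (hσ : ContMDiffOn 𝓘(ℝ, ℝ × ℝ) 𝓘(ℝ, VP) ∞ σ unitSquare)
    (hπ : ∀ q ∈ unitSquare, 𝓟.proj (σ q) = Γ q) {e : ℝ → ℝ → E} :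
    C.IsSurfaceHolonomy Γ (σ (0, 0)) e ↔
      IsSurf 𝒢 (fun t s => C.omega (σ (t, s)) ![velocity (V := VP) (fun t => σ (t, s)) t])
        (fun t s => C.omega (σ (t, s)) ![velocity (V := VP) (fun s => σ (t, s)) s])
        (fun t s => C.m (σ (t, s)) ![velocity (V := VP) (fun t => σ (t, s)) t,
          velocity (V := VP) (fun s => σ (t, s)) s]) e := by
  have h0 : (0 : ℝ) ∈ Icc (0 : ℝ) 1 := ⟨le_rfl, zero_le_one⟩
  have hπt : ∀ s ∈ Icc (0 : ℝ) 1, ∀ t ∈ Icc (0 : ℝ) 1, 𝓟.proj (σ (t, s)) = Γ (t, s) :=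
    fun s hs t ht => hπ _ ⟨ht, hs⟩
  have hvt : ∀ s ∈ Icc (0 : ℝ) 1, ∀ t ∈ Icc (0 : ℝ) 1, HasVelWithin (V := VP)
      (fun t => σ (t, s)) (Icc 0 1) t (velocity (V := VP) (fun t => σ (t, s)) t) :=
    fun s hs t ht => hasVelWithin_comp_line hσ (hasDerivWithinAt_hline t s) (mapsTo_hline hs) ht
  have hvs : ∀ t ∈ Icc (0 : ℝ) 1, ∀ s ∈ Icc (0 : ℝ) 1, HasVelWithin (V := VP)
      (fun s => σ (t, s)) (Icc 0 1) s (velocity (V := VP) (fun s => σ (t, s)) s) :=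
    fun t ht s hs => hasVelWithin_comp_line hσ (hasDerivWithinAt_vline t s) (mapsTo_vline ht) hs
  -- The integrands of the two equations agree.
  have hm : ∀ t ∈ Icc (0 : ℝ) 1, ∀ s ∈ Icc (0 : ℝ) 1, ∀ (p : P) (g : G),
      p = 𝓟.act (σ (t, s)) g⁻¹ →
      C.m p ![𝓟.horLift C.omega p (velocity (V := VM) (fun t => Γ (t, s)) t),
        𝓟.horLift C.omega p (velocity (V := VM) (fun s => Γ (t, s)) s)] =
      𝒢.actL g (C.m (σ (t, s)) ![velocity (V := VP) (fun t => σ (t, s)) t,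
          velocity (V := VP) (fun s => σ (t, s)) s]) := fun t ht s hs p g hp =>
    m_horLift_act hp (hπ _ ⟨ht, hs⟩)
      (dπ_velocity (γ := fun t => Γ (t, s)) (fun t ht => hπ _ ⟨ht, hs⟩) (hvt s hs t ht) ht)
      (dπ_velocity (γ := fun s => Γ (t, s)) (fun s hs => hπ _ ⟨ht, hs⟩) (hvs t ht s hs) hs)
  constructor
  · rintro ⟨c, h, hc, hh, he⟩
    obtain ⟨z, hcz, hz⟩ := exists_hasLeftVel_of_isParallelTransport (C := C)
      (fun s hs => hπ _ ⟨h0, hs⟩) (hvs 0 h0) hc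
    have hy : ∀ s, ∃ y : ℝ → G, s ∈ Icc (0 : ℝ) 1 →
        (∀ t ∈ Icc (0 : ℝ) 1, h s t = 𝓟.act (σ (t, s)) (y t)⁻¹) ∧
        ∀ t ∈ Icc (0 : ℝ) 1, HasLeftVel y (Icc 0 1) t
          (C.omegaL (σ (t, s)) (velocity (V := VP) (fun t => σ (t, s)) t)) := fun s => by
      by_cases hs : s ∈ Icc (0 : ℝ) 1
      · obtain ⟨y, hy⟩ := exists_hasLeftVel_of_isParallelTransport (C := C)
          (hπt s hs) (hvt s hs) (hh s hs)
        exact ⟨y, fun _ => hy⟩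
      · exact ⟨fun _ => 1, fun h => absurd h hs⟩
    choose y hy using hy
    have hz0 : z 0 = 1 := by
      have h1 := (hcz 0 h0).symm.trans hc.1
      rw [← 𝓟.act_one (σ (0, 0)), ← 𝓟.act_mul, one_mul] at h1
      exact inv_eq_one.1 (SmoothPrincipalBundle.act_left_injective h1)
    have hy0 : ∀ s ∈ Icc (0 : ℝ) 1, y s 0 = z s := fun s hs => by
      have h1 := (((hy s hs).1 0 h0).symm.trans (hh s hs).1).trans (hcz s hs)
      exact inv_injective (SmoothPrincipalBundle.act_left_injective h1)
    refine ⟨z, fun s t => (z s)⁻¹ * y s t, ⟨hz0, fun s hs => (hz s hs).of_eq ?_⟩,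
      fun s hs => ⟨?_, fun t ht => (((hy s hs).2 t ht).const_mul _).of_eq ?_⟩,
      fun t ht => ⟨(he t ht).1, fun s hs => ?_⟩⟩
    · exact C.omegaL_apply _ _
    · beta_reduce
      rw [hy0 s hs, inv_mul_cancel]
    · exact C.omegaL_apply _ _
    · refine HasLeftVel.of_eq ((he t ht).2 s hs) (integral_zero_congr ht fun t' ht' => ?_)
      rw [mul_inv_cancel_left]
      exact hm t' ht' s hs _ _ ((hy s hs).1 t' ht')
  · rintro ⟨z, y, hz, hy, he⟩
    refine ⟨fun s => 𝓟.act (σ (0, s)) (z s)⁻¹, fun s t => 𝓟.act (σ (t, s)) (z s * y s t)⁻¹,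
      isParallelTransport_of_hasLeftVel (fun s hs => hπ _ ⟨h0, hs⟩) (hvs 0 h0)
        (fun s hs => (hz.2 s hs).of_eq ?_) ?_,
      fun s hs => isParallelTransport_of_hasLeftVel (hπt s hs) (hvt s hs)
        (fun t ht => (((hy s hs).2 t ht).const_mul _).of_eq ?_) ?_,
      fun t ht => ⟨(he t ht).1, fun s hs => ?_⟩⟩
    · exact (C.omegaL_apply _ _).symm
    · rw [hz.1, inv_one, 𝓟.act_one]
    · exact (C.omegaL_apply _ _).symm
    · rw [(hy s hs).1, mul_one]
    · exact HasLeftVel.of_eq ((he t ht).2 s hs)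
        (integral_zero_congr ht fun t' ht' => (hm t' ht' s hs _ _ rfl).symm)

theorem isTransposedHolonomy_iff {Γ : ℝ × ℝ → M} {u : P} {f : ℝ → ℝ → E} :
    C.IsTransposedHolonomy Γ u f ↔
      C.IsSurfaceHolonomy (fun q => Γ (q.2, q.1)) u (fun s t => f t s) := Iff.rfl

/-- In the gauge given by a lift, the transposed holonomy is the surface-ordered exponential of
the data for the square reflected in the diagonal. -/
theorem isTransposedHolonomy_iff_isSurf {Γ : ℝ × ℝ → M} {σ : ℝ × ℝ → P}
    (hσ : ContMDiffOn 𝓘(ℝ, ℝ × ℝ) 𝓘(ℝ, VP) ∞ σ unitSquare)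
    (hπ : ∀ q ∈ unitSquare, 𝓟.proj (σ q) = Γ q) {f : ℝ → ℝ → E} :
    C.IsTransposedHolonomy Γ (σ (0, 0)) f ↔
      IsSurf 𝒢 (fun t s => C.omega (σ (s, t)) ![velocity (V := VP) (fun t => σ (s, t)) t])
        (fun t s => C.omega (σ (s, t)) ![velocity (V := VP) (fun s => σ (s, t)) s])
        (fun t s => -C.m (σ (s, t)) ![velocity (V := VP) (fun s => σ (s, t)) s,
          velocity (V := VP) (fun t => σ (s, t)) t]) (fun s t => f t s) := by
  have hswap : ContDiff ℝ ∞ (fun q : ℝ × ℝ => (q.2, q.1)) := contDiff_snd.prodMk contDiff_fst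
  have hσ' : ContMDiffOn 𝓘(ℝ, ℝ × ℝ) 𝓘(ℝ, VP) ∞ (fun q : ℝ × ℝ => σ (q.2, q.1)) unitSquare :=
    hσ.comp hswap.contMDiff.contMDiffOn fun q hq => ⟨hq.2, hq.1⟩
  rw [isTransposedHolonomy_iff]
  refine (isSurfaceHolonomy_iff (C := C) (Γ := fun q => Γ (q.2, q.1)) hσ'
    (fun q hq => hπ _ ⟨hq.2, hq.1⟩)).trans
    ⟨fun h => h.congr (fun _ _ _ _ => rfl) (fun _ _ => rfl) fun t _ s _ => ?_,
      fun h => h.congr (fun _ _ _ _ => rfl) (fun _ _ => rfl) fun t _ s _ => ?_⟩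
  · exact (form_two_swap (V := VP) _ _ _).symm
  · exact form_two_swap (V := VP) _ _ _

/-- Both claims follow, in the gauge given by a lift, from the existence of the surface-ordered
exponentials on the unit square and from their being inverse to each other. -/
theorem exists_holonomies_and_mul_eq_one {Γ : ℝ × ℝ → M}
    (hΓ : ContMDiffOn 𝓘(ℝ, ℝ × ℝ) 𝓘(ℝ, VM) ∞ Γ unitSquare) {u : P} (hu : 𝓟.proj u = Γ (0, 0)) :
    (∃ e : ℝ → ℝ → E, C.IsSurfaceHolonomy Γ u e) ∧
    (∃ f : ℝ → ℝ → E, C.IsTransposedHolonomy Γ u f) ∧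
    ∀ e f : ℝ → ℝ → E, C.IsSurfaceHolonomy Γ u e → C.IsTransposedHolonomy Γ u f →
      ∀ t ∈ Icc (0 : ℝ) 1, ∀ s ∈ Icc (0 : ℝ) 1, e t s * f t s = 1 := by
  obtain ⟨σ, hσ, hπ, rfl⟩ := SmoothPrincipalBundle.exists_lift hΓ hu
  obtain ⟨as, bt, D⟩ := exists_squareData hσ C.smooth_omega C.smooth_m C.fakeCurvature
  obtain ⟨e, he⟩ := D.exists_isSurf
  obtain ⟨f, hf⟩ := D.swap.exists_isSurf
  refine ⟨⟨e, (isSurfaceHolonomy_iff hσ hπ).2 he⟩,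
    ⟨fun t s => f s t, (isTransposedHolonomy_iff_isSurf hσ hπ).2 hf⟩,
    fun e f he hf t ht s hs => ?_⟩
  exact D.isSurf_swap_mul ((isSurfaceHolonomy_iff hσ hπ).1 he)
    ((isTransposedHolonomy_iff_isSurf hσ hπ).1 hf) ht hs

end CategoricalConnection

end BundleHolonomy

theorem mainTheorem1
    {VG : Type*} [NormedAddCommGroup VG] [NormedSpace ℝ VG] [FiniteDimensional ℝ VG]
    {VE : Type*} [NormedAddCommGroup VE] [NormedSpace ℝ VE] [FiniteDimensional ℝ VE]
    {VM : Type*} [NormedAddCommGroup VM] [NormedSpace ℝ VM] [FiniteDimensional ℝ VM]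
    {VP : Type*} [NormedAddCommGroup VP] [NormedSpace ℝ VP] [FiniteDimensional ℝ VP]
    {G : Type*} [TopologicalSpace G] [T2Space G] [ChartedSpace VG G] [Group G]
    [LieGroup 𝓘(ℝ, VG) ∞ G]
    {E : Type*} [TopologicalSpace E] [T2Space E] [ChartedSpace VE E] [Group E]
    [LieGroup 𝓘(ℝ, VE) ∞ E]
    {M : Type*} [TopologicalSpace M] [T2Space M] [ChartedSpace VM M] [IsManifold 𝓘(ℝ, VM) ∞ M]
    {P : Type*} [TopologicalSpace P] [T2Space P] [ChartedSpace VP P] [IsManifold 𝓘(ℝ, VP) ∞ P]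
    (𝒢 : LieCrossedModule VG VE G E) :
    -- bundle form
    (∀ (𝓟 : SmoothPrincipalBundle VG VM VP G M P) (C : CategoricalConnection 𝒢 𝓟)
      (Γ : SmoothSquare VM M) (u : P), 𝓟.proj u = Γ.toFun (0, 0) →
      (∃ e : ℝ → ℝ → E, C.IsSurfaceHolonomy Γ.toFun u e) ∧
      (∃ f : ℝ → ℝ → E, C.IsTransposedHolonomy Γ.toFun u f) ∧
      ∀ e f : ℝ → ℝ → E, C.IsSurfaceHolonomy Γ.toFun u e → C.IsTransposedHolonomy Γ.toFun u f →
        ∀ t ∈ Icc (0 : ℝ) 1, ∀ s ∈ Icc (0 : ℝ) 1, e t s * f t s = 1) ∧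
    -- dihedral covariance of the local holonomy
    (∀ C : LocalConnectionPair VM 𝒢 M, ∃ H : SmoothSquare VM M → 𝒢.Square,
      (∀ (Γ : SmoothSquare VM M) (q : 𝒢.Square), C.IsHolonomy Γ.toFun q ↔ q = H Γ) ∧
      ∀ (r : DihedralGroup 4) (Γ : SmoothSquare VM M),
        H (Γ.transform r) = LieCrossedModule.squareAction 𝒢 r (H Γ)) := by
  refine ⟨fun 𝓟 C Γ u hu => CategoricalConnection.exists_holonomies_and_mul_eq_one Γ.smooth hu,
    fun C => ?_⟩
  choose H hH using fun Γ : SmoothSquare VM M => C.isHolonomy_exists Γ.smooth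
  exact ⟨H, fun Γ q => ⟨fun h => h.eq (hH Γ), fun h => h ▸ hH Γ⟩,
    fun r Γ => (hH (Γ.transform r)).eq ((hH Γ).transform r)⟩
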